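/- Consider asynchronous, failure-free message passing networks: the topology is a finite connected simple graph $G=(V,E)$ with $n=|V|$ nodes; the nodes carry distinct identifiers from $\{1,\dots,n\}$; each node $v$ has distinct ports for its incident links; and $G$ is planar, with a combinatorial embedding stored distributively, i.e. each node $v$ stores a cyclic ordering of its incident links, and these orderings (a rotation system) describe an embedding of $G$ in the plane. Initially a node knows only its own identifier, its ports with their cyclic ordering, and a bound $k$ on the diameter of $G$. One arbitrary node, the requesting node, starts the computation; all other nodes act only on receipt of messages. Links deliver every message after a finite delay, not necessarily in order; local computation takes no time, and time is measured in units of the maximal message delay. A rooted tree $(T,F,r)$ (with child-parent relation $F$ and root $r$) together with a labeling $L$ of its vertices $t\in T$ by $(w+1)$-tuples $L(t)=(b^t_1,\dots,b^t_{w+1})$ of vertices of $G$ (repetitions allowed) is an *ordered tree decomposition of $G$ of width $w$* if, with the bags $B(t)=\{b^t_1,\dots,b^t_{w+1}\}$, (1) for every edge $\{u,v\}\in E$ there is $t\in T$ with $\{u,v\}\subseteq B(t)$, and (2) for every $v\in V$ the set $\{t\in T: v\in B(t)\}$ is non-empty and connected in $T$. Its *rank* is the maximal number of children of a vertex of $T$.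 It is *stored distributively* in the network if each bag tuple is stored in some node, as a tuple of identifiers, together with either a mark that it is the root bag or a reference to its parent bag, which is stored in the same node or in a neighbor of it. **Lemma.** There is a deterministic distributed algorithm such that for every $k\in\mathbb N$ there is a constant $C$, depending only on $k$, with the following property. For every connected planar network as above (biconnected or not) of diameter at most $k$ and every choice of the requesting node, every execution of the algorithm is finite and ends with all nodes terminated and with an ordered tree decomposition of $G$ of width $3k$ and rank at most $2$ stored distributively in the network, its root bag being stored in the requesting node. Moreover, in every execution, all events happen by time at most $C\,n$ (TIME $=O(n)$), at most $C$ messages are sent over each link (MSG/LINK $=O(1)$), and every message consists of at most $C\lfloor\log_2 n\rfloor$ bits. -/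

import Mathlib

noncomputable section

/-! ### Rooted trees and ordered tree decompositions -/

/-- `F s t` means that `t` is the parent of `s`; `F` is a rooted tree with root `r`. -/
structure IsRootedTree {T : Type*} (F : T → T → Prop) (r : T) : Prop where
  root_no_parent : ∀ t, ¬ F r t
  unique_parent : ∀ s, s ≠ r → ∃! t, F s t
  reaches_root : ∀ s, Relation.ReflTransGen F s r

/-- The set of tree vertices whose bag `B t` contains the graph vertex `v`. -/
def bagsContaining {V T : Type*} (B : T → Set V) (v : V) : Set T := {t | v ∈ B t}

/-- `(T, F, r, B)` is a tree decomposition of `G`. (A connected subset of the tree is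
non-empty, so every vertex of `G` lies in some bag.) -/
structure IsTreeDecomposition {V T : Type*} (G : SimpleGraph V)
    (F : T → T → Prop) (r : T) (B : T → Set V) : Prop where
  tree : IsRootedTree F r
  edge_covered : ∀ v w, G.Adj v w → ∃ t, v ∈ B t ∧ w ∈ B t
  connected : ∀ v, ((SimpleGraph.fromRel F).induce (bagsContaining B v)).Connected

/-- `(T, F, r, L)` is an ordered tree decomposition of `G` of width `k`: the labels are
`(k+1)`-tuples of vertices, possibly with repetitions, and the sets of their entries are the
bags of a tree decomposition. -/
def IsOrderedTreeDecomposition {V T : Type*} (G : SimpleGraph V) (k : ℕ)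
    (F : T → T → Prop) (r : T) (L : T → Fin (k + 1) → V) : Prop :=
  IsTreeDecomposition G F r (fun t => Set.range (L t))

/-- Every vertex of the (finite) rooted tree has at most `d` children. -/
def RankAtMost {T : Type*} (F : T → T → Prop) (d : ℕ) : Prop :=
  ∀ t, {s | F s t}.Finite ∧ {s | F s t}.ncard ≤ d

/-! ### Networks with a combinatorial embedding -/

/-- A communication network with topology `G` on `n = |V|` nodes: unique identifiers from
`1, …, n`, distinct ports `0, …, deg v - 1` for the links incident to each node `v`, and a cyclic
ordering of the incident links (given on the ports) stored in each node. -/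
structure Network {V : Type*} [Fintype V] (G : SimpleGraph V) where
  ident : V → ℕ
  ident_injective : Function.Injective ident
  ident_mem : ∀ v, ident v ∈ Finset.Icc 1 (Fintype.card V)
  deg : V → ℕ
  port : (v : V) → Fin (deg v) ≃ G.neighborSet v
  /-- The port that follows immediately in the cyclic ordering at `v`. -/
  next : (v : V) → Equiv.Perm (Fin (deg v))
  next_cyclic : ∀ v (i j : Fin (deg v)), (next v).SameCycle i j

namespace Network

variable {V : Type*} [Fintype V] {G : SimpleGraph V}

/-- The arcs of the network. The arc `⟨v, p⟩` leaves `v` through its port `p`. -/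
abbrev Arc (N : Network G) : Type _ := (v : V) × Fin (N.deg v)

/-- The node at the other end of port `p` of `v`. -/
def neighbor (N : Network G) (v : V) (p : Fin (N.deg v)) : V := (N.port v p).1

/-- The arc of the same link in the opposite direction. -/
def opposite (N : Network G) (a : N.Arc) : N.Arc :=
  ⟨N.neighbor a.1 a.2,
    (N.port (N.neighbor a.1 a.2)).symm ⟨a.1, SimpleGraph.Adj.symm (N.port a.1 a.2).2⟩⟩

theorem opposite_involutive (N : Network G) : Function.Involutive N.opposite := by
  have key : ∀ (v : V) (p : Fin (N.deg v)) (w : V) (h : G.Adj v w), w = N.neighbor v p →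
      (⟨v, (N.port v).symm ⟨w, h⟩⟩ : N.Arc) = ⟨v, p⟩ := by
    intro v p w h hw
    subst hw
    congr 1
    exact (N.port v).symm_apply_apply p
  have key2 : ∀ (v u u' : V) (h : G.Adj v u) (h' : G.Adj v u'), u = u' →
      (⟨v, (N.port v).symm ⟨u, h⟩⟩ : N.Arc) = ⟨v, (N.port v).symm ⟨u', h'⟩⟩ := by
    intro v u u' h h' e
    subst e
    rfl
  rintro ⟨v, p⟩
  set w := N.neighbor v p with hw
  have hadj : G.Adj v w := (N.port v p).2
  have hback : N.neighbor w ((N.port w).symm ⟨v, SimpleGraph.Adj.symm hadj⟩) = v := by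
    simp [neighbor]
  have main : ∀ (u : V) (hu : G.Adj u w), u = v →
      (⟨u, (N.port u).symm ⟨w, hu⟩⟩ : N.Arc) = ⟨v, p⟩ := by
    intro u hu e
    subst e
    exact key _ p w hu hw
  exact main _ _ hback

/-- The traversal of the boundaries of the faces: an arc `(u, v)` is followed by the arc `(v, w)`
that is immediately before `(v, u)` in the cyclic ordering at `v`. -/
def faceNext (N : Network G) : Equiv.Perm N.Arc :=
  (N.opposite_involutive.toPerm).trans (Equiv.sigmaCongrRight fun v => (N.next v).symm)

/-- The number of faces of the embedding: each closed boundary walk bounds a face, and so does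
each isolated node. -/
def numFaces (N : Network G) : ℕ :=
  Nat.card (Quotient (Equiv.Perm.SameCycle.setoid N.faceNext)) + Nat.card {v : V // N.deg v = 0}

/-- The cyclic orderings of a connected network are a combinatorial embedding of its topology
into the plane (equivalently, into the sphere): Euler's formula holds. -/
def IsPlanarEmbedding (N : Network G) : Prop :=
  Nat.card V + N.numFaces = Nat.card G.edgeSet + 2

end Network

/-! ### Asynchronous message passing -/

/-- A message is a string of bits, and its size is the length of the string. -/
abbrev Message : Type := List Bool

/-- All that a node knows initially: the bound on the diameter, its own identifier, the number of
its ports, and the cyclic ordering of its ports. -/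
structure LocalInput where
  bound : ℕ
  ident : ℕ
  degree : ℕ
  next : Equiv.Perm (Fin degree)

/-- A place in the reach of a node with `d` ports: the node itself, or the neighbor at a port. -/
inductive Place (d : ℕ) : Type
  | here : Place d
  | across (p : Fin d) : Place d

/-- A bag as it is stored in a node with `d` ports: a `(k+1)`-tuple of node identifiers, and either
`none` (root bag) or a reference to the parent bag, that is, the place where the parent bag is
stored and its position in the list of bags stored there. -/
structure StoredBag (k d : ℕ) where
  tuple : Fin (k + 1) → ℕ
  parent : Option (Place d × ℕ)

/-- A (deterministic) distributed algorithm. Every node runs the same algorithm and may use only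
its local input, its state, and the messages it gets. The requesting node starts the computation
(`start`); every other node is in the state `initial` and acts only when it gets a message
(`receive`). An action changes the state and sends, through each port, finitely many messages. A
node has terminated when `output` is not `none`; its output then never changes. -/
structure DistributedAlgorithm where
  State : Type
  initial : LocalInput → State
  start : (x : LocalInput) → State × (Fin x.degree → List Message)
  receive : (x : LocalInput) → State → Fin x.degree → Message →
    State × (Fin x.degree → List Message)
  output : (x : LocalInput) → State → Option (List (StoredBag (3 * x.bound) x.degree))
  output_stable : ∀ x s p m o, output x s = some o → output x (receive x s p m).1 = some o

namespace Network

variable {V : Type*} [Fintype V] {G : SimpleGraph V}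

/-- What node `v` knows initially, where `k` is the bound on the diameter. -/
def localInput (N : Network G) (k : ℕ) (v : V) : LocalInput where
  bound := k
  ident := N.ident v
  degree := N.deg v
  next := N.next v

/-- A message sent over an arc at some time. -/
structure Packet (N : Network G) where
  arc : N.Arc
  content : Message
  sentAt : ℝ

/-- The packets that arise when node `v` sends the messages `out` at time `t`. -/
def packets (N : Network G) (v : V) (out : Fin (N.deg v) → List Message) (t : ℝ) :
    Multiset N.Packet :=
  ∑ p : Fin (N.deg v), (out p : Multiset Message).map fun m => ⟨⟨v, p⟩, m, t⟩

/-- A configuration of the system: the time of the latest event, the states of the nodes, the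
messages in transit, and a record of all messages sent so far (delivered or not). -/
structure Config (N : Network G) (A : DistributedAlgorithm) where
  time : ℝ
  state : V → A.State
  transit : Multiset N.Packet
  sent : Multiset N.Packet

variable (N : Network G) (A : DistributedAlgorithm) (k : ℕ)

open Classical in
/-- The configuration at time `0`, when the requesting node `r` has started the computation. -/
def startConfig (r : V) : N.Config A where
  time := 0
  state := Function.update (fun v => A.initial (N.localInput k v)) r
    (A.start (N.localInput k r)).1
  transit := N.packets r (A.start (N.localInput k r)).2 0
  sent := N.packets r (A.start (N.localInput k r)).2 0

/-- The action of the receiver when the packet `q` is delivered in configuration `c`. -/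
def reaction (c : N.Config A) (q : N.Packet) :
    A.State × (Fin (N.deg (N.opposite q.arc).1) → List Message) :=
  A.receive (N.localInput k (N.opposite q.arc).1) (c.state (N.opposite q.arc).1)
    (N.opposite q.arc).2 q.content

open Classical in
/-- One event of the asynchronous system: any one packet `q` in transit (links need not keep the
order of the messages) is delivered at a time `t`. The time unit is the maximal delay of a message:
at time `t` no message has been in transit for more than one unit. Local computation takes no
time. -/
def Step (c c' : N.Config A) : Prop :=
  ∃ (q : N.Packet) (rest : Multiset N.Packet) (t : ℝ),
    c.transit = q ::ₘ rest ∧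
    c.time ≤ t ∧ (∀ q' ∈ c.transit, t ≤ q'.sentAt + 1) ∧
    c' = { time := t
           state := Function.update c.state (N.opposite q.arc).1 (N.reaction A k c q).1
           transit := rest + N.packets (N.opposite q.arc).1 (N.reaction A k c q).2 t
           sent := c.sent + N.packets (N.opposite q.arc).1 (N.reaction A k c q).2 t }

/-- The configurations that occur in the executions with requesting node `r`. -/
def Reachable (r : V) (c : N.Config A) : Prop :=
  Relation.ReflTransGen (N.Step A k) (N.startConfig A k r) c

/-- All executions with requesting node `r` are finite. -/
def AlwaysTerminates (r : V) : Prop :=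
  ¬ ∃ e : ℕ → N.Config A, e 0 = N.startConfig A k r ∧ ∀ i, N.Step A k (e i) (e (i + 1))

open Classical in
/-- The number of messages sent so far over the link between `v` and `w`, in both directions. -/
def traffic {N : Network G} {A : DistributedAlgorithm} (c : N.Config A) (v w : V) : ℕ :=
  (c.sent.filter fun q =>
    (q.arc.1 = v ∧ (N.opposite q.arc).1 = w) ∨ (q.arc.1 = w ∧ (N.opposite q.arc).1 = v)).card

/-! ### Tree decompositions stored in the network -/

/-- The node denoted by a place, seen from node `v`. -/
def resolve (N : Network G) (v : V) : Place (N.deg v) → V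
  | .here => v
  | .across p => N.neighbor v p

/-- The vertices of a distributively stored tree: the position `i` in the list stored in `v`. -/
abbrev BagIndex {N : Network G} {w : ℕ} (out : (v : V) → List (StoredBag w (N.deg v))) : Type _ :=
  (v : V) × Fin (out v).length

/-- The child-parent relation given by the stored references. -/
def StoredParent {N : Network G} {w : ℕ} (out : (v : V) → List (StoredBag w (N.deg v)))
    (s t : BagIndex out) : Prop :=
  ∃ l : Place (N.deg s.1), ((out s.1).get s.2).parent = some (l, (t.2 : ℕ)) ∧
    N.resolve s.1 l = t.1

/-- The bags stored in the nodes form an ordered tree decomposition of the topology of width `w`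
and rank at most `2`, with its root bag stored in `r` and marked as the root. -/
def StoresDecomposition (N : Network G) (w : ℕ) (r : V)
    (out : (v : V) → List (StoredBag w (N.deg v))) : Prop :=
  ∃ (root : BagIndex out) (L : BagIndex out → Fin (w + 1) → V),
    root.1 = r ∧ ((out root.1).get root.2).parent = none ∧
    (∀ t i, N.ident (L t i) = ((out t.1).get t.2).tuple i) ∧
    IsOrderedTreeDecomposition G w (StoredParent out) root L ∧
    RankAtMost (StoredParent out) 2

/-- Every node has terminated, and the outputs store an ordered tree decomposition of width `3k`
with its root in `r`. -/
def HasConstructed (r : V) (c : N.Config A) : Prop :=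
  ∃ out : (v : V) → List (StoredBag (3 * k) (N.deg v)),
    (∀ v, A.output (N.localInput k v) (c.state v) = some (out v)) ∧
    N.StoresDecomposition (3 * k) r out

end Network

end

noncomputable section

/-! ### Rotation systems and the tour around a spanning tree. -/

namespace Network

variable {V : Type*} [Fintype V] {G : SimpleGraph V} (N : Network G)

/-! Only one message is ever in transit, so the scheduler can choose nothing but delays: an
execution is the walk of a token, and it takes no more time than there are deliveries
(`Corresponds.step`). A planar network has at most 6n arcs (`card_arc_le`), so a constant number of
messages per arc suffices for all bounds.

Exploration. The token searches depth-first for paths of at most k + 1 nodes from the requesting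
node r. A node that is offered a shorter path than the one it knows adopts it and explores all its
links again. Since lengths decrease, an arc is explored at most k + 1 times. In the end the known
paths form a spanning tree of depth at most k (`ExploreCore.exists_spanningTree`).

Tour. The token then goes around this tree as the rotation system prescribes: it crosses the tree
links and passes by the other links, the chords. The tour is a single cycle through all arcs
(`sameCycle_tour`), so a chord is met at two times. Apart from the count of arcs, planarity is used
only to show that these pairs of times never interleave (`not_crossing`). This is a Jordan curve
theorem, drawn from Euler's formula by linear algebra over ZMod 2 (`exists_coloring`).

Bags. The nested chords divide the tour into regions. The anchor is the tree path from r to the node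
at which the current region will be left: the far end of the innermost open chord, or r if no chord
is open. Each bag consists of the path to the current node and the anchor; when a chord is opened,
the path to its far end is added. Three paths that share r have at most 3k + 1 nodes. Every bag
hangs below its predecessor, except that the bag made when a chord is closed hangs below the one
made when it was opened; hence rank two. Each subtree of the spanning tree is visited during an
interval of the tour (`mem_path_of_between`). Therefore a node that is in a bag but not in its
parent has been in no earlier bag (`not_mem_bag`), and this is the connectivity condition
(`storesDecomposition_of_sequence`).

Locality. When a chord is opened, its far end replies with its own path and remembers the anchor and
the position of the opening bag, which is all that is needed to close the chord
(`tourInvariant_deliver`). -/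

theorem opposite_opposite (a : N.Arc) : N.opposite (N.opposite a) = a :=
  N.opposite_involutive a

theorem adj_opposite (a : N.Arc) : G.Adj a.1 (N.opposite a).1 := (N.port a.1 a.2).2

theorem opposite_ne (a : N.Arc) : N.opposite a ≠ a := fun h => by
  have := N.adj_opposite a
  rw [h] at this
  exact G.irrefl this

theorem arc_ext {a b : N.Arc} (h1 : a.1 = b.1) (h2 : (N.opposite a).1 = (N.opposite b).1) :
    a = b := by
  obtain ⟨v, p⟩ := a
  obtain ⟨w, q⟩ := b
  obtain rfl : v = w := h1
  have : p = q := (N.port v).injective (Subtype.ext h2)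
  rw [this]

theorem exists_arc {v w : V} (h : G.Adj v w) :
    ∃ a : N.Arc, a.1 = v ∧ (N.opposite a).1 = w :=
  ⟨⟨v, (N.port v).symm ⟨w, h⟩⟩, rfl, by simp [opposite, neighbor]⟩

/-- The arc that precedes `a` in the cyclic ordering at its tail. -/
def rotate : Equiv.Perm N.Arc := Equiv.sigmaCongrRight fun v => (N.next v).symm

theorem rotate_fst (a : N.Arc) : (N.rotate a).1 = a.1 := rfl

theorem faceNext_eq (a : N.Arc) : N.faceNext a = N.rotate (N.opposite a) := rfl

/-- A relation that links every arc at `v`, with at most one exception, to its successor links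
all arcs at `v`. -/
theorem rel_of_rel_rotate (R : N.Arc → N.Arc → Prop) (hR : Equivalence R) (v : V)
    (q : Fin (N.deg v)) (h : ∀ p, p ≠ q → R ⟨v, p⟩ (N.rotate ⟨v, p⟩))
    (a b : N.Arc) (ha : a.1 = v) (hb : b.1 = v) : R a b := by
  have key : ∀ n : ℕ, R (N.rotate ⟨v, q⟩) ⟨v, ((N.next v).symm ^ n) ((N.next v).symm q)⟩ := by
    intro n
    induction n with
    | zero => exact hR.refl _
    | succ n ih =>
      -- At the excluded port the rotation is back at its starting point, so no link is needed
      -- there.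
      by_cases e : ((N.next v).symm ^ n) ((N.next v).symm q) = q
      · rw [pow_succ', Equiv.Perm.mul_apply, e]
        exact hR.refl _
      · rw [pow_succ', Equiv.Perm.mul_apply]
        exact hR.trans ih (h _ e)
  have all : ∀ c : N.Arc, c.1 = v → R (N.rotate ⟨v, q⟩) c := by
    rintro ⟨w, p⟩ hw
    obtain rfl : w = v := hw
    have hs : (N.next w)⁻¹.SameCycle ((N.next w).symm q) p :=
      Equiv.Perm.sameCycle_inv.2 (N.next_cyclic w _ p)
    obtain ⟨n, -, hn⟩ := hs.exists_pow_eq'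
    rw [← hn]
    exact key n
  exact hR.trans (hR.symm (all a ha)) (all b hb)

/-- A spanning tree with root `r`, given by the port to the parent of each node and by the paths
from the root. -/
structure SpanningTree (r : V) where
  port : (v : V) → Option (Fin (N.deg v))
  path : V → List V
  port_root : port r = none
  path_root : path r = [r]
  exists_port : ∀ v, v ≠ r → ∃ q, port v = some q
  path_eq : ∀ v q, port v = some q → path v = path (N.neighbor v q) ++ [v]

namespace SpanningTree

variable {N} {r : V} (T : N.SpanningTree r)

/-- The arc leads from a node to its parent. -/
def IsUp (a : N.Arc) : Prop := T.port a.1 = some a.2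

/-- The link of the arc belongs to the tree. -/
def IsTree (a : N.Arc) : Prop := T.IsUp a ∨ T.IsUp (N.opposite a)

theorem isTree_opposite {a : N.Arc} : T.IsTree (N.opposite a) ↔ T.IsTree a := by
  rw [IsTree, IsTree, opposite_opposite, or_comm]

theorem path_of_isUp {a : N.Arc} (h : T.IsUp a) :
    T.path a.1 = T.path (N.opposite a).1 ++ [a.1] := T.path_eq _ _ h

theorem not_isUp_opposite {a : N.Arc} (h : T.IsUp a) : ¬ T.IsUp (N.opposite a) := by
  intro h'
  have h1 := congrArg List.length (T.path_of_isUp h)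
  have h2 := congrArg List.length (T.path_of_isUp h')
  rw [opposite_opposite] at h2
  simp at h1 h2
  omega

theorem ne_root_of_isUp {a : N.Arc} (h : T.IsUp a) : a.1 ≠ r := by
  rcases a with ⟨v, p⟩
  rintro rfl
  have := T.port_root
  simp [IsUp, this] at h

theorem eq_of_isUp {a b : N.Arc} (ha : T.IsUp a) (hb : T.IsUp b) (h : a.1 = b.1) : a = b := by
  rcases a with ⟨v, p⟩
  rcases b with ⟨w, q⟩
  obtain rfl : v = w := h
  have := ha.symm.trans hb
  simp only [Option.some.injEq] at this
  rw [this]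

theorem exists_isUp {v : V} (h : v ≠ r) : ∃ a : N.Arc, a.1 = v ∧ T.IsUp a := by
  obtain ⟨q, hq⟩ := T.exists_port v h
  exact ⟨⟨v, q⟩, rfl, hq⟩

/-- Induction from the root. -/
theorem induction_root {p : V → Prop} (hr : p r)
    (h : ∀ a : N.Arc, T.IsUp a → p (N.opposite a).1 → p a.1) (v : V) : p v := by
  induction hn : (T.path v).length using Nat.strong_induction_on generalizing v with
  | _ n ih =>
    by_cases e : v = r
    · exact e ▸ hr
    · obtain ⟨a, rfl, ha⟩ := T.exists_isUp e
      refine h a ha (ih _ ?_ _ rfl)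
      rw [← hn, T.path_of_isUp ha]
      simp

theorem self_mem_path (v : V) : v ∈ T.path v := by
  induction v using T.induction_root with
  | hr => simp [T.path_root]
  | h a ha _ => simp [T.path_of_isUp ha]

theorem path_head (v : V) : ∃ l, T.path v = r :: l := by
  induction v using T.induction_root with
  | hr => exact ⟨[], T.path_root⟩
  | h a ha ih =>
    obtain ⟨l, hl⟩ := ih
    exact ⟨l ++ [a.1], by rw [T.path_of_isUp ha, hl]; rfl⟩

theorem mem_path_iff_of_isUp {a : N.Arc} (h : T.IsUp a) {x : V} :
    x ∈ T.path a.1 ↔ x ∈ T.path (N.opposite a).1 ∨ x = a.1 := by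
  simp [T.path_of_isUp h]

theorem length_le_of_mem {x v : V} (h : x ∈ T.path v) :
    (T.path x).length ≤ (T.path v).length := by
  induction v using T.induction_root with
  | hr =>
    rw [T.path_root, List.mem_singleton] at h
    rw [h]
  | h a ha ih =>
    rcases (T.mem_path_iff_of_isUp ha).1 h with h | h
    · rw [T.path_of_isUp ha, List.length_append]
      exact (ih h).trans (Nat.le_add_right _ _)
    · rw [h]

theorem not_mem_path_of_isUp {a : N.Arc} (h : T.IsUp a) : a.1 ∉ T.path (N.opposite a).1 := by
  intro hm
  have := T.length_le_of_mem hm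
  rw [T.path_of_isUp h] at this
  simp at this

open Classical in
/-- Reversal of the arcs of the tree. -/
def flip : Equiv.Perm N.Arc :=
  Function.Involutive.toPerm (fun a => if T.IsTree a then N.opposite a else a) fun a => by
    by_cases h : T.IsTree a
    · have h' := T.isTree_opposite.2 h
      simp [h, h', opposite_opposite]
    · simp [h]

theorem flip_apply (a : N.Arc) [Decidable (T.IsTree a)] :
    T.flip a = if T.IsTree a then N.opposite a else a := by
  have : T.flip a = @ite _ (T.IsTree a) (Classical.propDecidable _) (N.opposite a) a := rfl
  rw [this]
  congr

/-- The tour around the tree: it crosses the links of the tree and passes by all others. -/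
def tour : Equiv.Perm N.Arc := T.flip.trans N.rotate

theorem tour_of_isTree {a : N.Arc} (h : T.IsTree a) :
    T.tour a = N.rotate (N.opposite a) := by
  classical
  rw [tour, Equiv.trans_apply, flip_apply, if_pos h]

theorem tour_of_not_isTree {a : N.Arc} (h : ¬ T.IsTree a) : T.tour a = N.rotate a := by
  classical
  rw [tour, Equiv.trans_apply, flip_apply, if_neg h]

/-- Induction from the leaves towards the root. Having come down to `a.1`, the tour passes by the
chords and, by induction, returns from every child, so it rotates through all ports up to the one to
the parent. -/
theorem sameCycle_tour_down {a : N.Arc} (h : T.IsUp a) :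
    T.tour.SameCycle (N.opposite a) a := by
  obtain ⟨B, hB⟩ : ∃ B, ∀ v, (T.path v).length ≤ B :=
    ⟨_, fun v => Finset.le_sup (f := fun v => (T.path v).length) (Finset.mem_univ v)⟩
  induction hn : B - (T.path a.1).length using Nat.strong_induction_on generalizing a with
  | _ n ih =>
    have step : ∀ p, p ≠ a.2 → T.tour.SameCycle ⟨a.1, p⟩ (N.rotate ⟨a.1, p⟩) := by
      intro p hp
      by_cases ht : T.IsTree ⟨a.1, p⟩
      · rcases ht with hu | hu
        · exact absurd (Option.some.inj (hu.symm.trans h)) hp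
        · have h1 := T.path_of_isUp hu
          rw [opposite_opposite] at h1
          have h2 := hB (N.opposite ⟨a.1, p⟩).1
          have h3 := ih _ (by rw [← hn, h1]; rw [h1] at h2; simp at h2 ⊢; omega) hu rfl
          rw [opposite_opposite] at h3
          have h4 := T.tour_of_isTree (Or.inl hu)
          rw [opposite_opposite] at h4
          rw [← h4]
          exact Equiv.Perm.sameCycle_apply_right.2 h3
      · rw [← T.tour_of_not_isTree ht]
        exact Equiv.Perm.sameCycle_apply_right.2 (Equiv.Perm.SameCycle.refl _ _)
    have h1 := N.rel_of_rel_rotate T.tour.SameCycle (Equiv.Perm.SameCycle.equivalence _) a.1 a.2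
      step (N.rotate a) a rfl rfl
    have h2 := T.tour_of_isTree (a := N.opposite a) (Or.inr (by rwa [opposite_opposite]))
    rw [opposite_opposite] at h2
    rw [← h2] at h1
    exact Equiv.Perm.sameCycle_apply_left.1 h1

/-- At a tree link the tour comes back over the same link before it rotates on; it is in one cycle
with the continuation on both sides. -/
theorem sameCycle_tour_rotate (a : N.Arc) : T.tour.SameCycle a (N.rotate a) := by
  by_cases h : T.IsTree a
  · have h2 := T.tour_of_isTree (T.isTree_opposite.2 h)
    rw [opposite_opposite] at h2
    rw [← h2]
    refine Equiv.Perm.sameCycle_apply_right.2 ?_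
    rcases h with h | h
    · exact (T.sameCycle_tour_down h).symm
    · have := T.sameCycle_tour_down h
      rwa [opposite_opposite] at this
  · rw [← T.tour_of_not_isTree h]
    exact Equiv.Perm.sameCycle_apply_right.2 (Equiv.Perm.SameCycle.refl _ _)

/-- The tour is a single closed walk. -/
theorem sameCycle_tour (a b : N.Arc) : T.tour.SameCycle a b := by
  have loc : ∀ c d : N.Arc, c.1 = d.1 → T.tour.SameCycle c d := fun c d h =>
    N.rel_of_rel_rotate T.tour.SameCycle (Equiv.Perm.SameCycle.equivalence _) c.1 c.2
      (fun p _ => T.sameCycle_tour_rotate _) c d rfl h.symm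
  have key : ∀ v, ∀ c : N.Arc, c.1 = v → (∃ d : N.Arc, d.1 = r ∧ T.tour.SameCycle c d) := by
    intro v
    induction v using T.induction_root with
    | hr => exact fun c hc => ⟨c, hc, Equiv.Perm.SameCycle.refl _ _⟩
    | h e he ih =>
      intro c hc
      obtain ⟨d, hd, h1⟩ := ih _ rfl
      exact ⟨d, hd, (loc c e hc).trans ((T.sameCycle_tour_down he).symm.trans h1)⟩
  obtain ⟨c, hc, h1⟩ := key _ a rfl
  obtain ⟨d, hd, h2⟩ := key _ b rfl
  exact h1.trans ((loc c d (hc.trans hd.symm)).trans h2.symm)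

end SpanningTree

/-! ### Jordan curve theorem from Euler's formula. -/

/-- The link of an arc, as an edge of the topology. -/
def edge (a : N.Arc) : Sym2 V := s(a.1, (N.opposite a).1)

theorem edge_mem (a : N.Arc) : N.edge a ∈ G.edgeSet := N.adj_opposite a

theorem edge_opposite (a : N.Arc) : N.edge (N.opposite a) = N.edge a := by
  rw [edge, edge, opposite_opposite, Sym2.eq_swap]

theorem edge_eq_iff {a b : N.Arc} : N.edge a = N.edge b ↔ a = b ∨ a = N.opposite b := by
  constructor
  · intro h
    rcases Sym2.eq_iff.1 h with ⟨h1, h2⟩ | ⟨h1, h2⟩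
    · exact Or.inl (N.arc_ext h1 h2)
    · exact Or.inr (N.arc_ext h1 (by rwa [opposite_opposite]))
  · rintro (rfl | rfl)
    · rfl
    · exact N.edge_opposite b

theorem exists_edge_eq {e : Sym2 V} (he : e ∈ G.edgeSet) : ∃ a : N.Arc, N.edge a = e := by
  induction e using Sym2.ind with
  | _ v w =>
    obtain ⟨a, rfl, rfl⟩ := N.exists_arc (G.mem_edgeSet.1 he)
    exact ⟨a, rfl⟩

/-- Makes the contribution of isolated nodes to `numFaces` vanish. -/
theorem deg_ne_zero (hG : G.Connected) (a : N.Arc) (v : V) : N.deg v ≠ 0 := by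
  have : ∃ w, G.Adj v w := by
    by_cases h : v = a.1
    · exact ⟨_, h ▸ N.adj_opposite a⟩
    · have : Nontrivial V := ⟨⟨v, a.1, h⟩⟩
      exact hG.preconnected.exists_adj_of_nontrivial v
  obtain ⟨w, hw⟩ := this
  intro h0
  have := (N.port v).symm ⟨w, hw⟩
  rw [h0] at this
  exact this.elim0

namespace SpanningTree

variable {N} {r : V} (T : N.SpanningTree r)

open Classical in
/-- Jordan curve theorem for the cycle closed by a chord `c` of the spanning tree: a two-coloring
of the arcs that is constant along the boundaries of the faces and in which, of all the chords,
only `c` separates different colors. -/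
theorem exists_coloring (hG : G.Connected) (hN : N.IsPlanarEmbedding) (c : N.Arc) :
    ∃ f : N.Arc → ZMod 2,
      (∀ a, T.IsTree a → f (T.tour a) = f a) ∧
      (∀ a, ¬ T.IsTree a → f (T.tour a) = f (N.opposite a)) ∧
      (∀ a, ¬ T.IsTree a →
        f (N.opposite a) = f a + if a = c ∨ a = N.opposite c then 1 else 0) := by
  let S := Equiv.Perm.SameCycle.setoid N.faceNext
  let NT := {e : G.edgeSet // ∀ a : N.Arc, N.edge a = e → ¬ T.IsTree a}
  have rep : ∀ e : NT, ∃ a : N.Arc, N.edge a = e.1 := fun e => N.exists_edge_eq e.1.2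
  choose arc harc using rep
  -- `Φ` maps a coloring of the faces to its jumps across the chords. What is wanted is a preimage
  -- of the indicator of `c`.
  let Φ : (Quotient S → ZMod 2) →ₗ[ZMod 2] (NT → ZMod 2) :=
    LinearMap.pi fun e =>
      LinearMap.proj (R := ZMod 2) (φ := fun _ => ZMod 2) (Quotient.mk S (N.opposite (arc e))) -
        LinearMap.proj (R := ZMod 2) (φ := fun _ => ZMod 2) (Quotient.mk S (arc e))
  have hΦ : ∀ f e, Φ f e = f (Quotient.mk S (N.opposite (arc e))) - f (Quotient.mk S (arc e)) :=
    fun f e => rfl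
  -- In characteristic two the jump does not depend on the arc that represents the chord.
  have hsymm : ∀ x y : ZMod 2, x - y = y - x := by decide
  have hΦ' : ∀ f (a : N.Arc) (e : NT), N.edge a = e.1 →
      f (Quotient.mk S (N.opposite a)) - f (Quotient.mk S a) = Φ f e := by
    intro f a e he
    rw [hΦ]
    rcases N.edge_eq_iff.1 (he.trans (harc e).symm) with rfl | rfl
    · rfl
    · rw [opposite_opposite]
      exact hsymm _ _
  have nt : ∀ a : N.Arc, ¬ T.IsTree a → ∀ b : N.Arc, N.edge b = N.edge a → ¬ T.IsTree b := by
    intro a ha b hb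
    rcases N.edge_eq_iff.1 hb with rfl | rfl
    · exact ha
    · rwa [T.isTree_opposite]
  have face : ∀ (f : Quotient S → ZMod 2) (a : N.Arc),
      f (Quotient.mk S (N.faceNext a)) = f (Quotient.mk S a) := by
    intro f a
    congr 1
    exact Quotient.sound (s := S) (Equiv.Perm.sameCycle_apply_left.2
      (Equiv.Perm.SameCycle.refl _ _))
  have tour_tree : ∀ (f : Quotient S → ZMod 2) (a : N.Arc), T.IsTree a →
      f (Quotient.mk S (T.tour a)) = f (Quotient.mk S a) := by
    intro f a ha
    rw [T.tour_of_isTree ha, ← faceNext_eq]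
    exact face f a
  have tour_chord : ∀ (f : Quotient S → ZMod 2) (a : N.Arc), ¬ T.IsTree a →
      f (Quotient.mk S (T.tour a)) = f (Quotient.mk S (N.opposite a)) := by
    intro f a ha
    have := face f (N.opposite a)
    rwa [faceNext_eq, opposite_opposite, ← T.tour_of_not_isTree ha] at this
  -- A coloring without jumps is invariant under the tour, which meets all arcs; so the kernel
  -- contains only constants.
  have hker : Module.finrank (ZMod 2) (LinearMap.ker Φ) ≤ 1 := by
    refine finrank_le_one ⟨fun _ => 1, by ext e; simp [hΦ]⟩ ?_
    rintro ⟨f, hf⟩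
    rw [LinearMap.mem_ker] at hf
    refine ⟨f (Quotient.mk S c), ?_⟩
    ext x
    induction x using Quotient.inductionOn with
    | _ a =>
      have inv : ∀ a, f (Quotient.mk S (T.tour a)) = f (Quotient.mk S a) := by
        intro a
        by_cases ha : T.IsTree a
        · exact tour_tree f a ha
        · rw [tour_chord f a ha, ← sub_eq_zero,
            hΦ' f a ⟨⟨_, N.edge_mem a⟩, nt a ha⟩ rfl, hf]
          rfl
      have : f (Quotient.mk S a) = f (Quotient.mk S c) := by
        obtain ⟨n, -, hn⟩ := (T.sameCycle_tour c a).exists_pow_eq'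
        rw [← hn]
        clear hn
        induction n with
        | zero => rfl
        | succ n ih => rw [pow_succ', Equiv.Perm.mul_apply, inv, ih]
      simp [this]
  -- The links to the parents are n - 1 distinct links outside `NT`.
  have hcard : Fintype.card NT + (Fintype.card V - 1) ≤ Nat.card G.edgeSet := by
    have up : ∀ v : {v : V // v ≠ r}, ∃ a : N.Arc, a.1 = v.1 ∧ T.IsUp a :=
      fun v => T.exists_isUp v.2
    choose u hu1 hu2 using up
    have hinj : Function.Injective
        (Sum.elim (fun e : NT => e.1) fun v => (⟨_, N.edge_mem (u v)⟩ : G.edgeSet)) := by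
      refine Function.Injective.sumElim Subtype.val_injective ?_ ?_
      · intro v w h
        rcases N.edge_eq_iff.1 (Subtype.ext_iff.1 h) with h | h
        · exact Subtype.ext (by rw [← hu1, ← hu1, h])
        · exact absurd (h ▸ hu2 v) (T.not_isUp_opposite (hu2 w))
      · intro e v h
        exact e.2 (u v) (Subtype.ext_iff.1 h).symm (Or.inl (hu2 v))
    have := Nat.card_le_card_of_injective _ hinj
    rw [Nat.card_sum, Nat.card_eq_fintype_card, Nat.card_eq_fintype_card] at this
    simpa [Fintype.card_subtype_compl] using this
  -- By Euler's formula the faces outnumber the chords. With a kernel of dimension at most one,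
  -- rank-nullity makes `Φ` surjective.
  have hface : Fintype.card NT + 1 ≤ Fintype.card (Quotient S) := by
    have h0 : Nat.card {v : V // N.deg v = 0} = 0 := by
      have : IsEmpty {v : V // N.deg v = 0} := ⟨fun v => N.deg_ne_zero hG c v.1 v.2⟩
      exact Nat.card_of_isEmpty
    have h1 := hN
    rw [IsPlanarEmbedding, numFaces, h0, Nat.card_eq_fintype_card (α := V),
      Nat.card_eq_fintype_card (α := Quotient S)] at h1
    have : 0 < Fintype.card V := Fintype.card_pos_iff.2 ⟨r⟩
    omega
  have hrank := LinearMap.finrank_range_add_finrank_ker Φ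
  rw [Module.finrank_fintype_fun_eq_card] at hrank
  have htop : LinearMap.range Φ = ⊤ := by
    refine Submodule.eq_top_of_finrank_eq (le_antisymm (Submodule.finrank_le _) ?_)
    rw [Module.finrank_fintype_fun_eq_card]
    omega
  obtain ⟨f, hf⟩ := LinearMap.range_eq_top.1 htop
    (fun e => if N.edge c = e.1 then 1 else 0)
  refine ⟨fun a => f (Quotient.mk S a), tour_tree f, tour_chord f, fun a ha => ?_⟩
  have h1 := hΦ' f a ⟨⟨_, N.edge_mem a⟩, nt a ha⟩ rfl
  rw [hf, sub_eq_iff_eq_add'] at h1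
  simp only at h1 ⊢
  rw [h1]
  congr 1
  refine if_congr ?_ rfl rfl
  rw [eq_comm]
  exact N.edge_eq_iff

end SpanningTree

end Network

/-! ### The number of links of a planar network. -/

namespace Network

variable {V : Type*} [Fintype V] {G : SimpleGraph V} (N : Network G)

/-- A planar network has at most `3n` links. -/
theorem card_arc_le (hG : G.Connected) (hN : N.IsPlanarEmbedding) :
    Fintype.card N.Arc ≤ 6 * Fintype.card V := by
  classical
  rcases isEmpty_or_nonempty N.Arc with he | ⟨⟨a₀⟩⟩
  · rw [Fintype.card_eq_zero]
    exact Nat.zero_le _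
  have hpos : 0 < Fintype.card V := Fintype.card_pos_iff.2 ⟨a₀.1⟩
  have hA : Fintype.card N.Arc ≤ 2 * Fintype.card G.edgeSet := by
    rw [← Finset.card_univ, ← Finset.card_univ (α := G.edgeSet)]
    refine Finset.card_le_mul_card_image_of_maps_to
      (f := fun a => (⟨_, N.edge_mem a⟩ : G.edgeSet)) (fun _ _ => Finset.mem_univ _) 2 ?_
    rintro ⟨e, he⟩ -
    obtain ⟨a, rfl⟩ := N.exists_edge_eq he
    refine (Finset.card_le_card (t := {a, N.opposite a}) ?_).trans Finset.card_le_two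
    intro b hb
    simp only [Finset.mem_filter, Finset.mem_univ, true_and, Subtype.mk.injEq] at hb
    simpa using N.edge_eq_iff.1 hb
  -- A face with two arcs forces both ends of its link to be leaves, so that there is no other link.
  -- Otherwise every face has three arcs, and Euler's formula gives the bound.
  by_cases h2 : ∃ a, N.faceNext (N.faceNext a) = a
  · obtain ⟨a, ha⟩ := h2
    rw [faceNext_eq, faceNext_eq] at ha
    have hfix : ∀ b : N.Arc, N.rotate b = b → ∀ c : N.Arc, c.1 = b.1 → c = b := by
      intro b hb c hc
      refine N.rel_of_rel_rotate (· = ·) ⟨fun _ => rfl, Eq.symm, Eq.trans⟩ b.1 b.2 ?_ c b hc rfl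
      intro p hp
      exfalso
      apply hp
      have hs := N.next_cyclic b.1 b.2 p
      have hb' : N.next b.1 b.2 = b.2 := by
        have : (N.next b.1).symm b.2 = b.2 := eq_of_heq (Sigma.mk.inj_iff.1 hb).2
        rw [Equiv.symm_apply_eq] at this
        exact this.symm
      exact (Equiv.Perm.SameCycle.eq_of_left hs hb').symm
    have hopp : N.opposite (N.rotate (N.opposite a)) = N.rotate.symm a := by
      rw [Equiv.eq_symm_apply, ha]
    -- The arc after `a` leads back to `a.1`; as there are no parallel links, it is `N.opposite a`.
    have hb : N.rotate (N.opposite a) = N.opposite a := by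
      refine N.arc_ext rfl ?_
      rw [hopp, opposite_opposite]
      have := N.rotate_fst (N.rotate.symm a)
      rwa [Equiv.apply_symm_apply, eq_comm] at this
    have ha' : N.rotate a = a := by
      rw [hb, opposite_opposite] at ha
      exact ha
    have htwo : ∀ v : V, v = a.1 ∨ v = (N.opposite a).1 := by
      have step : ∀ v w, G.Adj v w → (v = a.1 ∨ v = (N.opposite a).1) →
          (w = a.1 ∨ w = (N.opposite a).1) := by
        intro v w hvw hv
        obtain ⟨c, rfl, rfl⟩ := N.exists_arc hvw
        rcases hv with hv | hv
        · exact Or.inr (by rw [hfix a ha' c hv])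
        · exact Or.inl (by rw [hfix _ hb c hv, opposite_opposite])
      intro v
      obtain ⟨p⟩ := hG.preconnected a.1 v
      have : ∀ {u w : V} (p : G.Walk u w), (u = a.1 ∨ u = (N.opposite a).1) →
          (w = a.1 ∨ w = (N.opposite a).1) := by
        intro u w p
        induction p with
        | nil => exact id
        | cons h _ ih => exact fun hu => ih (step _ _ h hu)
      exact this p (Or.inl rfl)
    have : Fintype.card N.Arc ≤ 2 := by
      rw [← Finset.card_univ]
      refine (Finset.card_le_card (t := {a, N.opposite a}) ?_).trans Finset.card_le_two
      intro c _
      rcases htwo c.1 with h | h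
      · simp [hfix a ha' c h]
      · simp [hfix _ hb c h]
    omega
  · push Not at h2
    have h1 : ∀ a, N.faceNext a ≠ a := by
      intro a h
      have := congrArg Sigma.fst h
      rw [faceNext_eq, rotate_fst] at this
      have hadj := N.adj_opposite a
      rw [this] at hadj
      exact G.irrefl hadj
    let S := Equiv.Perm.SameCycle.setoid N.faceNext
    -- The first three arcs from a representative of a face are distinct by `h1` and `h2`.
    have hF : Fintype.card (Quotient S × Fin 3) ≤ Fintype.card N.Arc := by
      refine Fintype.card_le_of_injective
        (fun x => (N.faceNext ^ (x.2 : ℕ)) (Quotient.out x.1)) ?_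
      rintro ⟨x, i⟩ ⟨y, j⟩ hxy
      simp only at hxy
      have hq : x = y := by
        rw [← Quotient.out_eq x, ← Quotient.out_eq y]
        refine Quotient.sound (s := S) ?_
        have h3 : N.faceNext.SameCycle (Quotient.out x)
            ((N.faceNext ^ (i : ℕ)) (Quotient.out x)) :=
          Equiv.Perm.sameCycle_pow_right.2 (Equiv.Perm.SameCycle.refl _ _)
        rw [hxy] at h3
        exact Equiv.Perm.sameCycle_pow_right.1 h3
      subst hq
      have h1' := h1 (Quotient.out x)
      have h2' := h2 (Quotient.out x)
      fin_cases i <;> fin_cases j <;> simp [pow_succ] at hxy ⊢ <;>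
        first
        | exact h1' hxy
        | exact h1' hxy.symm
        | exact h2' hxy
        | exact h2' hxy.symm
    rw [Fintype.card_prod, Fintype.card_fin] at hF
    have h0 : Nat.card {v : V // N.deg v = 0} = 0 := by
      have : IsEmpty {v : V // N.deg v = 0} := ⟨fun v => N.deg_ne_zero hG a₀ v.1 v.2⟩
      exact Nat.card_of_isEmpty
    have h1 := hN
    rw [IsPlanarEmbedding, numFaces, h0, Nat.card_eq_fintype_card (α := V),
      Nat.card_eq_fintype_card (α := Quotient S), Nat.card_eq_fintype_card] at h1
    omega

/-! ### The tour as a sequence of arcs; chords are nested. -/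

namespace SpanningTree

variable {N} {r : V} (T : N.SpanningTree r) (p₀ : Fin (N.deg r))

/-- The arcs in the order of the tour that starts with the arc at port `p₀` of the root. -/
def arcAt (t : ℕ) : N.Arc := (T.tour ^ t) ⟨r, p₀⟩

theorem arcAt_zero : T.arcAt p₀ 0 = ⟨r, p₀⟩ := rfl

theorem arcAt_succ (t : ℕ) : T.arcAt p₀ (t + 1) = T.tour (T.arcAt p₀ t) := by
  rw [arcAt, pow_succ', Equiv.Perm.mul_apply]
  rfl

theorem isCycleOn_tour : T.tour.IsCycleOn (Finset.univ : Finset N.Arc) :=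
  ⟨by simp, fun a _ b _ => T.sameCycle_tour a b⟩

theorem arcAt_card : T.arcAt p₀ (Fintype.card N.Arc) = ⟨r, p₀⟩ :=
  (T.isCycleOn_tour.pow_apply_eq (Finset.mem_univ _)).2 (by simp)

theorem exists_arcAt_eq (a : N.Arc) : ∃ t < Fintype.card N.Arc, T.arcAt p₀ t = a := by
  obtain ⟨t, ht, h⟩ :=
    T.isCycleOn_tour.exists_pow_eq (Finset.mem_univ ⟨r, p₀⟩) (Finset.mem_univ a)
  exact ⟨t, by rwa [Finset.card_univ] at ht, h⟩

theorem arcAt_injOn {s t : ℕ} (hs : s < Fintype.card N.Arc) (ht : t < Fintype.card N.Arc)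
    (h : T.arcAt p₀ s = T.arcAt p₀ t) : s = t := by
  have := (T.isCycleOn_tour.pow_apply_eq_pow_apply (Finset.mem_univ _)).1 h
  rw [Finset.card_univ] at this
  exact Nat.ModEq.eq_of_lt_of_lt this hs ht

/-- The arc at time `t` of the tour belongs to a chord. -/
def IsChord (t : ℕ) : Prop := ¬ T.IsTree (T.arcAt p₀ t)

/-- The time at which the tour meets the opposite arc. -/
def partner (t : ℕ) : ℕ := (T.exists_arcAt_eq p₀ (N.opposite (T.arcAt p₀ t))).choose

theorem partner_lt (t : ℕ) : T.partner p₀ t < Fintype.card N.Arc :=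
  (T.exists_arcAt_eq p₀ (N.opposite (T.arcAt p₀ t))).choose_spec.1

theorem arcAt_partner (t : ℕ) : T.arcAt p₀ (T.partner p₀ t) = N.opposite (T.arcAt p₀ t) :=
  (T.exists_arcAt_eq p₀ (N.opposite (T.arcAt p₀ t))).choose_spec.2

theorem partner_partner {t : ℕ} (ht : t < Fintype.card N.Arc) :
    T.partner p₀ (T.partner p₀ t) = t := by
  refine T.arcAt_injOn p₀ (T.partner_lt p₀ _) ht ?_
  rw [arcAt_partner, arcAt_partner, opposite_opposite]

theorem partner_ne (t : ℕ) : T.partner p₀ t ≠ t := fun h => by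
  have := T.arcAt_partner p₀ t
  rw [h] at this
  exact N.opposite_ne _ this.symm

theorem isChord_partner {t : ℕ} : T.IsChord p₀ (T.partner p₀ t) ↔ T.IsChord p₀ t := by
  rw [IsChord, IsChord, arcAt_partner, isTree_opposite]

theorem arcAt_succ_of_isChord {t : ℕ} (h : T.IsChord p₀ t) :
    T.arcAt p₀ (t + 1) = N.rotate (T.arcAt p₀ t) := by
  rw [arcAt_succ, T.tour_of_not_isTree h]

theorem arcAt_succ_of_isTree {t : ℕ} (h : T.IsTree (T.arcAt p₀ t)) :
    T.arcAt p₀ (t + 1) = N.rotate (N.opposite (T.arcAt p₀ t)) := by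
  rw [arcAt_succ, T.tour_of_isTree h]

/-- Chords do not cross. -/
theorem not_crossing (hG : G.Connected) (hN : N.IsPlanarEmbedding) {i i' : ℕ}
    (hi : T.IsChord p₀ i) (hi' : T.IsChord p₀ i') (h1 : i < i') (h2 : i' < T.partner p₀ i)
    (h3 : T.partner p₀ i < T.partner p₀ i') : False := by
  obtain ⟨f, htree, hchord, hf⟩ := T.exists_coloring hG hN (T.arcAt p₀ i)
  have hj := T.partner_lt p₀ i
  have hj' := T.partner_lt p₀ i'
  set j := T.partner p₀ i with hjdef
  set j' := T.partner p₀ i' with hjdef'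
  have step : ∀ t < Fintype.card N.Arc, t ≠ i → t ≠ j →
      f (T.arcAt p₀ (t + 1)) = f (T.arcAt p₀ t) := by
    intro t ht hti htj
    rw [arcAt_succ]
    by_cases h : T.IsTree (T.arcAt p₀ t)
    · exact htree _ h
    · rw [hchord _ h, hf _ h, if_neg, add_zero]
      rintro (e | e)
      · exact hti (T.arcAt_injOn p₀ ht (by omega) e)
      · rw [← arcAt_partner] at e
        exact htj (T.arcAt_injOn p₀ ht hj e)
  have const : ∀ s t, s ≤ t → t ≤ Fintype.card N.Arc → (∀ u, s ≤ u → u < t → u ≠ i ∧ u ≠ j) →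
      f (T.arcAt p₀ t) = f (T.arcAt p₀ s) := by
    intro s t hst
    induction t, hst using Nat.le_induction with
    | base => exact fun _ _ => rfl
    | succ t hst ih =>
      intro ht hu
      rw [step t (by omega) (hu t hst (by omega)).1 (hu t hst (by omega)).2]
      exact ih (by omega) fun u h h' => hu u h (by omega)
  -- From `i'` to `j'` the tour changes its color exactly once, at `j`. But the chord that joins
  -- these two times does not separate colors.
  have e1 := const i' j h2.le hj.le fun u hu hu' => ⟨by omega, by omega⟩
  have e2 := const (j + 1) j' (by omega) hj'.le fun u hu hu' => ⟨by omega, by omega⟩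
  have hjc : ¬ T.IsTree (T.arcAt p₀ j) := (T.isChord_partner p₀).2 hi
  have e3 : f (T.arcAt p₀ (j + 1)) = f (T.arcAt p₀ j) + 1 := by
    rw [arcAt_succ, hchord _ hjc, hf _ hjc, if_pos (Or.inr (T.arcAt_partner p₀ i))]
  have e4 : f (T.arcAt p₀ j') = f (T.arcAt p₀ i') := by
    rw [hjdef', arcAt_partner, hf _ hi', if_neg, add_zero]
    rintro (e | e)
    · exact absurd (T.arcAt_injOn p₀ (by omega) (by omega) e) (by omega)
    · rw [← arcAt_partner] at e
      exact absurd (T.arcAt_injOn p₀ (by omega) (by omega) e) (by omega)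
  rw [e2, e3, e1] at e4
  simp at e4

/-- The nodes of a subtree are visited during an interval of time. -/
theorem mem_path_of_between {x : V} (hx : x ≠ r) {s t u : ℕ} (hsu : s ≤ u) (hut : u ≤ t)
    (ht : t ≤ Fintype.card N.Arc) (hs : x ∈ T.path (T.arcAt p₀ s).1)
    (hxt : x ∈ T.path (T.arcAt p₀ t).1) : x ∈ T.path (T.arcAt p₀ u).1 := by
  by_contra hu
  -- The subtree of `x` can be entered only by the arc from the parent of `x`. The tour starts
  -- outside, so leaving and returning would use this arc twice.
  have enter : ∀ a b, a ≤ b → x ∉ T.path (T.arcAt p₀ a).1 → x ∈ T.path (T.arcAt p₀ b).1 →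
      ∃ t, a ≤ t ∧ t < b ∧ T.IsUp (N.opposite (T.arcAt p₀ t)) ∧
        (N.opposite (T.arcAt p₀ t)).1 = x := by
    intro a b hab ha
    induction b, hab using Nat.le_induction with
    | base => exact fun h => absurd h ha
    | succ b hab ih =>
      intro hb
      by_cases hb' : x ∈ T.path (T.arcAt p₀ b).1
      · obtain ⟨t, h1, h2, h3⟩ := ih hb'
        exact ⟨t, h1, by omega, h3⟩
      · by_cases htree : T.IsTree (T.arcAt p₀ b)
        · rw [T.arcAt_succ_of_isTree p₀ htree, rotate_fst] at hb
          rcases htree with h | h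
          · exact absurd ((T.mem_path_iff_of_isUp h).2 (Or.inl hb)) hb'
          · rcases (T.mem_path_iff_of_isUp h).1 hb with hm | hm
            · rw [opposite_opposite] at hm
              exact absurd hm hb'
            · exact ⟨b, hab, by omega, h, hm.symm⟩
        · rw [T.arcAt_succ_of_isChord p₀ htree, rotate_fst] at hb
          exact absurd hb hb'
  obtain ⟨t1, -, h1, h2, h3⟩ := enter 0 s (Nat.zero_le _)
    (by rw [arcAt_zero, T.path_root]; simpa using hx) hs
  obtain ⟨t2, h4, h5, h6, h7⟩ := enter u t hut hu hxt
  have := N.opposite_involutive.injective (T.eq_of_isUp h2 h6 (h3.trans h7.symm))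
  have := T.arcAt_injOn p₀ (by omega) (by omega) this
  omega

/-- The arc to the parent is the last arc of the tour at its node. -/
theorem le_of_isUp {s t : ℕ} (hs : T.IsUp (T.arcAt p₀ s)) (hst : s < t)
    (ht : t ≤ Fintype.card N.Arc) : (T.arcAt p₀ t).1 ≠ (T.arcAt p₀ s).1 := by
  intro h
  have := T.mem_path_of_between p₀ (T.ne_root_of_isUp hs) (Nat.le_succ s) hst ht
    (T.self_mem_path _) (h ▸ T.self_mem_path _)
  rw [Nat.succ_eq_add_one, T.arcAt_succ_of_isTree p₀ (Or.inl hs), rotate_fst] at this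
  exact T.not_mem_path_of_isUp hs this

end SpanningTree

end Network

/-! ### From a sequence of bags to a stored decomposition. -/

namespace Network

variable {V : Type*} [Fintype V] {G : SimpleGraph V} (N : Network G)

open Classical in
/-- Bags that are created one after the other, at the nodes `loc 0, …, loc m`, and that refer to
earlier bags, form a decomposition if no node disappears from a bag and appears again later. -/
theorem storesDecomposition_of_sequence (w m : ℕ) (r : V)
    (out : (v : V) → List (StoredBag w (N.deg v)))
    (loc : ℕ → V) (bag : ℕ → List V) (par mate : ℕ → ℕ)
    (hloc : loc 0 = r)
    (hlen : ∀ v, (out v).length = Nat.count (fun s => loc s = v) (m + 1))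
    (hget : ∀ t ≤ m, ∃ b, (out (loc t))[Nat.count (fun s => loc s = loc t) t]? = some b ∧
      (∀ i : Fin (w + 1), b.tuple i = ((bag t).map N.ident).getD i (N.ident r)) ∧
      (t = 0 → b.parent = none) ∧
      (t ≠ 0 → ∃ l, b.parent = some (l, Nat.count (fun s => loc s = loc (par t)) (par t)) ∧
        N.resolve (loc t) l = loc (par t)))
    (hpar : ∀ t < m, par (t + 1) ≤ t)
    (hmate : ∀ t < m, par (t + 1) = t ∨ mate (par (t + 1)) = t + 1)
    (hroot : ∀ t ≤ m, r ∈ bag t) (hbag : ∀ t ≤ m, (bag t).length ≤ w + 1)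
    (hnew : ∀ t < m, ∀ x ∈ bag (t + 1), x ∉ bag (par (t + 1)) → ∀ s ≤ t, x ∉ bag s)
    (hvertex : ∀ v, ∃ t ≤ m, v ∈ bag t)
    (hedge : ∀ v v', G.Adj v v' → ∃ t ≤ m, v ∈ bag t ∧ v' ∈ bag t) :
    N.StoresDecomposition w r out := by
  choose b hb1 hb2 hb3 hb4 using hget
  have idx : ∀ t : Fin (m + 1),
      Nat.count (fun s => loc s = loc t) t < (out (loc t)).length := fun t =>
    (List.getElem?_eq_some_iff.1 (hb1 t (Nat.lt_succ_iff.1 t.2))).1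
  let E : Fin (m + 1) → BagIndex out := fun t => ⟨loc t, ⟨_, idx t⟩⟩
  have hEget : ∀ t, (out (E t).1).get (E t).2 = b t (Nat.lt_succ_iff.1 t.2) := fun t =>
    (List.getElem?_eq_some_iff.1 (hb1 t (Nat.lt_succ_iff.1 t.2))).2
  have ext : ∀ x y : BagIndex out, x.1 = y.1 → (x.2 : ℕ) = y.2 → x = y := by
    rintro ⟨v, i⟩ ⟨v', i'⟩ h h'
    obtain rfl : v = v' := h
    obtain rfl : i = i' := Fin.ext h'
    rfl
  have hinj : Function.Injective E := by
    intro s t h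
    have h1 : loc s = loc t := congrArg Sigma.fst h
    have h2 : Nat.count (fun u => loc u = loc s) s = Nat.count (fun u => loc u = loc t) t :=
      congrArg (fun x : BagIndex out => (x.2 : ℕ)) h
    rw [h1] at h2
    exact Fin.ext (Nat.count_injective (p := fun u => loc u = loc t) h1 rfl h2)
  have hsurj : Function.Surjective E := by
    rintro ⟨v, i⟩
    have hi : (i : ℕ) < Nat.count (fun s => loc s = v) (m + 1) := by
      rw [← hlen]
      exact i.2
    have h1 : Nat.nth (fun s => loc s = v) i < m + 1 := Nat.nth_lt_of_lt_count hi
    have h2 : loc (Nat.nth (fun s => loc s = v) i) = v :=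
      Nat.nth_mem (p := fun s => loc s = v) i fun hf => hi.trans_le (Nat.count_le_card hf _)
    refine ⟨⟨_, h1⟩, ext _ _ h2 ?_⟩
    change Nat.count (fun u => loc u = loc (Nat.nth (fun s => loc s = v) i)) _ = (i : ℕ)
    rw [h2]
    exact Nat.count_nth fun hf' => hi.trans_le (Nat.count_le_card hf' _)
  let e : Fin (m + 1) ≃ BagIndex out := Equiv.ofBijective E ⟨hinj, hsurj⟩
  have hF : ∀ (t : ℕ) (ht : t < m + 1) (x : BagIndex out), StoredParent out (E ⟨t, ht⟩) x →
      t ≠ 0 ∧ ∃ h, x = E ⟨par t, h⟩ := by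
    rintro t ht x ⟨l, h1, h2⟩
    rw [hEget] at h1
    have h0 : t ≠ 0 := by
      rintro rfl
      rw [hb3 0 (by omega) rfl] at h1
      cases h1
    obtain ⟨l', h3, h4⟩ := hb4 t (by omega) h0
    simp only at h1
    rw [h3, Option.some.injEq, Prod.mk.injEq] at h1
    obtain ⟨t, rfl⟩ := Nat.exists_eq_succ_of_ne_zero h0
    have := hpar t (by omega)
    refine ⟨h0, by simp only [Nat.succ_eq_add_one]; omega, ext _ _ ?_ h1.2.symm⟩
    rw [← h2, ← h1.1]
    exact h4
  have hF' : ∀ (t : ℕ) (ht : t + 1 < m + 1) (h : par (t + 1) < m + 1),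
      StoredParent out (E ⟨t + 1, ht⟩) (E ⟨par (t + 1), h⟩) := by
    intro t ht h
    obtain ⟨l, h3, h4⟩ := hb4 (t + 1) (by omega) (by omega)
    refine ⟨l, ?_, h4⟩
    rw [hEget]
    exact h3
  have hpar' : ∀ t, t + 1 < m + 1 → par (t + 1) < m + 1 := fun t ht => by
    have := hpar t (by omega)
    omega
  -- Filling up with `r` does not change the set of entries, since `r` is in every bag.
  let lab : BagIndex out → Fin (w + 1) → V := fun x i => (bag (e.symm x)).getD i r
  have hsymm : ∀ t, e.symm (E t) = t := e.symm_apply_apply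
  have hlab : ∀ t x, x ∈ Set.range (lab (E t)) ↔ x ∈ bag t := by
    intro t x
    have ht := Nat.lt_succ_iff.1 t.2
    simp only [lab, hsymm, Set.mem_range]
    constructor
    · rintro ⟨i, rfl⟩
      by_cases hi : (i : ℕ) < (bag t).length
      · rw [List.getD_eq_getElem _ _ hi]
        exact List.getElem_mem _
      · rw [List.getD_eq_default _ _ (by omega)]
        exact hroot t ht
    · intro hx
      obtain ⟨i, hi, rfl⟩ := List.getElem_of_mem hx
      exact ⟨⟨i, hi.trans_le (hbag t ht)⟩, List.getD_eq_getElem _ _ hi⟩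
  refine ⟨E 0, lab, hloc, ?_, ?_, ⟨⟨?_, ?_, ?_⟩, ?_, ?_⟩, ?_⟩
  · rw [hEget]
    exact hb3 0 (Nat.zero_le _) rfl
  · intro x i
    obtain ⟨t, rfl⟩ := hsurj x
    rw [hEget, hb2 t (Nat.lt_succ_iff.1 t.2), List.getD_map]
    simp only [lab, hsymm]
  · intro x hx
    exact (hF 0 (Nat.succ_pos _) x hx).1 rfl
  · intro x hx
    obtain ⟨⟨t, ht⟩, rfl⟩ := hsurj x
    obtain _ | t := t
    · exact absurd rfl hx
    · refine ⟨E ⟨par (t + 1), hpar' t ht⟩, hF' t ht _, fun y hy => ?_⟩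
      obtain ⟨-, h, e⟩ := hF _ ht y hy
      exact e
  · intro x
    obtain ⟨⟨t, ht⟩, rfl⟩ := hsurj x
    induction t using Nat.strong_induction_on with
    | _ t ih =>
      obtain _ | t := t
      · exact Relation.ReflTransGen.refl
      · exact Relation.ReflTransGen.head (hF' t ht (hpar' t ht))
          (ih _ (Nat.lt_succ_of_le (hpar t (by omega))) _)
  · intro v v' h
    obtain ⟨t, ht, h1, h2⟩ := hedge v v' h
    exact ⟨E ⟨t, by omega⟩, (hlab _ _).2 h1, (hlab _ _).2 h2⟩
  · intro v
    have hex : ∃ t, t ≤ m ∧ v ∈ bag t := hvertex v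
    obtain ⟨h1, h2⟩ := Nat.find_spec hex
    rw [SimpleGraph.connected_iff_exists_forall_reachable]
    -- The earliest bag that contains `v` is the top of its subtree: by `hnew`, every later bag with
    -- `v` has a parent with `v`.
    refine ⟨⟨E ⟨Nat.find hex, by omega⟩, (hlab _ _).2 h2⟩, ?_⟩
    rintro ⟨x, hx⟩
    obtain ⟨⟨t, ht⟩, rfl⟩ := hsurj x
    have hx' := (hlab _ _).1 hx
    simp only at hx'
    induction t using Nat.strong_induction_on with
    | _ t ih =>
      rcases (Nat.find_min' hex ⟨by omega, hx'⟩).eq_or_lt with h | h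
      · have : (⟨E ⟨Nat.find hex, by omega⟩, (hlab _ _).2 h2⟩ : bagsContaining _ v) =
            ⟨E ⟨t, ht⟩, hx⟩ := by
          simp only [h]
        rw [this]
      · obtain _ | t := t
        · omega
        · have hp : v ∈ bag (par (t + 1)) := by
            by_contra hp
            exact hnew t (by omega) v hx' hp _ (by omega) h2
          have hlt := hpar t (by omega)
          refine (ih (par (t + 1)) (by omega) (hpar' t ht) ((hlab _ _).2 hp) hp).trans
            (SimpleGraph.Adj.reachable ?_)
          rw [SimpleGraph.comap_adj, SimpleGraph.fromRel_adj]
          refine ⟨fun h => ?_, Or.inr (hF' t ht _)⟩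
          have := congrArg Fin.val (hinj h)
          simp only at this
          omega
  · intro x
    obtain ⟨⟨j, hj⟩, rfl⟩ := hsurj x
    let E' : ℕ → BagIndex out := fun t => if h : t < m + 1 then E ⟨t, h⟩ else E 0
    have hE' : ∀ t (h : t < m + 1), E' t = E ⟨t, h⟩ := fun t h => dif_pos h
    -- By `hmate`, a child of `j` is its successor or its mate.
    have hsub : {s | StoredParent out s (E ⟨j, hj⟩)} ⊆ {E' (j + 1), E' (mate j)} := by
      intro s hs
      obtain ⟨⟨t, ht⟩, rfl⟩ := hsurj s
      obtain ⟨h0, h1, h2⟩ := hF t ht _ hs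
      obtain ⟨t, rfl⟩ := Nat.exists_eq_succ_of_ne_zero h0
      have h3 : j = par (t + 1) := congrArg Fin.val (hinj h2)
      rcases hmate t (by omega) with h | h
      · left
        rw [h3, h, hE' _ ht]
      · right
        rw [Set.mem_singleton_iff, h3, h, hE' _ ht]
    exact ⟨(Set.toFinite _).subset hsub, (Set.ncard_le_ncard hsub (Set.toFinite _)).trans
      ((Set.ncard_insert_le _ _).trans (by rw [Set.ncard_singleton]))⟩

/-! ### Anchors and bags along the tour. -/

namespace SpanningTree

variable {N} {r : V} (T : N.SpanningTree r) (p₀ : Fin (N.deg r))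

/-- The time at which the tour leaves the region, bounded by the chords, that it enters at
time `t`. -/
def anchorTime (t : ℕ) : ℕ :=
  sInf {j | t ≤ j ∧ (j = Fintype.card N.Arc ∨
    j < Fintype.card N.Arc ∧ T.IsChord p₀ j ∧ T.partner p₀ j < t)}

theorem anchorTime_spec {t : ℕ} (ht : t ≤ Fintype.card N.Arc) :
    t ≤ T.anchorTime p₀ t ∧ (T.anchorTime p₀ t = Fintype.card N.Arc ∨
      T.anchorTime p₀ t < Fintype.card N.Arc ∧ T.IsChord p₀ (T.anchorTime p₀ t) ∧
        T.partner p₀ (T.anchorTime p₀ t) < t) :=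
  Nat.sInf_mem (s := {j | t ≤ j ∧ (j = Fintype.card N.Arc ∨
    j < Fintype.card N.Arc ∧ T.IsChord p₀ j ∧ T.partner p₀ j < t)}) ⟨_, ht, Or.inl rfl⟩

theorem anchorTime_le {t j : ℕ} (htj : t ≤ j) (hj : j < Fintype.card N.Arc)
    (h1 : T.IsChord p₀ j) (h2 : T.partner p₀ j < t) : T.anchorTime p₀ t ≤ j :=
  Nat.sInf_le ⟨htj, Or.inr ⟨hj, h1, h2⟩⟩

theorem anchorTime_le_card {t : ℕ} (ht : t ≤ Fintype.card N.Arc) :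
    T.anchorTime p₀ t ≤ Fintype.card N.Arc :=
  Nat.sInf_le ⟨ht, Or.inl rfl⟩

theorem anchorTime_zero : T.anchorTime p₀ 0 = Fintype.card N.Arc := by
  rcases (T.anchorTime_spec p₀ (Nat.zero_le _)).2 with h | ⟨-, -, h⟩
  · exact h
  · omega

/-- The path from the root to the node at which the tour leaves the current region. -/
def anchor (t : ℕ) : List V := T.path (T.arcAt p₀ (T.anchorTime p₀ t)).1

theorem anchor_zero : T.anchor p₀ 0 = [r] := by
  rw [anchor, anchorTime_zero, arcAt_card, T.path_root]

/-- Only chords bound regions: neither end of a chord is at time `t`, so the shift by one admits and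
removes no exit. -/
theorem anchorTime_succ_of_isTree {t : ℕ} (ht : t < Fintype.card N.Arc)
    (h : T.IsTree (T.arcAt p₀ t)) : T.anchorTime p₀ (t + 1) = T.anchorTime p₀ t := by
  rw [anchorTime, anchorTime]
  congr 1
  ext j
  have h1 : j = t → ¬ T.IsChord p₀ j := by rintro rfl hj; exact hj h
  have h2 : T.partner p₀ j = t → ¬ T.IsChord p₀ j := by
    intro e hj
    rw [← isChord_partner, e] at hj
    exact hj h
  simp only [Set.mem_ofPred_eq]
  constructor
  · rintro ⟨h3, h4 | ⟨h4, h5, h6⟩⟩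
    · exact ⟨by omega, Or.inl h4⟩
    · have : T.partner p₀ j ≠ t := fun e => h2 e h5
      exact ⟨by omega, Or.inr ⟨h4, h5, by omega⟩⟩
  · rintro ⟨h3, h4 | ⟨h4, h5, h6⟩⟩
    · exact ⟨by omega, Or.inl h4⟩
    · have : j ≠ t := fun e => h1 e h5
      exact ⟨by omega, Or.inr ⟨h4, h5, by omega⟩⟩

theorem anchor_succ_of_isTree {t : ℕ} (ht : t < Fintype.card N.Arc)
    (h : T.IsTree (T.arcAt p₀ t)) : T.anchor p₀ (t + 1) = T.anchor p₀ t := by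
  rw [anchor, T.anchorTime_succ_of_isTree p₀ ht h, anchor]

section Planar

variable (hG : G.Connected) (hN : N.IsPlanarEmbedding)
include hG hN

/-- The chord just opened is the innermost one: an earlier exit would belong to a chord that crosses
it. -/
theorem anchorTime_succ_of_opening {t : ℕ} (ht : t < Fintype.card N.Arc) (h : T.IsChord p₀ t)
    (h' : t < T.partner p₀ t) : T.anchorTime p₀ (t + 1) = T.partner p₀ t := by
  have hp := T.partner_partner p₀ ht
  refine le_antisymm (T.anchorTime_le p₀ h' (T.partner_lt p₀ t) ((T.isChord_partner p₀).2 h)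
    (by omega)) ?_
  by_contra hlt
  obtain ⟨h1, h2 | ⟨h2, h3, h4⟩⟩ := T.anchorTime_spec p₀ (Nat.succ_le_of_lt ht)
  · have := T.partner_lt p₀ t
    rw [Nat.succ_eq_add_one] at h2
    omega
  · have hJ := T.partner_partner p₀ h2
    rw [Nat.succ_eq_add_one] at *
    have hne : T.partner p₀ (T.anchorTime p₀ (t + 1)) ≠ t := by
      intro e
      rw [e] at hJ
      omega
    exact T.not_crossing p₀ hG hN (i := T.partner p₀ (T.anchorTime p₀ (t + 1))) (i' := t)
      ((T.isChord_partner p₀).2 h3) h (by omega) (by omega) (by omega)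

theorem anchor_succ_of_opening {t : ℕ} (ht : t < Fintype.card N.Arc) (h : T.IsChord p₀ t)
    (h' : t < T.partner p₀ t) :
    T.anchor p₀ (t + 1) = T.path (N.opposite (T.arcAt p₀ t)).1 := by
  rw [anchor, T.anchorTime_succ_of_opening p₀ hG hN ht h h', arcAt_partner]

/-- Closing a chord leads back to the region from which it was opened, because no chord has exactly
one end strictly between these two times. -/
theorem anchorTime_succ_of_closing {t : ℕ} (ht : t < Fintype.card N.Arc) (h : T.IsChord p₀ t)
    (h' : T.partner p₀ t < t) :
    T.anchorTime p₀ (t + 1) = T.anchorTime p₀ (T.partner p₀ t) := by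
  rw [anchorTime, anchorTime]
  congr 1
  ext j
  have hp := T.partner_partner p₀ ht
  have hpc := (T.isChord_partner p₀).2 h
  have hjp : ∀ {j}, j < Fintype.card N.Arc → T.partner p₀ (T.partner p₀ j) = j :=
    T.partner_partner p₀
  simp only [Set.mem_ofPred_eq]
  constructor
  · rintro ⟨h3, h4 | ⟨h4, h5, h6⟩⟩
    · exact ⟨by omega, Or.inl h4⟩
    · have e := hjp h4
      have h7 : T.partner p₀ j ≠ t := by intro e'; rw [e'] at e; omega
      have h8 : T.partner p₀ j ≠ T.partner p₀ t := by intro e'; rw [e', hp] at e; omega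
      refine ⟨by omega, Or.inr ⟨h4, h5, ?_⟩⟩
      by_contra h9
      exact T.not_crossing p₀ hG hN (i := T.partner p₀ t) (i' := T.partner p₀ j) hpc
        ((T.isChord_partner p₀).2 h5) (by omega) (by omega) (by omega)
  · rintro ⟨h3, h4 | ⟨h4, h5, h6⟩⟩
    · exact ⟨by omega, Or.inl h4⟩
    · have e := hjp h4
      refine ⟨?_, Or.inr ⟨h4, h5, by omega⟩⟩
      by_contra h9
      have h7 : j ≠ t := by rintro rfl; omega
      have h8 : j ≠ T.partner p₀ t := by rintro rfl; omega
      exact T.not_crossing p₀ hG hN (i := T.partner p₀ j) (i' := T.partner p₀ t)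
        ((T.isChord_partner p₀).2 h5) hpc (by omega) (by omega) (by omega)

theorem anchor_succ_of_closing {t : ℕ} (ht : t < Fintype.card N.Arc) (h : T.IsChord p₀ t)
    (h' : T.partner p₀ t < t) :
    T.anchor p₀ (t + 1) = T.anchor p₀ (T.partner p₀ t) := by
  rw [anchor, T.anchorTime_succ_of_closing p₀ hG hN ht h h', anchor]

end Planar

open Classical in
/-- The bags in the order in which they are created. -/
def bag : ℕ → List V
  | 0 => [r]
  | t + 1 => if T.IsChord p₀ t ∧ t < T.partner p₀ t then
      T.path (T.arcAt p₀ t).1 ++ (T.anchor p₀ t).tail ++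
        (T.path (N.opposite (T.arcAt p₀ t)).1).tail
    else T.path (T.arcAt p₀ (t + 1)).1 ++ (T.anchor p₀ (t + 1)).tail

open Classical in
/-- The parents of the bags. -/
def bagParent : ℕ → ℕ
  | 0 => 0
  | t + 1 => if T.IsChord p₀ t ∧ T.partner p₀ t < t then T.partner p₀ t + 1 else t

/-- All paths begin with `r`, so only the first of the concatenated paths has to keep its head. This
is why (k + 1) + k + k entries suffice. -/
theorem mem_append_tail {l : List V} (hl : r ∈ l) (v : V) {x : V} :
    x ∈ l ++ (T.path v).tail ↔ x ∈ l ∨ x ∈ T.path v := by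
  obtain ⟨l', h⟩ := T.path_head v
  rw [h, List.tail_cons, List.mem_append, List.mem_cons]
  constructor
  · tauto
  · rintro (h | rfl | h)
    · exact Or.inl h
    · exact Or.inl hl
    · exact Or.inr h

theorem root_mem_path (v : V) : r ∈ T.path v := by
  obtain ⟨l, h⟩ := T.path_head v
  simp [h]

theorem mem_bag_of_opening {t : ℕ} (h : T.IsChord p₀ t) (h' : t < T.partner p₀ t) {x : V} :
    x ∈ T.bag p₀ (t + 1) ↔ (x ∈ T.path (T.arcAt p₀ t).1 ∨ x ∈ T.anchor p₀ t) ∨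
      x ∈ T.path (N.opposite (T.arcAt p₀ t)).1 := by
  rw [bag, if_pos ⟨h, h'⟩, mem_append_tail, anchor, mem_append_tail]
  · exact T.root_mem_path _
  · exact List.mem_append_left _ (T.root_mem_path _)

theorem mem_bag_of_not_opening {t : ℕ} (h : ¬ (T.IsChord p₀ t ∧ t < T.partner p₀ t)) {x : V} :
    x ∈ T.bag p₀ (t + 1) ↔ x ∈ T.path (T.arcAt p₀ (t + 1)).1 ∨ x ∈ T.anchor p₀ (t + 1) := by
  rw [bag, if_neg h, anchor, mem_append_tail]
  exact T.root_mem_path _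

theorem root_mem_bag (t : ℕ) : r ∈ T.bag p₀ t := by
  obtain _ | t := t
  · simp [bag]
  · by_cases h : T.IsChord p₀ t ∧ t < T.partner p₀ t
    · exact (T.mem_bag_of_opening p₀ h.1 h.2).2 (Or.inr (T.root_mem_path _))
    · exact (T.mem_bag_of_not_opening p₀ h).2 (Or.inl (T.root_mem_path _))

theorem length_bag_le {k : ℕ} (hk : ∀ v, (T.path v).length ≤ k + 1) (t : ℕ) :
    (T.bag p₀ t).length ≤ 3 * k + 1 := by
  have h1 : ∀ v, (T.path v).tail.length ≤ k := fun v => by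
    rw [List.length_tail]
    have := hk v
    omega
  obtain _ | t := t
  · simp [bag]
  · rw [bag]
    have h2 := hk (T.arcAt p₀ t).1
    have h3 := hk (T.arcAt p₀ (t + 1)).1
    have h4 := h1 (N.opposite (T.arcAt p₀ t)).1
    have h5 := h1 (T.arcAt p₀ (T.anchorTime p₀ t)).1
    have h6 := h1 (T.arcAt p₀ (T.anchorTime p₀ (t + 1))).1
    split_ifs <;> simp only [List.length_append, anchor] <;> omega

theorem bagParent_succ_le (t : ℕ) : T.bagParent p₀ (t + 1) ≤ t := by
  rw [bagParent]
  split_ifs with h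
  · exact h.2
  · exact le_rfl

/-- The bag made by opening a chord at time `u` has index `u + 1`; besides its successor, its only
child is the bag `partner u + 1` made at the closing. -/
theorem bagParent_mate {t : ℕ} (ht : t < Fintype.card N.Arc) :
    T.bagParent p₀ (t + 1) = t ∨ T.partner p₀ (T.bagParent p₀ (t + 1) - 1) + 1 = t + 1 := by
  rw [bagParent]
  split_ifs
  · exact Or.inr (by rw [Nat.add_sub_cancel, T.partner_partner p₀ ht])
  · exact Or.inl rfl

theorem exists_mem_bag (v : V) : ∃ t ≤ Fintype.card N.Arc, v ∈ T.bag p₀ t := by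
  by_cases h : v = r
  · exact ⟨0, Nat.zero_le _, h ▸ T.root_mem_bag p₀ 0⟩
  · obtain ⟨a, rfl, ha⟩ := T.exists_isUp h
    obtain ⟨t, ht, h1⟩ := T.exists_arcAt_eq p₀ (N.opposite a)
    have htree : T.IsTree (T.arcAt p₀ t) := h1 ▸ Or.inr (by rwa [opposite_opposite])
    refine ⟨t + 1, ht, (T.mem_bag_of_not_opening p₀ fun hc => hc.1 htree).2 (Or.inl ?_)⟩
    rw [T.arcAt_succ_of_isTree p₀ htree, h1, opposite_opposite, rotate_fst]
    exact T.self_mem_path _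

/-- A tree link is covered when the tour goes down along it, a chord when it is opened, that is, at
the earlier of its two times. -/
theorem exists_mem_bag_of_adj {v v' : V} (h : G.Adj v v') :
    ∃ t ≤ Fintype.card N.Arc, v ∈ T.bag p₀ t ∧ v' ∈ T.bag p₀ t := by
  have up : ∀ a : N.Arc, T.IsUp a → ∃ t ≤ Fintype.card N.Arc,
      a.1 ∈ T.bag p₀ t ∧ (N.opposite a).1 ∈ T.bag p₀ t := by
    intro a ha
    obtain ⟨t, ht, h1⟩ := T.exists_arcAt_eq p₀ (N.opposite a)
    have htree : T.IsTree (T.arcAt p₀ t) := h1 ▸ Or.inr (by rwa [opposite_opposite])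
    have h2 : (T.arcAt p₀ (t + 1)).1 = a.1 := by
      rw [T.arcAt_succ_of_isTree p₀ htree, h1, opposite_opposite, rotate_fst]
    refine ⟨t + 1, ht, ?_, ?_⟩ <;>
      rw [T.mem_bag_of_not_opening p₀ fun hc => hc.1 htree, h2, T.mem_path_iff_of_isUp ha]
    · exact Or.inl (Or.inr rfl)
    · exact Or.inl (Or.inl (T.self_mem_path _))
  obtain ⟨a, rfl, rfl⟩ := N.exists_arc h
  by_cases ha : T.IsTree a
  · rcases ha with ha | ha
    · exact up a ha
    · obtain ⟨t, ht, h1, h2⟩ := up _ ha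
      rw [opposite_opposite] at h2
      exact ⟨t, ht, h2, h1⟩
  · obtain ⟨t, ht, h1⟩ := T.exists_arcAt_eq p₀ a
    have hc : T.IsChord p₀ t := by rwa [IsChord, h1]
    rcases (T.partner_ne p₀ t).lt_or_gt with h2 | h2
    · have h3 := T.arcAt_partner p₀ t
      have h4 := T.partner_partner p₀ ht
      refine ⟨T.partner p₀ t + 1, T.partner_lt p₀ t, ?_, ?_⟩ <;>
        rw [T.mem_bag_of_opening p₀ ((T.isChord_partner p₀).2 hc) (by omega), h3, h1,
          opposite_opposite]
      · exact Or.inr (T.self_mem_path _)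
      · exact Or.inl (Or.inl (T.self_mem_path _))
    · refine ⟨t + 1, ht, ?_, ?_⟩ <;> rw [T.mem_bag_of_opening p₀ hc h2, h1]
      · exact Or.inl (Or.inl (T.self_mem_path _))
      · exact Or.inr (T.self_mem_path _)

section Planar

variable (hG : G.Connected) (hN : N.IsPlanarEmbedding)
include hG hN

/-- A bag made at an opening is larger than its current path and anchor, but the new anchor is among
its three paths. -/
theorem mem_bag_of_mem_path_or_anchor {t : ℕ} (ht : t ≤ Fintype.card N.Arc) {x : V}
    (hx : x ∈ T.path (T.arcAt p₀ t).1 ∨ x ∈ T.anchor p₀ t) : x ∈ T.bag p₀ t := by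
  obtain _ | t := t
  · rw [arcAt_zero, anchor_zero, T.path_root, or_self] at hx
    exact hx
  · by_cases h : T.IsChord p₀ t ∧ t < T.partner p₀ t
    · rw [T.mem_bag_of_opening p₀ h.1 h.2]
      rw [T.arcAt_succ_of_isChord p₀ h.1, rotate_fst,
        T.anchor_succ_of_opening p₀ hG hN ht h.1 h.2] at hx
      tauto
    · exact (T.mem_bag_of_not_opening p₀ h).2 hx

/-- The third path of an opening bag is the next anchor, so membership in bags reduces to current
paths and anchors. -/
theorem exists_of_mem_bag {t : ℕ} (ht : t ≤ Fintype.card N.Arc) {x : V} (hx : x ∈ T.bag p₀ t) :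
    ∃ u ≤ t, x ∈ T.path (T.arcAt p₀ u).1 ∨ x ∈ T.anchor p₀ u := by
  obtain _ | t := t
  · exact ⟨0, le_rfl, Or.inl (by rw [arcAt_zero, T.path_root]; exact hx)⟩
  · by_cases h : T.IsChord p₀ t ∧ t < T.partner p₀ t
    · rw [T.mem_bag_of_opening p₀ h.1 h.2] at hx
      rcases hx with hx | hx
      · exact ⟨t, by omega, hx⟩
      · exact ⟨t + 1, le_rfl,
          Or.inr (by rwa [T.anchor_succ_of_opening p₀ hG hN ht h.1 h.2])⟩
    · exact ⟨t + 1, le_rfl, (T.mem_bag_of_not_opening p₀ h).1 hx⟩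

/-- A node that enters the bags at time `t`, because the tour meets a link to a descendant of
it, has not been in any bag before. -/
theorem not_mem_bag_of_new {t j : ℕ} (ht : t < Fintype.card N.Arc) {x : V}
    (hx1 : x ∉ T.path (T.arcAt p₀ t).1) (hx2 : x ∉ T.anchor p₀ t) (htj : t < j)
    (hj : j ≤ T.anchorTime p₀ t) (hxj : x ∈ T.path (T.arcAt p₀ j).1) {s : ℕ} (hs : s ≤ t) :
    x ∉ T.bag p₀ s := by
  intro hxs
  have hJ := T.anchorTime_le_card p₀ ht.le
  have hxr : x ≠ r := by
    rintro rfl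
    exact hx1 (T.root_mem_path _)
  -- The visits to the subtree of `x` form an interval that contains `j` but not `t`.
  have before : ∀ u ≤ t, x ∉ T.path (T.arcAt p₀ u).1 := fun u hu h =>
    hx1 (T.mem_path_of_between p₀ hxr hu htj.le (by omega) h hxj)
  obtain ⟨u, hu, h | h⟩ := T.exists_of_mem_bag p₀ hG hN (by omega) hxs
  · exact before u (by omega) h
  · rw [anchor] at h
    obtain ⟨h1, h2 | ⟨h2, h3, h4⟩⟩ := T.anchorTime_spec p₀ (t := u) (by omega)
    · rw [h2, arcAt_card, T.path_root, List.mem_singleton] at h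
      exact hxr h
    -- So `x` was on an earlier anchor, whose exit is still to come and hence not before `anchorTime
    -- t`. The interval of visits then contains `anchorTime t`, contrary to `hx2`.
    · have h5 : t < T.anchorTime p₀ u := by
        by_contra h5
        exact before _ (by omega) h
      have h6 := T.anchorTime_le p₀ h5.le h2 h3 (by omega)
      exact hx2 (T.mem_path_of_between p₀ hxr hj h6 h2.le hxj h)

/-- A closing brings nothing new: the opening bag already has both ends' paths and the old anchor.
In the other cases `x` is on the path of a node still to be visited in the current region, the far
end of the chord or the next node. -/
theorem not_mem_bag {t : ℕ} (ht : t < Fintype.card N.Arc) {x : V} (hx : x ∈ T.bag p₀ (t + 1))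
    (hx' : x ∉ T.bag p₀ (T.bagParent p₀ (t + 1))) {s : ℕ} (hs : s ≤ t) : x ∉ T.bag p₀ s := by
  by_cases hc : T.IsChord p₀ t
  · rcases (T.partner_ne p₀ t).lt_or_gt with h | h
    · exfalso
      apply hx'
      rw [bagParent, if_pos ⟨hc, h⟩, T.mem_bag_of_opening p₀ ((T.isChord_partner p₀).2 hc)
        (by rwa [T.partner_partner p₀ ht]), arcAt_partner, opposite_opposite]
      rw [T.mem_bag_of_not_opening p₀ (by omega), T.arcAt_succ_of_isChord p₀ hc, rotate_fst,
        T.anchor_succ_of_closing p₀ hG hN ht hc h] at hx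
      tauto
    · rw [bagParent, if_neg (by omega)] at hx'
      have h1 := fun h => hx' (T.mem_bag_of_mem_path_or_anchor p₀ hG hN ht.le h)
      rw [T.mem_bag_of_opening p₀ hc h] at hx
      have h2 : x ∈ T.path (T.arcAt p₀ (T.partner p₀ t)).1 := by
        rw [arcAt_partner]
        tauto
      refine T.not_mem_bag_of_new p₀ hG hN ht (fun h => h1 (Or.inl h)) (fun h => h1 (Or.inr h))
        h ?_ h2 hs
      obtain ⟨h3, h4 | ⟨h4, h5, h6⟩⟩ := T.anchorTime_spec p₀ ht.le
      · rw [h4]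
        exact (T.partner_lt p₀ t).le
      -- An exit before the chord is closed would require a crossing chord.
      · by_contra h7
        have h8 := T.partner_partner p₀ h4
        have h9 : T.anchorTime p₀ t ≠ t := by
          intro e
          rw [e] at h6
          omega
        exact T.not_crossing p₀ hG hN ((T.isChord_partner p₀).2 h5) hc h6 (by omega) (by omega)
  · have htree : T.IsTree (T.arcAt p₀ t) := not_not.1 hc
    rw [bagParent, if_neg fun h => hc h.1] at hx'
    have h1 := fun h => hx' (T.mem_bag_of_mem_path_or_anchor p₀ hG hN ht.le h)
    rw [T.mem_bag_of_not_opening p₀ fun h => hc h.1, T.anchor_succ_of_isTree p₀ ht htree] at hx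
    refine T.not_mem_bag_of_new p₀ hG hN ht (fun h => h1 (Or.inl h)) (fun h => h1 (Or.inr h))
      (Nat.lt_succ_self t) ?_ (by tauto) hs
    obtain ⟨h3, h4 | ⟨h4, h5, h6⟩⟩ := T.anchorTime_spec p₀ ht.le
    · omega
    · have : T.anchorTime p₀ t ≠ t := fun e => hc (e ▸ h5)
      omega

end Planar

end SpanningTree

end Network

namespace TourAlgorithm

/-! ### The algorithm -/

/-- The content of a message. Only one message is in transit at any time. A message explores the
network in search of short paths from the requesting node (`explore`, `back`), and then makes a
tour around the spanning tree that has been found (`probe`, `up`, `ack`). -/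
inductive Signal : Type
  | explore (path : List ℕ)
  | back
  | probe (anchor : List ℕ) (index : ℕ)
  | up (anchor : List ℕ) (index : ℕ)
  | ack (path : List ℕ)

namespace Signal

def toNats : Signal → List ℕ
  | explore l => 0 :: l
  | back => [1]
  | probe l i => 2 :: i :: l
  | up l i => 3 :: i :: l
  | ack l => 4 :: l

def ofNats : List ℕ → Signal
  | 0 :: l => explore l
  | 2 :: i :: l => probe l i
  | 3 :: i :: l => up l i
  | 4 :: l => ack l
  | _ => back

theorem ofNats_toNats (m : Signal) : ofNats m.toNats = m := by
  cases m <;> rfl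

end Signal

/-- A number as a sequence of bits, each preceded by the bit `true`; the bit `false` ends it. -/
def bitsOfNat (x : ℕ) : List Bool := x.bits.flatMap (fun b => [true, b]) ++ [false]

def bitsOfNats (l : List ℕ) : List Bool := l.flatMap bitsOfNat

def natsOfBits : List Bool → List ℕ
  | true :: b :: l =>
    match natsOfBits l with
    | x :: xs => Nat.bit b x :: xs
    | [] => []
  | false :: l => 0 :: natsOfBits l
  | _ => []

theorem natsOfBits_bitsOfNat_append (x : ℕ) (l : List Bool) :
    natsOfBits (bitsOfNat x ++ l) = x :: natsOfBits l := by
  induction x using Nat.binaryRec' with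
  | zero => simp [bitsOfNat, natsOfBits]
  | bit b n h ih =>
    rw [bitsOfNat, List.append_assoc] at ih
    rw [bitsOfNat, Nat.bits_append_bit _ _ h, List.flatMap_cons, List.append_assoc,
      List.append_assoc, List.cons_append, List.cons_append, List.nil_append, natsOfBits, ih]

theorem natsOfBits_bitsOfNats (l : List ℕ) : natsOfBits (bitsOfNats l) = l := by
  induction l with
  | nil => rfl
  | cons x l ih =>
    rw [bitsOfNats, List.flatMap_cons, natsOfBits_bitsOfNat_append]
    exact congrArg _ ih

theorem length_bitsOfNat (x : ℕ) : (bitsOfNat x).length = 2 * x.size + 1 := by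
  simp [bitsOfNat, List.length_flatMap, Nat.size_eq_bits_len, mul_comm]

theorem length_bitsOfNats_le (l : List ℕ) {c B : ℕ} (hl : l.length ≤ c) (hB : ∀ x ∈ l, x ≤ B) :
    (bitsOfNats l).length ≤ c * (2 * B.size + 1) := by
  refine le_trans ?_ (Nat.mul_le_mul_right _ hl)
  rw [bitsOfNats, List.length_flatMap]
  refine (List.sum_le_card_nsmul _ _ ?_).trans (by rw [List.length_map, smul_eq_mul])
  intro y hy
  obtain ⟨x, hx, rfl⟩ := List.mem_map.1 hy
  rw [length_bitsOfNat]
  have := Nat.size_le_size (hB x hx)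
  omega

def encode (m : Signal) : Message := bitsOfNats m.toNats

def decode (m : Message) : Signal := Signal.ofNats (natsOfBits m)

theorem decode_encode (m : Signal) : decode (encode m) = m := by
  rw [decode, encode, natsOfBits_bitsOfNats, Signal.ofNats_toNats]

/-- A bag as a list of at most `3k + 1` identifiers. -/
structure Bag (d : ℕ) where
  members : List ℕ
  parent : Option (Place d × ℕ)

/-- The filler is the first member, which is the requesting node in all bags of the algorithm. -/
def Bag.store {d : ℕ} (w : ℕ) (b : Bag d) : StoredBag w d where
  tuple i := b.members.getD i (b.members.headD 0)
  parent := b.parent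

/-- The state of a node with `d` ports: the identifiers on the shortest known path from the
requesting node, the port to the last but one node of this path, the ports that still have to be
explored; for each port of a chord that has been met before from the other side, the anchor at
that time and the index of the bag stored there; the current anchor, the bags, and whether the
node has terminated. -/
structure NodeState (d : ℕ) where
  path : List ℕ := []
  parent : Option (Fin d) := none
  todo : List (Fin d) := []
  closed : Fin d → Option (List ℕ × ℕ) := fun _ => none
  anchor : List ℕ := []
  bags : List (Bag d) := []
  finished : Bool := false

/-- The new state of a node and the message that it sends, with its port. -/
abbrev Action (d : ℕ) : Type := NodeState d × Option (Fin d × Signal)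

variable {d : ℕ}

def NodeState.addBag (s : NodeState d) (members : List ℕ) (parent : Option (Place d × ℕ)) :
    NodeState d :=
  { s with bags := s.bags ++ [⟨members, parent⟩] }

/-- The requesting node begins the tour. -/
def beginTour (s : NodeState d) : Action d :=
  if h : 0 < d then
    ({ s.addBag s.path none with anchor := s.path }, some (⟨0, h⟩, .probe s.path 0))
  else
    ({ s.addBag s.path none with finished := true }, none)

/-- The exploration continues with the next port. -/
def advance (s : NodeState d) : Action d :=
  match s.todo with
  | p :: l => ({ s with todo := l }, some (p, .explore s.path))
  | [] =>
    match s.parent with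
    | some q => (s, some (q, .back))
    | none => beginTour s

/-- The tour continues after port `q`. -/
def resume (next : Equiv.Perm (Fin d)) (s : NodeState d) (q : Fin d) (anchor : List ℕ) :
    Action d :=
  -- The arc to the parent is the last one of the tour at its node, so the node may stop.
  if s.parent = some (next.symm q) then
    ({ s with finished := true }, some (next.symm q, .up anchor (s.bags.length - 1)))
  -- The tour started at port 0 of the requesting node and is complete when it would use this port
  -- again.
  else if s.parent = none ∧ (next.symm q : ℕ) = 0 then
    ({ s with finished := true }, none)
  else
    ({ s with anchor := anchor }, some (next.symm q, .probe anchor (s.bags.length - 1)))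

/-- The reaction of a node that has not terminated. -/
def react (k ident : ℕ) (next : Equiv.Perm (Fin d)) (s : NodeState d) (q : Fin d) :
    Signal → Action d
  | .explore l =>
    -- The path would have `l.length + 1` nodes, thus at most k + 1; an empty `s.path` means that
    -- none is known.
    if l.length ≤ k ∧ (s.path = [] ∨ l.length + 1 < s.path.length) then
      advance { s with path := l ++ [ident], parent := some q, todo := List.finRange d }
    else (s, some (q, .back))
  | .back => advance s
  | .probe anchor i =>
    if s.parent = some q then
      resume next (s.addBag (s.path ++ anchor.tail) (some (.across q, i))) q anchor
    -- The sender is about to store the opening bag right after its bag `i`; the closing bag will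
    -- refer to it.
    else ({ s with closed := Function.update s.closed q (some (anchor, i + 1)) },
      some (q, .ack s.path))
  | .up anchor i =>
    resume next (s.addBag (s.path ++ anchor.tail) (some (.across q, i))) q anchor
  | .ack l =>
    -- An entry shows that the far end met the chord first, so the chord is being closed; otherwise
    -- it is being opened.
    match s.closed q with
    | some (anchor, i) =>
      resume next (s.addBag (s.path ++ anchor.tail) (some (.across q, i))) q anchor
    | none =>
      resume next (s.addBag (s.path ++ s.anchor.tail ++ l.tail)
        (some (.here, s.bags.length - 1))) q l

def step (k ident : ℕ) (next : Equiv.Perm (Fin d)) (s : NodeState d) (q : Fin d) (m : Signal) :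
    Action d :=
  if s.finished then
    match m with
    -- A node can finish before the far ends of its chords have met them, so it must still answer.
    | .probe _ _ => (s, some (q, .ack s.path))
    | _ => (s, none)
  else react k ident next s q m

def begin (ident : ℕ) : Action d :=
  advance { path := [ident], todo := List.finRange d }

def outbox (o : Option (Fin d × Signal)) (p : Fin d) : List Message :=
  match o with
  | some (q, m) => if q = p then [encode m] else []
  | none => []

/-- The algorithm. A node with `d` ports uses only the component `d` of its state. -/
def algorithm : DistributedAlgorithm where
  State := (d : ℕ) → NodeState d
  initial _ := fun _ => {}
  start x :=
    (Function.update (fun _ => {}) x.degree (begin x.ident).1, outbox (begin x.ident).2)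
  receive x s p m :=
    (Function.update s x.degree (step x.bound x.ident x.next (s x.degree) p (decode m)).1,
      outbox (step x.bound x.ident x.next (s x.degree) p (decode m)).2)
  output x s :=
    if (s x.degree).finished then some ((s x.degree).bags.map (Bag.store (3 * x.bound)))
    else none
  output_stable x s p m o h := by
    by_cases hf : (s x.degree).finished
    · have : (step x.bound x.ident x.next (s x.degree) p (decode m)).1 = s x.degree := by
        simp only [step, if_pos hf]
        split <;> rfl
      simp only [Function.update_self, this]
      exact h
    · rw [if_neg hf] at h
      cases h

/-! ### Executions -/

variable {V : Type*} [Fintype V] {G : SimpleGraph V} (N : Network G)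

/-- A configuration without the times: the states of the nodes, the message in transit, and the
messages sent so far. -/
structure Global where
  node : (v : V) → NodeState (N.deg v)
  token : Option (N.Arc × Signal)
  history : List (N.Arc × Signal)

variable {N}

open Classical in
/-- The node `v` performs an action. -/
def Global.perform (g : Global N) (v : V) (x : Action (N.deg v)) : Global N where
  node := Function.update g.node v x.1
  token := x.2.map fun y => (⟨v, y.1⟩, y.2)
  history := (x.2.map fun y => ((⟨v, y.1⟩, y.2) : N.Arc × Signal)).toList ++ g.history

variable (N) in
def Global.start (r : V) : Global N :=
  Global.perform ⟨fun _ => {}, none, []⟩ r (begin (N.ident r))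

/-- The message `m` is delivered over the arc `a`. -/
def Global.deliver (k : ℕ) (g : Global N) (a : N.Arc) (m : Signal) : Global N :=
  g.perform (N.opposite a).1 (step k (N.ident (N.opposite a).1) (N.next (N.opposite a).1)
    (g.node (N.opposite a).1) (N.opposite a).2 m)

/-- The configuration `c` occurs after the delivery of `i` messages, and it is `g`. -/
structure Corresponds (i : ℕ) (g : Global N) (c : N.Config algorithm) : Prop where
  node : ∀ v, c.state v (N.deg v) = g.node v
  transit : c.transit = g.token.elim 0 fun x => {⟨x.1, encode x.2, c.time⟩}
  sent : c.sent.map (fun q => (q.arc, q.content)) =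
    ((g.history.map fun x => (x.1, encode x.2) : List (N.Arc × Message)) : Multiset _)
  time : c.time ≤ i
  length : i + g.token.toList.length = g.history.length

theorem packets_outbox (v : V) (o : Option (Fin (N.deg v) × Signal)) (t : ℝ) :
    N.packets v (outbox o) t =
      (o.map fun y => ((⟨v, y.1⟩, y.2) : N.Arc × Signal)).elim 0
        fun x => {⟨x.1, encode x.2, t⟩} := by
  rw [Network.packets]
  rcases o with _ | ⟨p, m⟩
  · simp [outbox]
  · rw [Finset.sum_eq_single p]
    · simp [outbox]
    · intro q _ hq
      simp [outbox, Ne.symm hq]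
    · simp

theorem update_node [DecidableEq V] (s : V → (d : ℕ) → NodeState d)
    (node : (v : V) → NodeState (N.deg v)) (hs : ∀ v, s v (N.deg v) = node v) (w : V)
    (f : (d : ℕ) → NodeState d) (x : NodeState (N.deg w)) (v : V) :
    Function.update s w (Function.update f (N.deg w) x) v (N.deg v) =
      Function.update node w x v := by
  by_cases h : v = w
  · subst h
    rw [Function.update_self, Function.update_self, Function.update_self]
  · rw [Function.update_of_ne h, Function.update_of_ne h, hs]

theorem corresponds_start (k : ℕ) (r : V) :
    Corresponds 0 (Global.start N r) (N.startConfig algorithm k r) := by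
  classical
  have hp := packets_outbox r (begin (d := N.deg r) (N.ident r)).2 0
  refine ⟨fun v => ?_, hp, ?_, by simp [Network.startConfig], ?_⟩
  · exact update_node (N := N) (fun _ _ => {}) (fun _ => {}) (fun _ => rfl) r _ _ v
  · refine (congrArg (Multiset.map _) hp).trans ?_
    simp only [Global.start, Global.perform, List.append_nil]
    cases (begin (d := N.deg r) (N.ident r)).2 <;> simp
  · simp only [Global.start, Global.perform, List.append_nil, zero_add]

/-- There is no choice of a packet, and the only packet was sent at the time of the last event. So
the next event is at most one unit later. -/
theorem Corresponds.step {k i : ℕ} {g : Global N} {c c' : N.Config algorithm}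
    (h : Corresponds i g c) (hs : N.Step algorithm k c c') :
    ∃ a m, g.token = some (a, m) ∧ Corresponds (i + 1) (g.deliver k a m) c' := by
  classical
  obtain ⟨q, rest, t, h1, h2, h3, rfl⟩ := hs
  have htr := h.transit
  obtain ⟨node, token, history⟩ := g
  rcases token with _ | ⟨a, m⟩
  · rw [h1] at htr
    simp at htr
  · refine ⟨a, m, rfl, ?_⟩
    rw [h1] at htr
    simp only [Option.elim_some] at htr
    obtain ⟨rfl, rfl⟩ : q = ⟨a, encode m, c.time⟩ ∧ rest = 0 := by
      have := (Multiset.singleton_eq_cons_iff _).1 htr.symm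
      exact ⟨this.1.symm, this.2⟩
    have hr : N.reaction algorithm k c ⟨a, encode m, c.time⟩ =
        (Function.update (c.state (N.opposite a).1) (N.deg (N.opposite a).1)
          (TourAlgorithm.step k (N.ident (N.opposite a).1) (N.next (N.opposite a).1)
            (node (N.opposite a).1) (N.opposite a).2 m).1,
        outbox (TourAlgorithm.step k (N.ident (N.opposite a).1) (N.next (N.opposite a).1)
          (node (N.opposite a).1) (N.opposite a).2 m).2) := by
      have e1 := h.node (N.opposite a).1
      simp only at e1
      rw [← e1]
      conv_rhs => rw [← decode_encode m]
      rfl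
    rw [hr]
    have hp := packets_outbox (N.opposite a).1 (TourAlgorithm.step k (N.ident (N.opposite a).1)
      (N.next (N.opposite a).1) (node (N.opposite a).1) (N.opposite a).2 m).2 t
    refine ⟨fun v => ?_, ?_, ?_, ?_, ?_⟩
    · exact update_node (N := N) c.state node h.node (N.opposite a).1 _ _ v
    · simp only [zero_add]
      exact hp
    · simp only [Multiset.map_add]
      rw [hp, h.sent]
      simp only [Global.deliver, Global.perform]
      cases (TourAlgorithm.step k (N.ident (N.opposite a).1)
        (N.next (N.opposite a).1) (node (N.opposite a).1) (N.opposite a).2 m).2 with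
      | none => simp
      | some y => simp [← Multiset.cons_coe, add_comm]
    · have h4 := h3 ⟨a, encode m, c.time⟩ (by rw [h1]; simp)
      simp only at h4 ⊢
      have := h.time
      push_cast
      linarith
    · have h5 := h.length
      simp only [Option.toList_some, List.length_singleton] at h5
      simp only [Global.deliver, Global.perform, List.length_append]
      omega

/-- Properties of all configurations are proved by induction on the number of deliveries. -/
theorem exists_corresponds {k : ℕ} {r : V} {P : Global N → Prop} (h0 : P (Global.start N r))
    (hP : ∀ g a m, P g → g.token = some (a, m) → P (g.deliver k a m))
    {c : N.Config algorithm} (hc : N.Reachable algorithm k r c) :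
    ∃ i g, P g ∧ Corresponds i g c := by
  induction hc with
  | refl => exact ⟨0, _, h0, corresponds_start k r⟩
  | tail _ hs ih =>
    obtain ⟨i, g, hg, h⟩ := ih
    obtain ⟨a, m, htok, h'⟩ := h.step hs
    exact ⟨_, _, hP g a m hg htok, h'⟩

/-- Every delivery consumes a message, so a bound on the messages sent bounds the number of events.
-/
theorem alwaysTerminates {k B : ℕ} {r : V} {P : Global N → Prop} (h0 : P (Global.start N r))
    (hP : ∀ g a m, P g → g.token = some (a, m) → P (g.deliver k a m))
    (hB : ∀ g, P g → g.history.length ≤ B) : N.AlwaysTerminates algorithm k r := by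
  rintro ⟨e, he, hs⟩
  have : ∀ i, ∃ g, P g ∧ Corresponds i g (e i) := by
    intro i
    induction i with
    | zero => exact ⟨_, h0, he ▸ corresponds_start k r⟩
    | succ i ih =>
      obtain ⟨g, hg, h⟩ := ih
      obtain ⟨a, m, htok, h'⟩ := h.step (hs i)
      exact ⟨_, hP g a m hg htok, h'⟩
  obtain ⟨g, hg, h⟩ := this (B + 1)
  have h1 := h.length
  have h2 := hB g hg
  omega

end TourAlgorithm

/-! ### The invariant of the tour. -/

namespace TourAlgorithm

variable {V : Type*} [Fintype V] {G : SimpleGraph V} {N : Network G}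

/-- A signal consists of at most `k + 3` numbers, all of them at most `B`. -/
def Signal.IsSmall (k B : ℕ) (m : Signal) : Prop :=
  m.toNats.length ≤ k + 3 ∧ ∀ x ∈ m.toNats, x ≤ B

variable (N) in
/-- The identifiers of a list of nodes. -/
def ids (l : List V) : List ℕ := l.map N.ident

theorem le_of_mem_ids {l : List V} {x : ℕ} (h : x ∈ ids N l) : x ≤ Fintype.card V := by
  obtain ⟨v, -, rfl⟩ := List.mem_map.1 h
  exact (Finset.mem_Icc.1 (N.ident_mem v)).2

theorem isSmall_probe {k B : ℕ} (h4 : 4 ≤ B) (hB : Fintype.card V ≤ B) {l : List V}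
    (hl : l.length ≤ k + 1) {i : ℕ} (hi : i ≤ B) : (Signal.probe (ids N l) i).IsSmall k B := by
  refine ⟨by simpa [Signal.toNats, ids] using hl, fun x hx => ?_⟩
  simp only [Signal.toNats, List.mem_cons] at hx
  rcases hx with rfl | rfl | hx
  · omega
  · exact hi
  · exact (le_of_mem_ids hx).trans hB

theorem isSmall_up {k B : ℕ} (h4 : 4 ≤ B) (hB : Fintype.card V ≤ B) {l : List V}
    (hl : l.length ≤ k + 1) {i : ℕ} (hi : i ≤ B) : (Signal.up (ids N l) i).IsSmall k B := by
  refine ⟨by simpa [Signal.toNats, ids] using hl, fun x hx => ?_⟩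
  simp only [Signal.toNats, List.mem_cons] at hx
  rcases hx with rfl | rfl | hx
  · omega
  · exact hi
  · exact (le_of_mem_ids hx).trans hB

theorem isSmall_ack {k B : ℕ} (h4 : 4 ≤ B) (hB : Fintype.card V ≤ B) {l : List V}
    (hl : l.length ≤ k + 1) : (Signal.ack (ids N l)).IsSmall k B := by
  refine ⟨by simp [Signal.toNats, ids]; omega, fun x hx => ?_⟩
  simp only [Signal.toNats, List.mem_cons] at hx
  rcases hx with rfl | hx
  · omega
  · exact (le_of_mem_ids hx).trans hB

theorem isSmall_explore {k B : ℕ} (hB : Fintype.card V ≤ B) {l : List V}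
    (hl : l.length ≤ k + 1) : (Signal.explore (ids N l)).IsSmall k B := by
  refine ⟨by simp [Signal.toNats, ids]; omega, fun x hx => ?_⟩
  simp only [Signal.toNats, List.mem_cons] at hx
  rcases hx with rfl | hx
  · omega
  · exact (le_of_mem_ids hx).trans hB

theorem isSmall_back {k B : ℕ} (h4 : 4 ≤ B) : Signal.back.IsSmall k B := by
  refine ⟨by simp [Signal.toNats], fun x hx => ?_⟩
  simp only [Signal.toNats, List.mem_singleton] at hx
  omega

open Classical in
/-- The number of messages sent over an arc. -/
def load (h : List (N.Arc × Signal)) (a : N.Arc) : ℕ := h.countP fun x => x.1 = a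

/-- All nodes have terminated, and their bags form a decomposition. -/
structure IsFinal (k : ℕ) (r : V) (g : Global N) : Prop where
  token : g.token = none
  finished : ∀ v, (g.node v).finished = true
  stores : N.StoresDecomposition (3 * k) r fun v => (g.node v).bags.map (Bag.store (3 * k))

section Tour

variable {r : V} (T : N.SpanningTree r) (p₀ : Fin (N.deg r))

open Classical in
/-- The position of a bag in the list of the node at which it is stored. -/
def bagIndex (t : ℕ) : ℕ := Nat.count (fun s => (T.arcAt p₀ s).1 = (T.arcAt p₀ t).1) t

theorem bagIndex_le (t : ℕ) : bagIndex T p₀ t ≤ t := by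
  classical exact Nat.count_le _

/-- The tour stays at its node when it passes by a chord. This justifies the `i + 1` recorded by the
far end. -/
theorem bagIndex_succ_of_isChord {t : ℕ} (h : T.IsChord p₀ t) :
    bagIndex T p₀ (t + 1) = bagIndex T p₀ t + 1 := by
  have : (T.arcAt p₀ (t + 1)).1 = (T.arcAt p₀ t).1 := by
    rw [T.arcAt_succ_of_isChord p₀ h, N.rotate_fst]
  rw [bagIndex, this, Nat.count_succ, if_pos rfl, bagIndex]

/-- `b` is the bag created at time `t`, stored at the node `v`. -/
def IsBagAt (t : ℕ) {v : V} (b : Bag (N.deg v)) : Prop :=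
  b.members = ids N (T.bag p₀ t) ∧ (t = 0 → b.parent = none) ∧
    (t ≠ 0 → ∃ l, b.parent = some (l, bagIndex T p₀ (T.bagParent p₀ t)) ∧
      N.resolve v l = (T.arcAt p₀ (T.bagParent p₀ t)).1)

open Classical in
/-- The states of the nodes when the bags up to time `t` have been stored, the arcs before time `c`
have been announced at the other side, and the arcs before time `f` have been used. -/
structure TourNodes (node : (v : V) → NodeState (N.deg v)) (t c f : ℕ) : Prop where
  path : ∀ v, (node v).path = ids N (T.path v)
  parent : ∀ v, (node v).parent = T.port v
  length_bags : ∀ v, (node v).bags.length = Nat.count (fun s => (T.arcAt p₀ s).1 = v) (t + 1)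
  bags : ∀ s ≤ t, ∃ b, (node (T.arcAt p₀ s).1).bags[bagIndex T p₀ s]? = some b ∧
    IsBagAt T p₀ s b
  closed : ∀ s, t ≤ s → s < Fintype.card N.Arc → T.IsChord p₀ s →
    (node (T.arcAt p₀ s).1).closed (T.arcAt p₀ s).2 =
      if T.partner p₀ s < c then
        some (ids N (T.anchor p₀ (T.partner p₀ s)), bagIndex T p₀ (T.partner p₀ s + 1))
      else none
  finished : ∀ v, (node v).finished = true ↔ ∃ s < f, (T.arcAt p₀ s).1 = v ∧ T.IsUp (T.arcAt p₀ s)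

open Classical in
/-- The messages sent during the tour over the arcs before time `f`, and in response over the
opposites of the arcs before time `c`, after at most `K` messages over each arc. -/
structure TourHistory (k K B : ℕ) (h : List (N.Arc × Signal)) (f c : ℕ) : Prop where
  load : ∀ a, load h a ≤ K + Nat.count (fun s => T.arcAt p₀ s = a) f +
    Nat.count (fun s => T.arcAt p₀ s = N.opposite a) c
  small : ∀ x ∈ h, x.2.IsSmall k B

/-- The message with which the tour uses the arc at time `t`. -/
def tourSignal (t : ℕ) : Set Signal :=
  {m | (T.IsUp (T.arcAt p₀ t) ∧ m = .up (ids N (T.anchor p₀ t)) (bagIndex T p₀ t)) ∨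
    (¬ T.IsUp (T.arcAt p₀ t) ∧ m = .probe (ids N (T.anchor p₀ t)) (bagIndex T p₀ t))}

/-- The configurations during the tour. -/
inductive TourInvariant (k K B : ℕ) (g : Global N) : Prop
  | probe (t : ℕ) (ht : t < Fintype.card N.Arc) (nodes : TourNodes T p₀ g.node t t (t + 1))
    (history : TourHistory T p₀ k K B g.history (t + 1) t) (m : Signal)
    (hm : m ∈ tourSignal T p₀ t) (token : g.token = some (T.arcAt p₀ t, m))
    (anchor : ¬ T.IsUp (T.arcAt p₀ t) →
      (g.node (T.arcAt p₀ t).1).anchor = ids N (T.anchor p₀ t))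
  | ack (t : ℕ) (ht : t < Fintype.card N.Arc) (hc : T.IsChord p₀ t)
    (nodes : TourNodes T p₀ g.node t (t + 1) (t + 1))
    (history : TourHistory T p₀ k K B g.history (t + 1) (t + 1))
    (token : g.token = some (N.opposite (T.arcAt p₀ t),
      .ack (ids N (T.path (N.opposite (T.arcAt p₀ t)).1))))
    (anchor : (g.node (T.arcAt p₀ t).1).anchor = ids N (T.anchor p₀ t))
  | final (final : IsFinal k r g)
    (history : TourHistory T p₀ k K B g.history (Fintype.card N.Arc) (Fintype.card N.Arc))

variable {T p₀}

theorem TourNodes.congr {node node' : (v : V) → NodeState (N.deg v)} {t c f f' : ℕ}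
    (h : TourNodes T p₀ node t c f) (hpath : ∀ v, (node' v).path = (node v).path)
    (hparent : ∀ v, (node' v).parent = (node v).parent)
    (hbags : ∀ v, (node' v).bags = (node v).bags)
    (hclosed : ∀ v, (node' v).closed = (node v).closed)
    (hfinished : ∀ v, (node' v).finished = true ↔
      ∃ s < f', (T.arcAt p₀ s).1 = v ∧ T.IsUp (T.arcAt p₀ s)) :
    TourNodes T p₀ node' t c f' where
  path v := by rw [hpath, h.path]
  parent v := by rw [hparent, h.parent]
  length_bags v := by rw [hbags, h.length_bags]
  bags s hs := by rw [hbags]; exact h.bags s hs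
  closed s h1 h2 h3 := by rw [hclosed]; exact h.closed s h1 h2 h3
  finished := hfinished

theorem TourNodes.length_bags_sub {node : (v : V) → NodeState (N.deg v)} {t c f : ℕ}
    (h : TourNodes T p₀ node t c f) :
    (node (T.arcAt p₀ t).1).bags.length - 1 = bagIndex T p₀ t := by
  rw [h.length_bags, Nat.count_succ, if_pos rfl, Nat.add_sub_cancel, bagIndex]

open Classical in
-- The hypothesis `hc` covers both `c = t + 1`, after a chord, and `c = t`, after a tree link, which
-- is the partner of no chord.
theorem TourNodes.addBag {node : (v : V) → NodeState (N.deg v)} {t c : ℕ}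
    (h : TourNodes T p₀ node t c (t + 1)) {v : V}
    (hv : (T.arcAt p₀ (t + 1)).1 = v)
    (hc : ∀ s, t < s → s < Fintype.card N.Arc → T.IsChord p₀ s →
      (T.partner p₀ s < c ↔ T.partner p₀ s < t + 1))
    {l : List ℕ} {o : Option (Place (N.deg v) × ℕ)} (hb : IsBagAt T p₀ (t + 1) ⟨l, o⟩) :
    TourNodes T p₀ (Function.update node v ((node v).addBag l o)) (t + 1) (t + 1) (t + 1) := by
  subst hv
  refine ⟨fun w => ?_, fun w => ?_, fun w => ?_, fun s hs => ?_, fun s h1 h2 h3 => ?_,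
    fun w => ?_⟩
  · by_cases e : w = (T.arcAt p₀ (t + 1)).1
    · subst e
      rw [Function.update_self]
      exact h.path _
    · rw [Function.update_of_ne e]
      exact h.path _
  · by_cases e : w = (T.arcAt p₀ (t + 1)).1
    · subst e
      rw [Function.update_self]
      exact h.parent _
    · rw [Function.update_of_ne e]
      exact h.parent _
  · rw [Nat.count_succ]
    by_cases e : w = (T.arcAt p₀ (t + 1)).1
    · subst e
      rw [Function.update_self, if_pos rfl, ← h.length_bags]
      simp [NodeState.addBag]
    · rw [Function.update_of_ne e, if_neg (Ne.symm e), add_zero]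
      exact h.length_bags _
  · rcases hs.eq_or_lt with rfl | hs
    · refine ⟨⟨l, o⟩, ?_, hb⟩
      rw [Function.update_self]
      simp only [NodeState.addBag]
      have : bagIndex T p₀ (t + 1) = (node (T.arcAt p₀ (t + 1)).1).bags.length :=
        (h.length_bags _).symm
      rw [this, List.getElem?_concat_length]
    · obtain ⟨b, hb1, hb2⟩ := h.bags s (by omega)
      refine ⟨b, ?_, hb2⟩
      clear hb2
      generalize (T.arcAt p₀ s).1 = w at b hb1 ⊢
      by_cases e : w = (T.arcAt p₀ (t + 1)).1
      · subst e
        rw [Function.update_self]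
        simp only [NodeState.addBag]
        rw [List.getElem?_append_left (List.getElem?_eq_some_iff.1 hb1).1, hb1]
      · rw [Function.update_of_ne e, hb1]
  · have h4 := h.closed s (by omega) h2 h3
    rw [if_congr (hc s (by omega) h2 h3) rfl rfl] at h4
    rw [← h4]
    by_cases e : (T.arcAt p₀ s).1 = (T.arcAt p₀ (t + 1)).1
    · generalize T.arcAt p₀ s = a at e ⊢
      obtain ⟨w, p⟩ := a
      simp only at e
      subst e
      rw [Function.update_self]
      rfl
    · rw [Function.update_of_ne e]
  · by_cases e : w = (T.arcAt p₀ (t + 1)).1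
    · subst e
      rw [Function.update_self]
      exact h.finished _
    · rw [Function.update_of_ne e]
      exact h.finished _

/-- A node with an arc still to come has not used the arc to its parent, which is its last one. -/
theorem TourNodes.not_finished {node : (v : V) → NodeState (N.deg v)} {t c : ℕ}
    (h : TourNodes T p₀ node t c (t + 1)) {s : ℕ} (hts : t < s) (hs : s ≤ Fintype.card N.Arc)
    {v : V} (hv : (T.arcAt p₀ s).1 = v) : ¬ (node v).finished = true := by
  intro hf
  obtain ⟨u, hu, h1, h2⟩ := (h.finished v).1 hf
  exact T.le_of_isUp p₀ h2 (by omega : u < s) hs (hv.trans h1.symm)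

section

variable {k K B : ℕ} {h : List (N.Arc × Signal)} {f c : ℕ}

theorem TourHistory.mono (H : TourHistory T p₀ k K B h f c) {c' : ℕ} (hc : c ≤ c') :
    TourHistory T p₀ k K B h f c' := by
  classical
  refine ⟨fun a => (H.load a).trans ?_, H.small⟩
  have := Nat.count_monotone (fun s => T.arcAt p₀ s = N.opposite a) hc
  exact Nat.add_le_add_left this _

theorem TourHistory.cons_arcAt (H : TourHistory T p₀ k K B h f c) {m : Signal}
    (hm : m.IsSmall k B) : TourHistory T p₀ k K B ((T.arcAt p₀ f, m) :: h) (f + 1) c := by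
  classical
  refine ⟨fun a => ?_, fun x hx => ?_⟩
  · have := H.load a
    rw [TourAlgorithm.load] at *
    rw [List.countP_cons, Nat.count_succ]
    simp only [decide_eq_true_eq]
    omega
  · rcases List.mem_cons.1 hx with rfl | hx
    · exact hm
    · exact H.small x hx

theorem TourHistory.cons_opposite (H : TourHistory T p₀ k K B h f c) {m : Signal}
    (hm : m.IsSmall k B) :
    TourHistory T p₀ k K B ((N.opposite (T.arcAt p₀ c), m) :: h) f (c + 1) := by
  classical
  refine ⟨fun a => ?_, fun x hx => ?_⟩
  · have := H.load a
    rw [TourAlgorithm.load] at *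
    rw [List.countP_cons, Nat.count_succ]
    have e : N.opposite (T.arcAt p₀ c) = a ↔ T.arcAt p₀ c = N.opposite a :=
      ⟨fun e => by rw [← e, N.opposite_opposite], fun e => by rw [e, N.opposite_opposite]⟩
    simp only [decide_eq_true_eq, e]
    omega
  · rcases List.mem_cons.1 hx with rfl | hx
    · exact hm
    · exact H.small x hx

/-- The tour has each arc once, so an arc carries at most one message of the tour and one reply. -/
theorem TourHistory.load_le (H : TourHistory T p₀ k K B h f c) (hf : f ≤ Fintype.card N.Arc)
    (hc : c ≤ Fintype.card N.Arc) (a : N.Arc) : TourAlgorithm.load h a ≤ K + 2 := by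
  classical
  have key : ∀ (b : N.Arc) (n : ℕ), n ≤ Fintype.card N.Arc →
      Nat.count (fun s => T.arcAt p₀ s = b) n ≤ 1 := by
    intro b n hn
    rw [Nat.count_eq_card_filter_range, Finset.card_le_one]
    intro s hs t ht
    rw [Finset.mem_filter, Finset.mem_range] at hs ht
    exact T.arcAt_injOn p₀ (by omega) (by omega) (hs.2.trans ht.2.symm)
  have := H.load a
  have := key a f hf
  have := key (N.opposite a) c hc
  omega

end

section Planar

variable (hG : G.Connected) (hN : N.IsPlanarEmbedding) (hp₀ : (p₀ : ℕ) = 0) {k K B : ℕ}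
  (hk : ∀ v, (T.path v).length ≤ k + 1) (h4 : 4 ≤ B) (hB : Fintype.card V ≤ B)
  (hB' : Fintype.card N.Arc ≤ B)

include hk in
theorem length_anchor_le (t : ℕ) : (T.anchor p₀ t).length ≤ k + 1 := hk _

include hG hN hk in
theorem TourNodes.storesDecomposition {node : (v : V) → NodeState (N.deg v)} {c f : ℕ}
    (h : TourNodes T p₀ node (Fintype.card N.Arc) c f) :
    N.StoresDecomposition (3 * k) r fun v => (node v).bags.map (Bag.store (3 * k)) := by
  classical
  refine N.storesDecomposition_of_sequence (3 * k) (Fintype.card N.Arc) r _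
    (fun t => (T.arcAt p₀ t).1) (T.bag p₀) (T.bagParent p₀)
    (fun t => T.partner p₀ (t - 1) + 1) rfl (fun v => ?_) (fun t ht => ?_)
    (fun t _ => T.bagParent_succ_le p₀ t) (fun t ht => T.bagParent_mate p₀ ht)
    (fun t _ => T.root_mem_bag p₀ t) (fun t _ => T.length_bag_le p₀ hk t)
    (fun t ht x hx hx' s hs => T.not_mem_bag p₀ hG hN ht hx hx' hs)
    (T.exists_mem_bag p₀) (fun v v' => T.exists_mem_bag_of_adj p₀)
  · rw [List.length_map, h.length_bags]
  · obtain ⟨b, h1, h2, h3, h5⟩ := h.bags t ht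
    have e : ∀ s, Nat.count (fun u => (T.arcAt p₀ u).1 = (T.arcAt p₀ s).1) s =
        bagIndex T p₀ s := by
      intro s
      rw [bagIndex]
    simp only [e]
    refine ⟨b.store (3 * k), ?_, fun i => ?_, h3, h5⟩
    · rw [List.getElem?_map, h1]
      rfl
    · have hd : b.members.headD 0 = N.ident r := by
        rw [h2, ids]
        have : ∃ l, T.bag p₀ t = r :: l := by
          obtain _ | t := t
          · exact ⟨[], rfl⟩
          · rw [Network.SpanningTree.bag]
            obtain ⟨l1, e1⟩ := T.path_head (T.arcAt p₀ t).1
            obtain ⟨l2, e2⟩ := T.path_head (T.arcAt p₀ (t + 1)).1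
            split_ifs
            · exact ⟨_, by rw [e1]; rfl⟩
            · exact ⟨_, by rw [e2]; rfl⟩
        obtain ⟨l, hl⟩ := this
        rw [hl]
        rfl
      change b.members.getD i (b.members.headD 0) = _
      rw [hd, h2]
      rfl

include hG hN hp₀ hk h4 hB hB' in
open Classical in
-- The three branches of `resume` are decided locally, yet they agree with the global position: the
-- next arc goes up, or the tour is complete, or neither.
theorem tourInvariant_resume (g : Global N) {t : ℕ} (h1t : 1 ≤ t)
    (ht : t ≤ Fintype.card N.Arc) {v : V} {q : Fin (N.deg v)} {s : NodeState (N.deg v)}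
    (hv : T.arcAt p₀ t = N.rotate ⟨v, q⟩)
    (hnodes : TourNodes T p₀ (Function.update g.node v s) t t t)
    (hhist : TourHistory T p₀ k K B g.history t t) :
    TourInvariant T p₀ k K B
      (g.perform v (resume (N.next v) s q (ids N (T.anchor p₀ t)))) := by
  have hv' : T.arcAt p₀ t = ⟨v, (N.next v).symm q⟩ := hv
  have hv1 : (T.arcAt p₀ t).1 = v := by rw [hv']
  have hpar : s.parent = T.port v := by
    have := hnodes.parent v
    rwa [Function.update_self] at this
  have hlen : s.bags.length - 1 = bagIndex T p₀ t := by
    have := hnodes.length_bags_sub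
    rw [hv1, Function.update_self] at this
    exact this
  have hup : T.IsUp (T.arcAt p₀ t) ↔ s.parent = some ((N.next v).symm q) := by
    rw [hpar, hv']
    rfl
  have hlast : t = Fintype.card N.Arc → v = r ∧ ((N.next v).symm q : ℕ) = 0 := by
    rintro rfl
    rw [T.arcAt_card p₀] at hv'
    obtain ⟨rfl, h2⟩ := Sigma.mk.inj_iff.1 hv'
    exact ⟨rfl, by rw [← eq_of_heq h2, hp₀]⟩
  have hidx : bagIndex T p₀ t ≤ B := (bagIndex_le T p₀ t).trans (ht.trans hB')
  have hfin : ∀ x : NodeState (N.deg v), x.finished = s.finished → ∀ w,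
      (Function.update g.node v x w).finished = true ↔
        ∃ u < t, (T.arcAt p₀ u).1 = w ∧ T.IsUp (T.arcAt p₀ u) := by
    intro x hx w
    rw [← hnodes.finished w]
    by_cases e : w = v
    · subst e
      rw [Function.update_self, Function.update_self, hx]
    · rw [Function.update_of_ne e, Function.update_of_ne e]
  have hupd : ∀ {β : V → Type} (F : ∀ w, NodeState (N.deg w) → β w) (x : NodeState (N.deg v)),
      F v x = F v s → ∀ w, F w (Function.update g.node v x w) =
        F w (Function.update g.node v s w) := by
    intro β F x hx w
    by_cases e : w = v
    · subst e
      rw [Function.update_self, Function.update_self, hx]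
    · rw [Function.update_of_ne e, Function.update_of_ne e]
  rw [resume]
  split_ifs with c1 c2
  · have hIs := hup.2 c1
    have htL : t < Fintype.card N.Arc := by
      refine lt_of_le_of_ne ht fun e => T.ne_root_of_isUp hIs ?_
      rw [hv1, (hlast e).1]
    have htok : (⟨v, (N.next v).symm q⟩ : N.Arc) = T.arcAt p₀ t := hv'.symm
    refine .probe t htL ?_ ?_ (.up (ids N (T.anchor p₀ t)) (bagIndex T p₀ t)) (Or.inl ⟨hIs, rfl⟩)
      ?_ fun h => absurd hIs h
    · refine hnodes.congr (hupd (fun _ x => x.path) _ rfl) (hupd (fun _ x => x.parent) _ rfl)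
        (hupd (fun _ x => x.bags) _ rfl) (hupd (fun _ x => x.closed) _ rfl) fun w => ?_
      by_cases e : w = v
      · subst e
        simp only [Global.perform, Function.update_self, true_iff]
        exact ⟨t, Nat.lt_succ_self t, hv1, hIs⟩
      · have := hfin s rfl w
        rw [Function.update_of_ne e] at this
        simp only [Global.perform, Function.update_of_ne e]
        rw [this]
        refine ⟨fun ⟨u, h1, h2⟩ => ⟨u, by omega, h2⟩, fun ⟨u, h1, h2, h3⟩ => ⟨u, ?_, h2, h3⟩⟩
        rcases Nat.lt_succ_iff_lt_or_eq.1 h1 with h1 | rfl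
        · exact h1
        · exact absurd (h2.symm.trans hv1) e
    · simp only [Global.perform, Option.map_some, htok, hlen]
      exact hhist.cons_arcAt (isSmall_up h4 hB (length_anchor_le hk t) hidx)
    · simp only [Global.perform, Option.map_some, htok, hlen]
  · have hvr : v = r := by
      by_contra e
      obtain ⟨q', hq'⟩ := T.exists_port v e
      rw [← hpar, c2.1] at hq'
      cases hq'
    -- The first arc recurs only after a full round, and `1 ≤ t` excludes the start.
    have htL : t = Fintype.card N.Arc := by
      by_contra e
      have : T.arcAt p₀ t = T.arcAt p₀ 0 := by
        rw [hv', T.arcAt_zero]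
        clear hv' hv hv1 hup hlast
        subst hvr
        congr 1
        exact Fin.ext (c2.2.trans hp₀.symm)
      have := T.arcAt_injOn p₀ (by omega) (by omega) this
      omega
    subst htL
    refine .final ⟨rfl, fun w => ?_, ?_⟩ ?_
    · by_cases e : w = v
      · subst e
        simp only [Global.perform, Function.update_self]
      · obtain ⟨a, ha, ha'⟩ := T.exists_isUp (v := w) (by rwa [← hvr])
        obtain ⟨u, hu, rfl⟩ := T.exists_arcAt_eq p₀ a
        have := (hfin s rfl w).2 ⟨u, hu, ha, ha'⟩
        rw [Function.update_of_ne e] at this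
        simp only [Global.perform, Function.update_of_ne e]
        exact this
    · have := hnodes.storesDecomposition hG hN hk
      convert this using 3 with w
      exact hupd (fun _ x => x.bags) { s with finished := true } rfl w
    · simpa [Global.perform] using hhist
  · have hIs : ¬ T.IsUp (T.arcAt p₀ t) := fun h => c1 (hup.1 h)
    have htL : t < Fintype.card N.Arc := by
      refine lt_of_le_of_ne ht fun e => c2 ⟨?_, (hlast e).2⟩
      rw [hpar, (hlast e).1, T.port_root]
    have htok : (⟨v, (N.next v).symm q⟩ : N.Arc) = T.arcAt p₀ t := hv'.symm
    refine .probe t htL ?_ ?_ (.probe (ids N (T.anchor p₀ t)) (bagIndex T p₀ t))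
      (Or.inr ⟨hIs, rfl⟩) ?_ fun _ => ?_
    · refine hnodes.congr (hupd (fun _ x => x.path) _ rfl) (hupd (fun _ x => x.parent) _ rfl)
        (hupd (fun _ x => x.bags) _ rfl) (hupd (fun _ x => x.closed) _ rfl) fun w => ?_
      refine (hfin { s with anchor := ids N (T.anchor p₀ t) } rfl w).trans ⟨fun ⟨u, h1, h2⟩ => ⟨u, by omega, h2⟩,
        fun ⟨u, h1, h2, h3⟩ => ⟨u, ?_, h2, h3⟩⟩
      rcases Nat.lt_succ_iff_lt_or_eq.1 h1 with h1 | rfl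
      · exact h1
      · exact absurd h3 hIs
    · simp only [Global.perform, Option.map_some, htok, hlen]
      exact hhist.cons_arcAt (isSmall_probe h4 hB (length_anchor_le hk t) hidx)
    · simp only [Global.perform, Option.map_some, htok, hlen]
    · simp only [Global.perform]
      rw [hv1, Function.update_self]

end Planar

end Tour

end TourAlgorithm

/-! ### Deliveries during the tour. -/

namespace TourAlgorithm

variable {V : Type*} [Fintype V] {G : SimpleGraph V} {N : Network G}
variable {r : V} {T : N.SpanningTree r} {p₀ : Fin (N.deg r)}
  (hG : G.Connected) (hN : N.IsPlanarEmbedding) (hp₀ : (p₀ : ℕ) = 0) {k K B : ℕ}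
  (hk : ∀ v, (T.path v).length ≤ k + 1) (h4 : 4 ≤ B) (hB : Fintype.card V ≤ B)
  (hB' : Fintype.card N.Arc ≤ B)

theorem isBagAt_succ_of_not_opening {t t' : ℕ}
    (h : ¬ (T.IsChord p₀ t ∧ t < T.partner p₀ t)) {v : V} (hv : (T.arcAt p₀ (t + 1)).1 = v)
    {q : Fin (N.deg v)} (ht' : T.bagParent p₀ (t + 1) = t')
    (hq : N.neighbor v q = (T.arcAt p₀ t').1) :
    IsBagAt T p₀ (t + 1) (v := v) ⟨ids N (T.path v) ++ (ids N (T.anchor p₀ (t + 1))).tail,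
      some (.across q, bagIndex T p₀ t')⟩ := by
  refine ⟨?_, fun h => absurd h (Nat.succ_ne_zero t), fun _ => ⟨_, by rw [ht'], ?_⟩⟩
  · rw [Network.SpanningTree.bag, if_neg h, hv, ids, ids, ids, List.map_append, List.map_tail]
  · rw [ht']
    exact hq

theorem isBagAt_succ_of_opening {t : ℕ} (h : T.IsChord p₀ t) (h' : t < T.partner p₀ t) {v : V}
    (hv : (T.arcAt p₀ t).1 = v) :
    IsBagAt T p₀ (t + 1) (v := v) ⟨ids N (T.path v) ++ (ids N (T.anchor p₀ t)).tail ++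
      (ids N (T.path (N.opposite (T.arcAt p₀ t)).1)).tail,
      some (.here, bagIndex T p₀ t)⟩ := by
  have ht' : T.bagParent p₀ (t + 1) = t := by
    rw [Network.SpanningTree.bagParent, if_neg (by omega)]
  refine ⟨?_, fun h => absurd h (Nat.succ_ne_zero t), fun _ => ⟨_, by rw [ht'], ?_⟩⟩
  · rw [Network.SpanningTree.bag, if_pos ⟨h, h'⟩, hv, ids, ids, ids, ids, List.map_append,
      List.map_append, List.map_tail, List.map_tail]
  · rw [ht', hv]
    rfl

theorem step_of_not_finished {d : ℕ} (k ident : ℕ) (next : Equiv.Perm (Fin d))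
    {s : NodeState d} (h : ¬ s.finished = true) (q : Fin d) (m : Signal) :
    step k ident next s q m = react k ident next s q m := if_neg h

include hG hN hp₀ hk h4 hB hB' in
theorem tourInvariant_next (g : Global N) {t : ℕ} (ht : t < Fintype.card N.Arc) {v : V}
    {q : Fin (N.deg v)} {c : ℕ} (hv : T.arcAt p₀ (t + 1) = N.rotate ⟨v, q⟩)
    (hnodes : TourNodes T p₀ g.node t c (t + 1))
    (hc : ∀ s, t < s → s < Fintype.card N.Arc → T.IsChord p₀ s →
      (T.partner p₀ s < c ↔ T.partner p₀ s < t + 1))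
    (hhist : TourHistory T p₀ k K B g.history (t + 1) (t + 1))
    {l : List ℕ} {o : Option (Place (N.deg v) × ℕ)} (hb : IsBagAt T p₀ (t + 1) ⟨l, o⟩) :
    TourInvariant T p₀ k K B (g.perform v (resume (N.next v) ((g.node v).addBag l o) q
      (ids N (T.anchor p₀ (t + 1))))) := by
  classical
  exact tourInvariant_resume hG hN hp₀ hk h4 hB hB' g (Nat.succ_le_succ (Nat.zero_le t)) ht hv
    (hnodes.addBag (by rw [hv, N.rotate_fst]) hc hb) hhist

include hG hN hp₀ hk h4 hB hB' in
-- The receiver is the next node of the tour and goes on without a reply. It recognizes the tree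
-- link by the signal `up` or by its parent port.
theorem tourInvariant_deliver_tree (g : Global N) {t : ℕ} (ht : t < Fintype.card N.Arc)
    (htree : T.IsTree (T.arcAt p₀ t)) (nodes : TourNodes T p₀ g.node t t (t + 1))
    (history : TourHistory T p₀ k K B g.history (t + 1) t) {m : Signal}
    (hm : m ∈ tourSignal T p₀ t) :
    TourInvariant T p₀ k K B (g.deliver k (T.arcAt p₀ t) m) := by
  have hnext := T.arcAt_succ_of_isTree p₀ htree
  set b := N.opposite (T.arcAt p₀ t) with hb
  have hbv : (T.arcAt p₀ (t + 1)).1 = b.1 := by rw [hnext, N.rotate_fst]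
  have hfin := nodes.not_finished (Nat.lt_succ_self t) ht hbv
  have hchord : ¬ T.IsChord p₀ t := fun h => h htree
  have hpar : T.bagParent p₀ (t + 1) = t := by
    rw [Network.SpanningTree.bagParent, if_neg fun h => hchord h.1]
  have hanchor := T.anchor_succ_of_isTree p₀ ht htree
  have hstep : step k (N.ident b.1) (N.next b.1) (g.node b.1) b.2 m =
      resume (N.next b.1) ((g.node b.1).addBag
        (ids N (T.path b.1) ++ (ids N (T.anchor p₀ (t + 1))).tail)
          (some (.across b.2, bagIndex T p₀ t))) b.2 (ids N (T.anchor p₀ (t + 1))) := by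
    rw [step_of_not_finished _ _ _ hfin, hanchor, ← nodes.path]
    rcases hm with ⟨-, rfl⟩ | ⟨hup, rfl⟩
    · rfl
    · have : T.IsUp b := htree.resolve_left hup
      exact if_pos (by rw [nodes.parent]; exact this)
  rw [Global.deliver, ← hb, hstep]
  refine tourInvariant_next hG hN hp₀ hk h4 hB hB' g ht hnext nodes ?_
    (history.mono (Nat.le_succ t))
    (isBagAt_succ_of_not_opening (fun h => hchord h.1) hbv hpar ?_)
  · intro s h1 h2 h3
    have : T.partner p₀ s ≠ t := by
      intro e
      rw [← T.isChord_partner, e] at h3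
      exact hchord h3
    omega
  · exact congrArg Sigma.fst (N.opposite_opposite (T.arcAt p₀ t))

include hk h4 hB in
-- The tour does not move. The receiver records what it may need to close the chord later and
-- replies with its path.
theorem tourInvariant_deliver_chord (g : Global N) {t : ℕ} (ht : t < Fintype.card N.Arc)
    (hc : T.IsChord p₀ t) (nodes : TourNodes T p₀ g.node t t (t + 1))
    (history : TourHistory T p₀ k K B g.history (t + 1) t)
    (anchor : (g.node (T.arcAt p₀ t).1).anchor = ids N (T.anchor p₀ t)) :
    TourInvariant T p₀ k K B (g.deliver k (T.arcAt p₀ t)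
      (.probe (ids N (T.anchor p₀ t)) (bagIndex T p₀ t))) := by
  classical
  have hpt := T.partner_partner p₀ ht
  have hpe := T.arcAt_partner p₀ t
  have hpne := T.partner_ne p₀ t
  have hplt := T.partner_lt p₀ t
  set b := N.opposite (T.arcAt p₀ t) with hb
  have hnp : (g.node b.1).parent ≠ some b.2 := by
    rw [nodes.parent]
    exact fun h => hc (Or.inr h)
  have hpath := nodes.path b.1
  have hbags : ∀ x : NodeState (N.deg b.1), x.path = (g.node b.1).path →
      x.parent = (g.node b.1).parent → x.bags = (g.node b.1).bags →
      x.finished = (g.node b.1).finished → x.anchor = (g.node b.1).anchor →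
      (∀ s, t ≤ s → s < Fintype.card N.Arc → T.IsChord p₀ s →
        (Function.update g.node b.1 x (T.arcAt p₀ s).1).closed (T.arcAt p₀ s).2 =
        if T.partner p₀ s < t + 1 then
          some (ids N (T.anchor p₀ (T.partner p₀ s)), bagIndex T p₀ (T.partner p₀ s + 1))
        else none) →
      TourInvariant T p₀ k K B (g.perform b.1 (x, some (b.2, .ack (g.node b.1).path))) := by
    intro x h1 h2 h3 h5 h6 h7
    have hupd : ∀ {β : V → Type} (F : ∀ w, NodeState (N.deg w) → β w),
        F _ x = F _ (g.node b.1) → ∀ w, F w (Function.update g.node b.1 x w) = F w (g.node w) := by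
      intro β F hx w
      by_cases e : w = b.1
      · subst e
        rw [Function.update_self, hx]
      · rw [Function.update_of_ne e]
    refine .ack t ht hc ⟨fun v => ?_, fun v => ?_, fun v => ?_, fun s hs => ?_, h7, fun v => ?_⟩
      ?_ ?_ ?_
    · exact (hupd (fun _ y => y.path) h1 v).trans (nodes.path v)
    · exact (hupd (fun _ y => y.parent) h2 v).trans (nodes.parent v)
    · exact (congrArg List.length (hupd (fun _ y => y.bags) h3 v)).trans (nodes.length_bags v)
    · have := hupd (fun _ y => y.bags) h3 (T.arcAt p₀ s).1
      simp only [Global.perform]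
      rw [this]
      exact nodes.bags s hs
    · rw [← nodes.finished v]
      exact (hupd (fun _ y => y.finished) h5 v).congr_left
    · have := history.cons_opposite (isSmall_ack (N := N) h4 hB (hk b.1))
      simp only [Global.perform, hpath]
      exact this
    · simp only [Global.perform, Option.map_some, hpath]
      rfl
    · exact (hupd (fun _ y => y.anchor) h6 _).trans anchor
  have hclosed : ∀ s, t ≤ s → s < Fintype.card N.Arc → T.IsChord p₀ s → s ≠ T.partner p₀ t →
      (g.node (T.arcAt p₀ s).1).closed (T.arcAt p₀ s).2 =
        if T.partner p₀ s < t + 1 then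
          some (ids N (T.anchor p₀ (T.partner p₀ s)), bagIndex T p₀ (T.partner p₀ s + 1))
        else none := by
    intro s h1 h2 h3 h5
    rw [nodes.closed s h1 h2 h3]
    have : T.partner p₀ s ≠ t := by
      intro e
      have := T.partner_partner p₀ h2
      rw [e] at this
      exact h5 this.symm
    exact if_congr (by omega) rfl rfl
  rw [Global.deliver, ← hb, step]
  split_ifs with hf
  -- A finished node records nothing, and need not: its arcs have all been used, so the chord is now
  -- being closed.
  · refine hbags (g.node b.1) rfl rfl rfl rfl rfl fun s h1 h2 h3 => ?_
    rw [Function.update_eq_self]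
    refine hclosed s h1 h2 h3 ?_
    rintro rfl
    exact nodes.not_finished (by omega) h2.le (by rw [hpe]) hf
  · rw [react, if_neg hnp]
    refine hbags _ rfl rfl rfl rfl rfl fun s h1 h2 h3 => ?_
    by_cases e : s = T.partner p₀ t
    · subst e
      rw [if_pos (by rw [hpt]; exact Nat.lt_succ_self t), hpt, hpe, Function.update_self]
      simp only [Function.update_self]
      rw [bagIndex_succ_of_isChord T p₀ hc]
    · rw [← hclosed s h1 h2 h3 e]
      have hne : T.arcAt p₀ s ≠ b := by
        intro h
        rw [← hpe] at h
        exact e (T.arcAt_injOn p₀ h2 hplt h)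
      generalize T.arcAt p₀ s = a at hne ⊢
      obtain ⟨w, p⟩ := a
      by_cases hw : w = b.1
      · subst hw
        rw [Function.update_self]
        have : p ≠ b.2 := fun h => hne (by rw [h])
        simp only
        rw [Function.update_of_ne this]
      · rw [Function.update_of_ne hw]

include hG hN hp₀ hk h4 hB hB' in
-- By the invariant, the entry in `closed` is present exactly when the partner time is earlier, so
-- the node tells closing from opening correctly; the new anchor is the recorded one or the path in
-- the reply.
theorem tourInvariant_deliver_ack (g : Global N) {t : ℕ} (ht : t < Fintype.card N.Arc)
    (hc : T.IsChord p₀ t) (nodes : TourNodes T p₀ g.node t (t + 1) (t + 1))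
    (history : TourHistory T p₀ k K B g.history (t + 1) (t + 1))
    (anchor : (g.node (T.arcAt p₀ t).1).anchor = ids N (T.anchor p₀ t)) :
    TourInvariant T p₀ k K B (g.deliver k (N.opposite (T.arcAt p₀ t))
      (.ack (ids N (T.path (N.opposite (T.arcAt p₀ t)).1)))) := by
  have hpe := T.arcAt_partner p₀ t
  have hnext := T.arcAt_succ_of_isChord p₀ hc
  have hlen := nodes.length_bags_sub
  have hclosed := nodes.closed t le_rfl ht hc
  have hanchor : T.anchor p₀ (t + 1) = if T.partner p₀ t < t then T.anchor p₀ (T.partner p₀ t)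
      else T.path (N.opposite (T.arcAt p₀ t)).1 := by
    split_ifs with h
    · exact T.anchor_succ_of_closing p₀ hG hN ht hc h
    · exact T.anchor_succ_of_opening p₀ hG hN ht hc (by have := T.partner_ne p₀ t; omega)
  rw [Global.deliver, N.opposite_opposite]
  have hbv : (T.arcAt p₀ (t + 1)).1 = (T.arcAt p₀ t).1 := by rw [hnext, N.rotate_fst]
  have hfin := nodes.not_finished (Nat.lt_succ_self t) ht hbv
  rw [step_of_not_finished _ _ _ hfin, react, hclosed]
  have next := fun {l o} => tourInvariant_next (l := l) (o := o) hG hN hp₀ hk h4 hB hB' g ht hnext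
    nodes (fun _ _ _ _ => Iff.rfl) history
  rcases (T.partner_ne p₀ t).lt_or_gt with h | h
  · rw [if_pos h] at hanchor
    simp only [if_pos (show T.partner p₀ t < t + 1 by omega), ← hanchor, nodes.path]
    refine next (isBagAt_succ_of_not_opening (t' := T.partner p₀ t + 1) (by omega) hbv ?_ ?_)
    · rw [Network.SpanningTree.bagParent, if_pos ⟨hc, h⟩]
    · rw [T.arcAt_succ_of_isChord p₀ ((T.isChord_partner p₀).2 hc), N.rotate_fst, hpe]
      rfl
  · rw [if_neg (by omega)] at hanchor
    simp only [if_neg (show ¬ T.partner p₀ t < t + 1 by omega), nodes.path, hlen, anchor]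
    have := next (isBagAt_succ_of_opening hc h rfl)
    rw [hanchor] at this
    exact this

include hG hN hp₀ hk h4 hB hB' in
theorem tourInvariant_deliver (g : Global N) (h : TourInvariant T p₀ k K B g) {a : N.Arc}
    {m : Signal} (htok : g.token = some (a, m)) :
    TourInvariant T p₀ k K B (g.deliver k a m) := by
  cases h with
  | probe t ht nodes history m' hm token anchor =>
    rw [token] at htok
    obtain ⟨rfl, rfl⟩ := Prod.mk.inj (Option.some.inj htok)
    by_cases hc : T.IsTree (T.arcAt p₀ t)
    · exact tourInvariant_deliver_tree hG hN hp₀ hk h4 hB hB' g ht hc nodes history hm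
    · have hup : ¬ T.IsUp (T.arcAt p₀ t) := fun h => hc (Or.inl h)
      rcases hm with ⟨h, -⟩ | ⟨-, rfl⟩
      · exact absurd h hup
      · exact tourInvariant_deliver_chord hk h4 hB g ht hc nodes history (anchor hup)
  | ack t ht hc nodes history token anchor =>
    rw [token] at htok
    obtain ⟨rfl, rfl⟩ := Prod.mk.inj (Option.some.inj htok)
    exact tourInvariant_deliver_ack hG hN hp₀ hk h4 hB hB' g ht hc nodes history anchor
  | final final history =>
    rw [final.token] at htok
    cases htok

include hp₀ h4 hB in
/-- The tour begins. -/
theorem tourInvariant_beginTour (g : Global N) (s : NodeState (N.deg r))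
    (hspath : s.path = ids N [r]) (hsparent : s.parent = none) (hsbags : s.bags = [])
    (hsclosed : s.closed = fun _ => none) (hsfinished : s.finished = false)
    (hpath : ∀ v, v ≠ r → (g.node v).path = ids N (T.path v))
    (hparent : ∀ v, v ≠ r → (g.node v).parent = T.port v)
    (hbags : ∀ v, v ≠ r → (g.node v).bags = [])
    (hclosed : ∀ v, v ≠ r → (g.node v).closed = fun _ => none)
    (hfinished : ∀ v, v ≠ r → (g.node v).finished = false)
    (hload : ∀ a, load g.history a ≤ K) (hsmall : ∀ x ∈ g.history, x.2.IsSmall k B) :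
    TourInvariant T p₀ k K B (g.perform r (beginTour s)) := by
  classical
  have hd : 0 < N.deg r := p₀.pos
  have hp : (⟨0, hd⟩ : Fin (N.deg r)) = p₀ := Fin.ext hp₀.symm
  have hup : ¬ T.IsUp (T.arcAt p₀ 0) := fun h => T.ne_root_of_isUp h rfl
  have hL : 0 < Fintype.card N.Arc := Fintype.card_pos_iff.2 ⟨⟨r, p₀⟩⟩
  have hidx : bagIndex T p₀ 0 = 0 := by rw [bagIndex, Nat.count_zero]
  have hanchor := T.anchor_zero p₀
  rw [beginTour, dif_pos hd, hp]
  refine .probe 0 hL ⟨fun v => ?_, fun v => ?_, fun v => ?_, fun u hu => ?_, fun u _ hu hc => ?_,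
    fun v => ?_⟩ ?_ (.probe (ids N (T.anchor p₀ 0)) (bagIndex T p₀ 0)) (Or.inr ⟨hup, rfl⟩) ?_ ?_
  · by_cases e : v = r
    · subst e
      simp only [Global.perform, Function.update_self, NodeState.addBag]
      rw [hspath, T.path_root]
    · simp only [Global.perform, Function.update_of_ne e, hpath v e]
  · by_cases e : v = r
    · subst e
      simp only [Global.perform, Function.update_self, NodeState.addBag]
      rw [hsparent, T.port_root]
    · simp only [Global.perform, Function.update_of_ne e, hparent v e]
  · rw [Nat.count_succ, Nat.count_zero, zero_add, T.arcAt_zero]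
    by_cases e : v = r
    · subst e
      simp only [Global.perform, Function.update_self, NodeState.addBag]
      rw [hsbags]
      simp
    · simp only [Global.perform, Function.update_of_ne e, hbags v e, if_neg (Ne.symm e)]
      rfl
  · obtain rfl : u = 0 := by omega
    refine ⟨⟨ids N [r], none⟩, ?_, rfl, fun _ => rfl, fun h => absurd rfl h⟩
    simp only [Global.perform]
    rw [hidx]
    have : (Function.update g.node r
        { s.addBag s.path none with anchor := s.path } r).bags[0]? = some ⟨ids N [r], none⟩ := by
      rw [Function.update_self]
      simp only [NodeState.addBag]
      rw [hsbags, hspath]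
      rfl
    exact this
  · rw [if_neg (Nat.not_lt_zero _)]
    generalize T.arcAt p₀ u = a
    obtain ⟨v, q⟩ := a
    by_cases e : v = r
    · subst e
      simp only [Global.perform, Function.update_self, NodeState.addBag, hsclosed]
    · simp only [Global.perform, Function.update_of_ne e, hclosed v e]
  · have : ¬ ∃ u < 0 + 1, (T.arcAt p₀ u).1 = v ∧ T.IsUp (T.arcAt p₀ u) := by
      rintro ⟨u, hu, -, h⟩
      obtain rfl : u = 0 := by omega
      exact hup h
    rw [iff_false_right this]
    by_cases e : v = r
    · subst e
      simp only [Global.perform, Function.update_self, NodeState.addBag, hsfinished]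
      exact Bool.false_ne_true
    · simp only [Global.perform, Function.update_of_ne e, hfinished v e]
      exact Bool.false_ne_true
  · have H : TourHistory T p₀ k K B g.history 0 0 :=
      ⟨fun a => by rw [Nat.count_zero, Nat.count_zero]; exact hload a, hsmall⟩
    have := H.cons_arcAt (m := .probe (ids N [r]) 0)
      (isSmall_probe h4 hB (by simp) (Nat.zero_le _))
    rw [T.arcAt_zero] at this
    simp only [Global.perform, hspath]
    exact this
  · simp only [Global.perform, Option.map_some, hspath, hidx, hanchor]
    rfl
  · intro _
    rw [hanchor, ← hspath]
    simp only [Global.perform]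
    exact congrArg NodeState.anchor (Function.update_self (β := fun v => NodeState (N.deg v)) r _ _)

end TourAlgorithm

/-! ### The exploration. -/

namespace TourAlgorithm

variable {V : Type*} [Fintype V] {G : SimpleGraph V} {N : Network G}

def Signal.IsExplore : Signal → Prop
  | explore _ => True
  | _ => False

open Classical in
/-- The number of messages sent over an arc in order to explore it. -/
def explores (h : List (N.Arc × Signal)) (a : N.Arc) : ℕ :=
  h.countP fun x => x.1 = a ∧ x.2.IsExplore

open Classical in
/-- The number of replies sent over an arc. -/
def replies (h : List (N.Arc × Signal)) (a : N.Arc) : ℕ :=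
  h.countP fun x => x.1 = a ∧ ¬ x.2.IsExplore

theorem load_eq (h : List (N.Arc × Signal)) (a : N.Arc) :
    load h a = explores h a + replies h a := by
  classical
  induction h with
  | nil => rfl
  | cons x h ih =>
    rw [load, explores, replies, List.countP_cons, List.countP_cons, List.countP_cons]
    rw [load, explores, replies] at ih
    by_cases h1 : x.1 = a <;> by_cases h2 : x.2.IsExplore <;>
      simp [-Bool.decide_and, h1, h2] <;> omega

open Classical in
theorem explores_cons_explore (h : List (N.Arc × Signal)) (a b : N.Arc) (l : List ℕ) :
    explores ((b, .explore l) :: h) a = explores h a + if b = a then 1 else 0 := by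
  rw [explores, List.countP_cons, explores]
  simp [Signal.IsExplore]

theorem replies_cons_explore (h : List (N.Arc × Signal)) (a b : N.Arc) (l : List ℕ) :
    replies ((b, .explore l) :: h) a = replies h a := by
  rw [replies, List.countP_cons, replies]
  simp [Signal.IsExplore]

open Classical in
theorem replies_cons_back (h : List (N.Arc × Signal)) (a b : N.Arc) :
    replies ((b, .back) :: h) a = replies h a + if b = a then 1 else 0 := by
  rw [replies, List.countP_cons, replies]
  simp [Signal.IsExplore]

theorem explores_cons_back (h : List (N.Arc × Signal)) (a b : N.Arc) :
    explores ((b, .back) :: h) a = explores h a := by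
  rw [explores, List.countP_cons, explores]
  simp [Signal.IsExplore]

/-- The node that the exploration has reached by the arcs of the stack. -/
def top (r : V) : List N.Arc → V
  | [] => r
  | a :: _ => (N.opposite a).1

/-- The arcs by which the exploration has reached the current node. -/
def IsStack (r : V) (node : (v : V) → NodeState (N.deg v)) (P : V → List V) :
    List N.Arc → Prop
  | [] => True
  | a :: l => top r l = a.1 ∧ (node (N.opposite a).1).parent = some (N.opposite a).2 ∧
      (P (N.opposite a).1).length = (P a.1).length + 1 ∧ IsStack r node P l

/-- Lengths grow by one along the stack. Hence a node whose path is longer than that of the top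
cannot be on the stack. -/
theorem IsStack.length_le {r : V} {node : (v : V) → NodeState (N.deg v)} {P : V → List V}
    {l : List N.Arc} (h : IsStack r node P l) :
    (P r).length ≤ (P (top r l)).length ∧
      ∀ a ∈ l, (P (N.opposite a).1).length ≤ (P (top r l)).length := by
  induction l with
  | nil => exact ⟨le_rfl, by simp⟩
  | cons a l ih =>
    obtain ⟨h1, -, h3, h5⟩ := h
    obtain ⟨h6, h7⟩ := ih h5
    rw [h1] at h6 h7
    refine ⟨by simp only [top]; omega, fun b hb => ?_⟩
    rcases List.mem_cons.1 hb with rfl | hb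
    · exact le_rfl
    · have := h7 b hb
      simp only [top]
      omega

theorem top_eq_or {r : V} (l : List N.Arc) : top r l = r ∨ ∃ a ∈ l, top r l = (N.opposite a).1 := by
  cases l with
  | nil => exact Or.inl rfl
  | cons a l => exact Or.inr ⟨a, List.mem_cons_self, rfl⟩

theorem IsStack.congr {r : V} {node node' : (v : V) → NodeState (N.deg v)} {P P' : V → List V}
    {l : List N.Arc} (h : IsStack r node P l)
    (hr : P' r = P r) (hl : ∀ a ∈ l, P' (N.opposite a).1 = P (N.opposite a).1)
    (hn : ∀ a ∈ l, (node' (N.opposite a).1).parent = (node (N.opposite a).1).parent) :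
    IsStack r node' P' l := by
  induction l with
  | nil => trivial
  | cons a l ih =>
    obtain ⟨h1, h2, h3, h5⟩ := h
    have h6 : P' a.1 = P a.1 := by
      rw [← h1]
      rcases top_eq_or (r := r) l with e | ⟨b, hb, e⟩
      · rw [e, hr]
      · rw [e, hl b (List.mem_cons_of_mem _ hb)]
    refine ⟨h1, ?_, ?_, ih h5 (fun b hb => hl b (List.mem_cons_of_mem _ hb))
      fun b hb => hn b (List.mem_cons_of_mem _ hb)⟩
    · rw [hn a List.mem_cons_self, h2]
    · rw [hl a List.mem_cons_self, h6, h3]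

open Classical in
/-- The configurations during the exploration, where `P v` is the path known to the node `v`, and
`pending` the arc over which an exploring message is in transit. -/
structure ExploreCore (k B : ℕ) (r : V) (node : (v : V) → NodeState (N.deg v)) (P : V → List V)
    (stack : List N.Arc) (pending : Option N.Arc) (h : List (N.Arc × Signal)) : Prop where
  path : ∀ v, (node v).path = ids N (P v)
  bags : ∀ v, (node v).bags = []
  closed : ∀ v, (node v).closed = fun _ => none
  finished : ∀ v, (node v).finished = false
  path_root : P r = [r]
  parent_root : (node r).parent = none
  length_le : ∀ v, (P v).length ≤ k + 1
  parent_none : ∀ v, v ≠ r → (node v).parent = none → P v = []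
  -- The parent may have found a shorter path since; the last clause is then vacuous until the node
  -- itself is improved.
  parent : ∀ v q, (node v).parent = some q → P (N.neighbor v q) ≠ [] ∧
    (P (N.neighbor v q)).length < (P v).length ∧
    ((P v).length = (P (N.neighbor v q)).length + 1 → P v = P (N.neighbor v q) ++ [v])
  -- When no work is left, lengths increase by at most one across a link, unless the depth limit is
  -- reached.
  covered : ∀ v p, P v ≠ [] → p ∈ (node v).todo ∨ pending = some ⟨v, p⟩ ∨
    (P (N.neighbor v p) ≠ [] ∧ (P (N.neighbor v p)).length ≤ (P v).length + 1) ∨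
    (P v).length = k + 1
  isStack : IsStack r node P stack
  idle : ∀ v, v ≠ r → (∀ a ∈ stack, (N.opposite a).1 ≠ v) → (node v).todo = []
  -- An exploring message has been answered, or is on the stack, or is in transit.
  explores_eq : ∀ a, explores h a = replies h (N.opposite a) + stack.count a +
    if pending = some a then 1 else 0
  -- A potential: a new path schedules each port once more but is shorter by at least one; an
  -- unknown path counts as k + 2.
  explores_le : ∀ v p, explores h ⟨v, p⟩ + (node v).todo.count p +
    (if P v = [] then k + 2 else (P v).length) ≤ k + 2
  small : ∀ x ∈ h, x.2.IsSmall k B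

/-- The configurations of the executions. -/
inductive Invariant (k B : ℕ) (r : V) (g : Global N) : Prop
  | explore (P : V → List V) (stack : List N.Arc) (a : N.Arc) (ha : a.1 = top r stack)
    (core : ExploreCore k B r g.node P stack (some a) g.history)
    (token : g.token = some (a, .explore (ids N (P a.1))))
  | back (P : V → List V) (stack : List N.Arc) (a : N.Arc) (ha : (N.opposite a).1 = top r stack)
    (core : ExploreCore k B r g.node P stack none g.history)
    (token : g.token = some (a, .back))
  | tour (T : N.SpanningTree r) (p₀ : Fin (N.deg r)) (hp₀ : (p₀ : ℕ) = 0)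
    (hk : ∀ v, (T.path v).length ≤ k + 1) (inv : TourInvariant T p₀ k (2 * (k + 1)) B g)
  | final (final : IsFinal k r g) (load : ∀ a, load g.history a ≤ 2 * (k + 1))
    (small : ∀ x ∈ g.history, x.2.IsSmall k B)

variable {k B : ℕ} {r : V}

/-- Replies over an arc answer exploring messages over its opposite, and there are at most k + 1 of
these. -/
theorem ExploreCore.load_le {node : (v : V) → NodeState (N.deg v)} {P : V → List V}
    {stack : List N.Arc} {pending : Option N.Arc} {h : List (N.Arc × Signal)}
    (H : ExploreCore k B r node P stack pending h) (a : N.Arc) : load h a ≤ 2 * (k + 1) := by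
  classical
  have key : ∀ a : N.Arc, explores h a ≤ k + 1 := by
    rintro ⟨v, p⟩
    have := H.explores_le v p
    by_cases e : P v = []
    · rw [if_pos e] at this
      omega
    · rw [if_neg e] at this
      have := List.length_pos_iff.2 e
      omega
  have h1 := H.explores_eq (N.opposite a)
  rw [N.opposite_opposite] at h1
  have h2 := key a
  have h3 := key (N.opposite a)
  rw [load_eq]
  omega

/-- After the exploration all nodes know shortest paths. -/
theorem ExploreCore.exists_spanningTree (hG : G.Connected) (hd : ∀ u v, G.dist u v ≤ k)
    {node : (v : V) → NodeState (N.deg v)} {P : V → List V} {h : List (N.Arc × Signal)}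
    (H : ExploreCore k B r node P [] none h) (htodo : (node r).todo = []) :
    ∃ T : N.SpanningTree r, T.path = P ∧ ∀ v, T.port v = (node v).parent := by
  have htodo' : ∀ v, (node v).todo = [] := by
    intro v
    by_cases e : v = r
    · rw [e, htodo]
    · exact H.idle v e (by simp)
  have cov : ∀ a : N.Arc, P a.1 ≠ [] →
      (P (N.opposite a).1 ≠ [] ∧ (P (N.opposite a).1).length ≤ (P a.1).length + 1) ∨
      (P a.1).length = k + 1 := by
    rintro ⟨v, p⟩ hv
    rcases H.covered v p hv with h1 | h1 | h1
    · rw [htodo'] at h1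
      cases h1
    · cases h1
    · exact h1
  -- The bound spreads along a walk from the root; since the walk has length at most k, the depth
  -- limit does not interfere.
  have walk : ∀ {v : V} (p : G.Walk v r), p.length ≤ k →
      P v ≠ [] ∧ (P v).length ≤ p.length + 1 := by
    intro v p
    induction hw : p.length generalizing v with
    | zero =>
      obtain rfl := SimpleGraph.Walk.eq_of_length_eq_zero hw
      intro
      simp [H.path_root]
    | succ n ih =>
      intro hn
      cases p with
      | nil => cases hw
      | cons hadj p =>
        rw [SimpleGraph.Walk.length_cons] at hw
        obtain ⟨h1, h2⟩ := ih p (by omega) (by omega)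
        obtain ⟨a, rfl, rfl⟩ := N.exists_arc hadj.symm
        rcases cov a h1 with h3 | h3
        · exact ⟨h3.1, by omega⟩
        · omega
  have all : ∀ v, P v ≠ [] := by
    intro v
    obtain ⟨p, hp⟩ := hG.exists_walk_length_eq_dist v r
    exact (walk p (hp ▸ hd v r)).1
  refine ⟨⟨fun v => (node v).parent, P, H.parent_root, H.path_root, fun v hv => ?_,
    fun v q hq => ?_⟩, rfl, fun v => rfl⟩
  · cases e : (node v).parent with
    | none => exact absurd (H.parent_none v hv e) (all v)
    | some q => exact ⟨q, rfl⟩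
  · obtain ⟨h1, h2, h3⟩ := H.parent v q hq
    apply h3
    have h4 := cov (N.opposite ⟨v, q⟩) h1
    rw [N.opposite_opposite] at h4
    change (P v ≠ [] ∧ (P v).length ≤ (P (N.neighbor v q)).length + 1) ∨
      (P (N.neighbor v q)).length = k + 1 at h4
    have := H.length_le v
    omega

/-- The network with a single node, in which there is no arc to start a tour. -/
theorem storesDecomposition_of_deg_eq_zero (hG : G.Connected) (hr : N.deg r = 0)
    (out : (v : V) → List (StoredBag (3 * k) (N.deg v)))
    (hout : ∀ v, out v = [⟨fun i => [N.ident r].getD i (N.ident r), none⟩]) :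
    N.StoresDecomposition (3 * k) r out := by
  classical
  have hV : ∀ v, v = r := by
    intro v
    by_contra e
    have : Nontrivial V := ⟨⟨v, r, e⟩⟩
    obtain ⟨w, hw⟩ := hG.preconnected.exists_adj_of_nontrivial r
    obtain ⟨a, rfl, -⟩ := N.exists_arc hw
    exact N.deg_ne_zero hG a _ hr
  refine N.storesDecomposition_of_sequence (3 * k) 0 r _ (fun _ => r) (fun _ => [r]) id id rfl
    (fun v => ?_) (fun t ht => ?_) (by simp) (by simp) (by simp) (by simp) (by simp)
    (fun v => ⟨0, le_rfl, by simp [hV v]⟩) (fun v w h => ?_)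
  · rw [hout, hV v]
    simp
  · obtain rfl : t = 0 := by omega
    refine ⟨⟨fun i => [N.ident r].getD i (N.ident r), none⟩, ?_, fun i => rfl, fun _ => rfl,
      fun h => absurd rfl h⟩
    rw [hout]
    simp
  · rw [hV v, hV w] at h
    exact absurd h G.irrefl

theorem ids_singleton (v : V) : ids N [v] = [N.ident v] := rfl

section

variable (hG : G.Connected) (hd : ∀ u v, G.dist u v ≤ k)
  (h4 : 4 ≤ B) (hB : Fintype.card V ≤ B)

include hG hd h4 hB

open Classical in
theorem invariant_beginTour (g : Global N) {s : NodeState (N.deg r)} {P : V → List V}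
    (core : ExploreCore k B r (Function.update g.node r s) P [] none g.history)
    (htodo : s.todo = []) : Invariant k B r (g.perform r (beginTour s)) := by
  have hs := core.path r
  have hs1 := core.parent_root
  have hs2 := core.bags r
  have hs3 := core.closed r
  have hs4 := core.finished r
  rw [Function.update_self] at hs hs1 hs2 hs3 hs4
  rw [core.path_root] at hs
  have hother : ∀ v, v ≠ r → Function.update g.node r s v = g.node v :=
    fun v hv => Function.update_of_ne hv _ _
  by_cases h0 : 0 < N.deg r
  · obtain ⟨T, rfl, hT⟩ := core.exists_spanningTree hG hd (by rw [Function.update_self, htodo])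
    refine .tour T ⟨0, h0⟩ rfl core.length_le (tourInvariant_beginTour rfl h4 hB g s hs hs1 hs2
      hs3 hs4 (fun v hv => ?_) (fun v hv => ?_) (fun v hv => ?_) (fun v hv => ?_) (fun v hv => ?_)
      core.load_le core.small)
    · rw [← core.path v, hother v hv]
    · rw [hT, hother v hv]
    · rw [← hother v hv, core.bags]
    · rw [← hother v hv, core.closed]
    · rw [← hother v hv, core.finished]
  · have hV : ∀ v, v = r := by
      intro v
      by_contra e
      have : Nontrivial V := ⟨⟨v, r, e⟩⟩
      obtain ⟨w, hw⟩ := hG.preconnected.exists_adj_of_nontrivial r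
      obtain ⟨a, rfl, -⟩ := N.exists_arc hw
      exact h0 a.2.pos
    rw [beginTour, dif_neg h0]
    refine .final ⟨rfl, fun v => ?_, ?_⟩ ?_ ?_
    · obtain rfl := hV v
      simp only [Global.perform, Function.update_self]
    · refine storesDecomposition_of_deg_eq_zero hG (Nat.eq_zero_of_not_pos h0) _ fun v => ?_
      obtain rfl := hV v
      simp only [Global.perform, Function.update_self, NodeState.addBag, hs2, hs, ids_singleton]
      rfl
    · simpa [Global.perform] using core.load_le
    · simpa [Global.perform] using core.small

open Classical in
-- The search goes on with the next port, or returns to the node below on the stack, or, with an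
-- empty stack and nothing left to do, becomes the tour.
theorem invariant_advance (g : Global N) {v : V} {s : NodeState (N.deg v)} {P : V → List V}
    {stack : List N.Arc} (hv : v = top r stack)
    (core : ExploreCore k B r (Function.update g.node v s) P stack none g.history) :
    Invariant k B r (g.perform v (advance s)) := by
  have hpath := core.path v
  rw [Function.update_self] at hpath
  have hupd : ∀ {β : V → Type} (F : ∀ w, NodeState (N.deg w) → β w) (x : NodeState (N.deg v)),
      F v x = F v s → ∀ w, F w (Function.update g.node v x w) =
        F w (Function.update g.node v s w) := by
    intro β F x hx w
    by_cases e : w = v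
    · subst e
      rw [Function.update_self, Function.update_self, hx]
    · rw [Function.update_of_ne e, Function.update_of_ne e]
  cases htodo : s.todo with
  | cons p l =>
    have hadv : advance s = ({ s with todo := l }, some (p, .explore s.path)) := by
      rw [advance, htodo]
    rw [hadv]
    have u1 := hupd (fun _ x => x.path) { s with todo := l } rfl
    have u2 := hupd (fun _ x => x.parent) { s with todo := l } rfl
    have u3 := hupd (fun _ x => x.bags) { s with todo := l } rfl
    have u4 := hupd (fun _ x => x.closed) { s with todo := l } rfl
    have u5 := hupd (fun _ x => x.finished) { s with todo := l } rfl
    have hcount : ∀ a, explores ((⟨v, p⟩, .explore s.path) :: g.history) a =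
      explores g.history a + if (⟨v, p⟩ : N.Arc) = a then 1 else 0 := fun a =>
        explores_cons_explore _ _ _ _
    refine .explore P stack ⟨v, p⟩ hv ⟨fun w => (u1 w).trans (core.path w),
      fun w => (u3 w).trans (core.bags w), fun w => (u4 w).trans (core.closed w),
      fun w => (u5 w).trans (core.finished w), core.path_root, (u2 r).trans core.parent_root,
      core.length_le, fun w hw h => core.parent_none w hw ((u2 w).symm.trans h),
      fun w q h => core.parent w q ((u2 w).symm.trans h), fun w q hw => ?_,
      core.isStack.congr rfl (fun _ _ => rfl) fun a _ => u2 _, fun w h1 h2 => ?_,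
      fun a => ?_, fun w q => ?_, ?_⟩ ?_
    · have := core.covered w q hw
      by_cases e : w = v
      · subst e
        simp only [Global.perform, Function.update_self] at this ⊢
        rw [htodo, List.mem_cons] at this
        rcases this with (rfl | h) | h | h
        · exact Or.inr (Or.inl rfl)
        · exact Or.inl h
        · cases h
        · exact Or.inr (Or.inr h)
      · simp only [Global.perform, Function.update_of_ne e] at this ⊢
        rcases this with h | h | h
        · exact Or.inl h
        · cases h
        · exact Or.inr (Or.inr h)
    · have e : w ≠ v := by
        rintro rfl
        rcases top_eq_or (r := r) stack with h | ⟨a, ha, h⟩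
        · exact h1 (hv.trans h)
        · exact h2 a ha (h.symm.trans hv.symm)
      have := core.idle w h1 h2
      simp only [Global.perform, Function.update_of_ne e] at this ⊢
      exact this
    · have h1 := core.explores_eq a
      simp only [Global.perform, Option.map_some, Option.toList_some, List.singleton_append]
      rw [hcount, replies_cons_explore, h1]
      simp
    · have h1 := core.explores_le w q
      simp only [Global.perform, Option.map_some, Option.toList_some, List.singleton_append]
      rw [hcount]
      by_cases e : w = v
      · subst e
        rw [Function.update_self] at h1 ⊢
        rw [htodo, List.count_cons] at h1
        have : ((⟨w, p⟩ : N.Arc) = ⟨w, q⟩) ↔ p = q := by simp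
        simp only [this]
        simp only [beq_iff_eq] at h1
        omega
      · rw [Function.update_of_ne e] at h1 ⊢
        have : (⟨v, p⟩ : N.Arc) ≠ ⟨w, q⟩ := fun h => e (congrArg Sigma.fst h).symm
        rw [if_neg this]
        exact h1
    · simp only [Global.perform, Option.map_some, Option.toList_some, List.singleton_append,
        List.mem_cons]
      rintro x (rfl | hx)
      · simp only [hpath]
        exact isSmall_explore hB (core.length_le v)
      · exact core.small x hx
    · simp only [Global.perform, Option.map_some, hpath]
  | nil =>
    cases hpar : s.parent with
    | some q =>
      have hadv : advance s = (s, some (q, .back)) := by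
        rw [advance, htodo, hpar]
      rw [hadv]
      cases stack with
      | nil =>
        obtain rfl : v = r := hv
        have := core.parent_root
        rw [Function.update_self, hpar] at this
        cases this
      | cons a l =>
        obtain ⟨h1, h2, h3, h5⟩ := core.isStack
        -- The parent port is the reverse of the top arc, so `back` answers the message that brought
        -- the search here.
        have ha : N.opposite a = ⟨v, q⟩ := by
          have hv' : v = (N.opposite a).1 := hv
          generalize N.opposite a = b at hv' h2 ⊢
          obtain ⟨w, p⟩ := b
          obtain rfl : v = w := hv'
          simp only at h2
          rw [Function.update_self, hpar] at h2
          rw [Option.some.inj h2]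
        have ha' : N.opposite ⟨v, q⟩ = a := by rw [← ha, N.opposite_opposite]
        refine .back P l ⟨v, q⟩ (by rw [ha', h1]) ⟨core.path, core.bags, core.closed,
          core.finished, core.path_root, core.parent_root, core.length_le, core.parent_none,
          core.parent, core.covered, h5, fun w h6 h7 => ?_, fun b => ?_, fun w p => ?_, ?_⟩ rfl
        · by_cases e : w = v
          · subst e
            simp only [Global.perform, Function.update_self]
            exact htodo
          · refine core.idle w h6 fun b hb => ?_
            rcases List.mem_cons.1 hb with rfl | hb
            · rw [ha]
              exact Ne.symm e
            · exact h7 b hb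
        · have h6 := core.explores_eq b
          simp only [Global.perform, Option.map_some, Option.toList_some, List.singleton_append]
          rw [explores_cons_back, replies_cons_back, h6, List.count_cons]
          have : (⟨v, q⟩ : N.Arc) = N.opposite b ↔ a = b := by
            rw [← ha]
            exact N.opposite_involutive.injective.eq_iff
          simp only [this, beq_iff_eq]
          omega
        · have h6 := core.explores_le w p
          simp only [Global.perform, Option.map_some, Option.toList_some, List.singleton_append]
          rw [explores_cons_back]
          exact h6
        · simp only [Global.perform, Option.map_some, Option.toList_some, List.singleton_append,
            List.mem_cons]
          rintro x (rfl | hx)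
          · exact isSmall_back h4
          · exact core.small x hx
    | none =>
      have hadv : advance s = beginTour s := by
        rw [advance, htodo, hpar]
      rw [hadv]
      cases stack with
      | nil =>
        obtain rfl : v = r := hv
        exact invariant_beginTour hG hd h4 hB g core htodo
      | cons a l =>
        obtain ⟨h1, h2, h3, h5⟩ := core.isStack
        obtain rfl : v = (N.opposite a).1 := hv
        rw [Function.update_self, hpar] at h2
        cases h2

/-- A node that adopts a path is not on the stack and hence idle, so resetting its list of ports
loses no work. A refusal means that the receiver's path is short enough or the sender is at the
depth limit, which is what `covered` demands. -/
theorem invariant_deliver_explore (g : Global N) {P : V → List V} {stack : List N.Arc}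
    {a : N.Arc} (ha : a.1 = top r stack)
    (core : ExploreCore k B r g.node P stack (some a) g.history) :
    Invariant k B r (g.deliver k a (.explore (ids N (P a.1)))) := by
  classical
  have hb : N.opposite (N.opposite a) = a := N.opposite_opposite a
  have hadj := N.adj_opposite a
  obtain ⟨hst1, hst2⟩ := core.isStack.length_le
  rw [← ha] at hst1 hst2
  rw [core.path_root, List.length_singleton] at hst1
  rw [Global.deliver]
  have hab : a = N.opposite (N.opposite a) := hb.symm
  generalize N.opposite a = b at *
  have hne : a.1 ≠ b.1 := hadj.ne
  rw [step_of_not_finished _ _ _ (by rw [core.finished]; exact Bool.false_ne_true), react]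
  have hlen : (ids N (P a.1)).length = (P a.1).length := List.length_map _
  have hlen' : (g.node b.1).path.length = (P b.1).length := by
    rw [core.path]
    exact List.length_map _
  have hnil : (g.node b.1).path = [] ↔ P b.1 = [] := by
    rw [← List.length_eq_zero_iff, hlen', List.length_eq_zero_iff]
  rw [hlen, hlen']
  split_ifs with hcond <;> rw [hnil] at hcond
  · obtain ⟨hc1, hc2⟩ := hcond
    have hbr : b.1 ≠ r := by
      intro e
      rw [e, core.path_root] at hc2
      simp at hc2
    -- Nodes on the stack have non-empty paths no longer than the sender's; the receiver has none or
    -- a longer one.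
    have hbst : ∀ c ∈ stack, (N.opposite c).1 ≠ b.1 := by
      intro c hc e
      have := hst2 c hc
      rw [e] at this
      rcases hc2 with h | h
      · have hs := core.isStack
        clear this
        have : ∀ l : List N.Arc, IsStack r g.node P l → ∀ c ∈ l, P (N.opposite c).1 ≠ [] := by
          intro l
          induction l with
          | nil => simp
          | cons d l ih =>
            rintro ⟨-, -, h3, h5⟩ c hc h6
            rcases List.mem_cons.1 hc with rfl | hc
            · rw [h6] at h3
              simp at h3
            · exact ih h5 c hc h6
        exact this stack hs c hc (by rw [e, h])
      · omega
    have htodo := core.idle b.1 hbr hbst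
    let P' := Function.update P b.1 (P a.1 ++ [b.1])
    have hP'b : P' b.1 = P a.1 ++ [b.1] := Function.update_self _ _ _
    have hP' : ∀ w, w ≠ b.1 → P' w = P w := fun w hw => Function.update_of_ne hw _ _
    have hPle : ∀ w, P w ≠ [] → P' w ≠ [] ∧ (P' w).length ≤ (P w).length := by
      intro w hw
      by_cases e : w = b.1
      · subst e
        rw [hP'b]
        refine ⟨by simp, ?_⟩
        rcases hc2 with h | h
        · exact absurd h hw
        · simp; omega
      · rw [hP' w e]
        exact ⟨hw, le_rfl⟩
    have hnode : ∀ (x : NodeState (N.deg b.1)) w, w ≠ b.1 →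
        Function.update g.node b.1 x w = g.node w := fun x w hw => Function.update_of_ne hw _ _
    have hpa : P a.1 ≠ [] := by
      intro h
      rw [h] at hst1
      simp at hst1
    refine invariant_advance hG hd h4 hB g (P := P') (stack := a :: stack)
      (by simp only [top]; rw [hab, N.opposite_opposite]) ?_
    have hoa : N.opposite a = b := by rw [hab, N.opposite_opposite]
    refine ⟨fun w => ?_, fun w => ?_, fun w => ?_, fun w => ?_, ?_, ?_, fun w => ?_,
      fun w h1 h2 => ?_, fun w q h1 => ?_, fun w p h1 => ?_, ⟨ha.symm, ?_, ?_, ?_⟩,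
      fun w h1 h2 => ?_, fun c => ?_, fun w p => ?_, core.small⟩
    · by_cases e : w = b.1
      · subst e
        rw [Function.update_self, hP'b]
        simp [ids]
      · rw [hnode _ w e, hP' w e, core.path]
    · by_cases e : w = b.1
      · subst e
        rw [Function.update_self]
        exact core.bags _
      · rw [hnode _ w e, core.bags]
    · by_cases e : w = b.1
      · subst e
        rw [Function.update_self]
        exact core.closed _
      · rw [hnode _ w e, core.closed]
    · by_cases e : w = b.1
      · subst e
        rw [Function.update_self]
        exact core.finished _
      · rw [hnode _ w e, core.finished]
    · rw [hP' r hbr.symm, core.path_root]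
    · rw [hnode _ r hbr.symm, core.parent_root]
    · by_cases e : w = b.1
      · subst e
        rw [hP'b]
        simpa using hc1
      · rw [hP' w e]
        exact core.length_le w
    · have e : w ≠ b.1 := by
        rintro rfl
        rw [Function.update_self] at h2
        cases h2
      rw [hnode _ w e] at h2
      rw [hP' w e]
      exact core.parent_none w h1 h2
    · by_cases e : w = b.1
      · subst e
        rw [Function.update_self] at h1
        obtain rfl : b.2 = q := Option.some.inj h1
        have hnb : N.neighbor b.1 b.2 = a.1 := (congrArg Sigma.fst hab).symm
        rw [hnb, hP' _ hne, hP'b]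
        exact ⟨hpa, by simp, fun _ => rfl⟩
      · rw [hnode _ w e] at h1
        obtain ⟨h5, h6, h7⟩ := core.parent w q h1
        rw [hP' w e]
        by_cases e' : N.neighbor w q = b.1
        · rw [e'] at h5 h6 ⊢
          -- If the improved node is the parent of `w`, the difference of lengths now exceeds one
          -- and the last clause becomes vacuous.
          have : (P' b.1).length < (P b.1).length := by
            rw [hP'b]
            rcases hc2 with h | h
            · exact absurd h h5
            · simpa using h
          exact ⟨(hPle _ h5).1, by omega, fun h => by omega⟩
        · rw [hP' _ e']
          exact ⟨h5, h6, h7⟩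
    · by_cases e : w = b.1
      · subst e
        left
        rw [Function.update_self]
        exact List.mem_finRange p
      · rw [hP' w e] at h1 ⊢
        rw [hnode _ w e]
        rcases core.covered w p h1 with h | h | h | h
        · exact Or.inl h
        · obtain rfl : a = ⟨w, p⟩ := Option.some.inj h
          have hnb : N.neighbor w p = b.1 := congrArg Sigma.fst hoa
          rw [hnb, hP'b]
          exact Or.inr (Or.inr (Or.inl ⟨by simp, by simp⟩))
        · have := hPle _ h.1
          exact Or.inr (Or.inr (Or.inl ⟨this.1, this.2.trans h.2⟩))
        · exact Or.inr (Or.inr (Or.inr h))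
    · rw [hoa, Function.update_self]
    · rw [hoa, hP'b, hP' _ hne]
      simp
    · refine core.isStack.congr (hP' r hbr.symm) (fun c hc => hP' _ (hbst c hc)) fun c hc => ?_
      rw [hnode _ _ (hbst c hc)]
    · have e : w ≠ b.1 := by
        rintro rfl
        exact h2 a List.mem_cons_self (by rw [hoa])
      rw [hnode _ w e]
      exact core.idle w h1 fun c hc => h2 c (List.mem_cons_of_mem _ hc)
    · rw [core.explores_eq, List.count_cons]
      simp only [Option.some.injEq, beq_iff_eq, reduceCtorEq, if_false]
      omega
    · have h1 := core.explores_le w p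
      by_cases e : w = b.1
      · subst e
        rw [Function.update_self]
        rw [htodo] at h1
        have h2 : (List.finRange (N.deg b.1)).count p ≤ 1 :=
          List.nodup_iff_count_le_one.1 (List.nodup_finRange _) p
        have h3 : (P' b.1).length = (P a.1).length + 1 := by rw [hP'b]; simp
        have h5 : P' b.1 ≠ [] := by rw [hP'b]; simp
        rw [if_neg h5]
        simp only [List.count_nil] at h1 ⊢
        split_ifs at h1 with h6
        · omega
        · rcases hc2 with h | h
          · exact absurd h h6
          · omega
      · rw [hnode _ w e, hP' w e]
        exact h1
  · have hupd : Function.update g.node b.1 (g.node b.1) = g.node := Function.update_eq_self _ _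
    refine .back P stack b (by rw [← hab, ha]) ?_ rfl
    simp only [Global.perform, Option.map_some, Option.toList_some, List.singleton_append, hupd]
    refine ⟨core.path, core.bags, core.closed, core.finished, core.path_root, core.parent_root,
      core.length_le, core.parent_none, core.parent, fun w p hw => ?_, core.isStack, core.idle,
      fun c => ?_, fun w p => ?_, ?_⟩
    · rcases core.covered w p hw with h | h | h
      · exact Or.inl h
      · obtain rfl : a = ⟨w, p⟩ := Option.some.inj h
        right
        right
        have hnb : N.neighbor w p = b.1 := by
          have : N.opposite ⟨w, p⟩ = b := by rw [hab, N.opposite_opposite]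
          exact congrArg Sigma.fst this
        rw [hnb]
        have := core.length_le w
        simp only at hcond
        by_cases h1 : (P w).length ≤ k
        · refine Or.inl ⟨fun h => hcond ⟨h1, Or.inl h⟩, ?_⟩
          by_contra h2
          exact hcond ⟨h1, Or.inr (by omega)⟩
        · exact Or.inr (by omega)
      · exact Or.inr (Or.inr h)
    · rw [explores_cons_back, replies_cons_back, core.explores_eq]
      have : b = N.opposite c ↔ a = c := by
        rw [hab]
        exact ⟨fun h => by rw [h, N.opposite_opposite], fun h => by rw [← h, N.opposite_opposite]⟩
      simp only [Option.some.injEq, this, reduceCtorEq, if_false]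
      omega
    · rw [explores_cons_back]
      exact core.explores_le w p
    · rintro x hx
      rcases List.mem_cons.1 hx with rfl | hx
      · exact isSmall_back h4
      · exact core.small x hx

theorem invariant_start : Invariant k B r (Global.start N r) := by
  classical
  let P : V → List V := fun v => if v = r then [r] else []
  have hPr : P r = [r] := if_pos rfl
  have hP : ∀ v, v ≠ r → P v = [] := fun v hv => if_neg hv
  refine invariant_advance hG hd h4 hB _ (P := P) (stack := []) rfl ?_
  refine ⟨fun v => ?_, fun v => ?_, fun v => ?_, fun v => ?_, hPr, ?_, fun v => ?_,
    fun v hv _ => hP v hv, fun v q h => ?_, fun v p h => ?_, trivial, fun v h1 h2 => ?_,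
    fun a => ?_, fun v p => ?_, by simp⟩
  · by_cases e : v = r
    · subst e
      rw [Function.update_self, hPr, ids_singleton]
    · rw [Function.update_of_ne e, hP v e]
      rfl
  · by_cases e : v = r
    · subst e
      rw [Function.update_self]
    · rw [Function.update_of_ne e]
  · by_cases e : v = r
    · subst e
      rw [Function.update_self]
    · rw [Function.update_of_ne e]
  · by_cases e : v = r
    · subst e
      rw [Function.update_self]
    · rw [Function.update_of_ne e]
  · rw [Function.update_self]
  · by_cases e : v = r
    · subst e
      rw [hPr]
      simp
    · rw [hP v e]
      simp
  · exfalso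
    by_cases e : v = r
    · subst e
      rw [Function.update_self] at h
      cases h
    · rw [Function.update_of_ne e] at h
      cases h
  · have e : v = r := by
      by_contra e
      exact h (hP v e)
    subst e
    left
    rw [Function.update_self]
    exact List.mem_finRange p
  · rw [Function.update_of_ne h1]
  · simp [explores, replies]
  · have h0 : explores ([] : List (N.Arc × Signal)) ⟨v, p⟩ = 0 := rfl
    rw [h0]
    by_cases e : v = r
    · subst e
      rw [Function.update_self, hPr, if_neg (by simp)]
      have h2 : (List.finRange (N.deg v)).count p ≤ 1 :=
        List.nodup_iff_count_le_one.1 (List.nodup_finRange _) p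
      simp only [List.length_singleton]
      omega
    · rw [Function.update_of_ne e, if_pos (hP v e)]
      simp

theorem invariant_deliver (hN : N.IsPlanarEmbedding) (hB' : Fintype.card N.Arc ≤ B) (g : Global N)
    (a : N.Arc) (m : Signal) (h : Invariant k B r g) (htok : g.token = some (a, m)) :
    Invariant k B r (g.deliver k a m) := by
  classical
  cases h with
  | explore P stack a' ha core token =>
    rw [token] at htok
    obtain ⟨rfl, rfl⟩ := Prod.mk.inj (Option.some.inj htok)
    exact invariant_deliver_explore hG hd h4 hB g ha core
  | back P stack a' ha core token =>
    rw [token] at htok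
    obtain ⟨rfl, rfl⟩ := Prod.mk.inj (Option.some.inj htok)
    rw [Global.deliver,
      step_of_not_finished _ _ _ (by rw [core.finished]; exact Bool.false_ne_true), react]
    refine invariant_advance hG hd h4 hB g (P := P) ha ?_
    rw [Function.update_eq_self]
    exact core
  | tour T p₀ hp₀ hk inv =>
    exact .tour T p₀ hp₀ hk (tourInvariant_deliver hG hN hp₀ hk h4 hB hB' g inv htok)
  | final final =>
    rw [final.token] at htok
    cases htok

end

theorem Invariant.load_le {g : Global N} (h : Invariant k B r g) (a : N.Arc) :
    load g.history a ≤ 2 * (k + 2) := by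
  cases h with
  | explore P stack a' ha core token => have := core.load_le a; omega
  | back P stack a' ha core token => have := core.load_le a; omega
  | tour T p₀ hp₀ hk inv =>
    cases inv with
    | probe t ht nodes history m hm token anchor => exact history.load_le ht ht.le a
    | ack t ht hc nodes history token anchor => exact history.load_le ht ht a
    | final final history => exact history.load_le le_rfl le_rfl a
  | final final load small => have := load a; omega

theorem Invariant.small {g : Global N} (h : Invariant k B r g) :
    ∀ x ∈ g.history, x.2.IsSmall k B := by
  cases h with
  | explore P stack a' ha core token => exact core.small
  | back P stack a' ha core token => exact core.small
  | tour T p₀ hp₀ hk inv =>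
    cases inv with
    | probe t ht nodes history m hm token anchor => exact history.small
    | ack t ht hc nodes history token anchor => exact history.small
    | final final history => exact history.small
  | final final load small => exact small

theorem Invariant.isFinal {g : Global N} (h : Invariant k B r g) (htok : g.token = none) :
    IsFinal k r g := by
  cases h with
  | explore P stack a' ha core token => rw [token] at htok; cases htok
  | back P stack a' ha core token => rw [token] at htok; cases htok
  | tour T p₀ hp₀ hk inv =>
    cases inv with
    | probe t ht nodes history m hm token anchor => rw [token] at htok; cases htok
    | ack t ht hc nodes history token anchor => rw [token] at htok; cases htok
    | final final history => exact final
  | final final load small => exact final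

end TourAlgorithm

/-! ### Messages, bits and time. -/

namespace TourAlgorithm

variable {V : Type*} [Fintype V] {G : SimpleGraph V} {N : Network G}

theorem length_eq_sum_load (h : List (N.Arc × Signal)) : h.length = ∑ a, load h a := by
  classical
  induction h with
  | nil => simp [load]
  | cons x h ih =>
    have : ∀ a, load (x :: h) a = load h a + if a = x.1 then 1 else 0 := by
      intro a
      rw [load, List.countP_cons, load]
      simp only [decide_eq_true_eq, eq_comm (a := a)]
    simp only [this, Finset.sum_add_distrib, Finset.sum_ite_eq', Finset.mem_univ, if_true]
    rw [List.length_cons, ih]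

theorem traffic_le {i : ℕ} {g : Global N} {c : N.Config algorithm} (h : Corresponds i g c)
    (e : N.Arc) :
    Network.traffic c e.1 (N.opposite e).1 ≤ load g.history e + load g.history (N.opposite e) := by
  classical
  have h1 : c.sent.map (fun q => q.arc) = ((g.history.map Prod.fst : List N.Arc) : Multiset _) := by
    have := congrArg (Multiset.map Prod.fst) h.sent
    simpa [Function.comp_def] using this
  have h2 : Network.traffic c e.1 (N.opposite e).1 =
      (c.sent.map fun q => q.arc).countP fun a => (a.1 = e.1 ∧ (N.opposite a).1 = (N.opposite e).1) ∨
        (a.1 = (N.opposite e).1 ∧ (N.opposite a).1 = e.1) := by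
    rw [Multiset.countP_map, Network.traffic]
  rw [h2, h1, Multiset.coe_countP, List.countP_map]
  generalize g.history = l
  induction l with
  | nil => simp
  | cons x l ih =>
    rw [load, load, List.countP_cons, List.countP_cons, List.countP_cons]
    rw [load, load] at ih
    have key : ((x.1.1 = e.1 ∧ (N.opposite x.1).1 = (N.opposite e).1) ∨
        (x.1.1 = (N.opposite e).1 ∧ (N.opposite x.1).1 = e.1)) →
        x.1 = e ∨ x.1 = N.opposite e := by
      rintro (⟨h3, h4⟩ | ⟨h3, h4⟩)
      · exact Or.inl (N.arc_ext h3 h4)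
      · exact Or.inr (N.arc_ext h3 (by rwa [N.opposite_opposite]))
    simp only [Function.comp_apply, decide_eq_true_eq]
    split_ifs <;> first | omega | tauto

/-- Since `7 * n < 2 ^ (Nat.log 2 n + 4)`, a number takes at most 2 log n + 9 bits, which is at most
11 log n because `2 ≤ n`. -/
theorem length_encode_le {k n : ℕ} (hn : 2 ≤ n) {m : Signal} (hm : m.IsSmall k (7 * n)) :
    (encode m).length ≤ 11 * (k + 3) * Nat.log 2 n := by
  refine (length_bitsOfNats_le _ hm.1 hm.2).trans ?_
  have h1 : 1 ≤ Nat.log 2 n := Nat.log_pos (by norm_num) hn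
  have h2 : (7 * n).size ≤ Nat.log 2 n + 4 := by
    rw [Nat.size_le]
    have := Nat.lt_pow_succ_log_self (b := 2) (by norm_num) n
    rw [pow_succ] at this
    rw [pow_add]
    omega
  calc (k + 3) * (2 * (7 * n).size + 1) ≤ (k + 3) * (11 * Nat.log 2 n) :=
        Nat.mul_le_mul_left _ (by omega)
    _ = 11 * (k + 3) * Nat.log 2 n := by ring

end TourAlgorithm

end

open TourAlgorithm in
theorem mainTheorem5 :
    ∃ A : DistributedAlgorithm, ∀ k : ℕ, ∃ C : ℕ,
      ∀ (V : Type*) [Fintype V] (G : SimpleGraph V) (N : Network G) (r : V),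
        G.Connected → (∀ u v, G.dist u v ≤ k) → N.IsPlanarEmbedding →
          N.AlwaysTerminates A k r ∧
          ∀ c : N.Config A, N.Reachable A k r c →
            (c.time ≤ C * Fintype.card V) ∧
            (∀ v w, G.Adj v w → Network.traffic c v w ≤ C) ∧
            (∀ q ∈ c.sent, q.content.length ≤ C * Nat.log 2 (Fintype.card V)) ∧
            (c.transit = 0 → N.HasConstructed A k r c) := by
  -- At most 6n arcs with at most 2(k + 2) messages each give 12(k + 2)n messages; a link carries at
  -- most 4(k + 2), and a message has at most 11(k + 3) log n bits.
  refine ⟨algorithm, fun k => ⟨12 * (k + 3), ?_⟩⟩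
  intro V _ G N r hG hd hN
  have hA := N.card_arc_le hG hN
  have hpos : 0 < Fintype.card V := Fintype.card_pos_iff.2 ⟨r⟩
  -- 7n bounds all numbers in messages: the tags of signals, the identifiers, and the indices of
  -- bags, which do not exceed the number of arcs.
  have h4 : 4 ≤ 7 * Fintype.card V := by omega
  have hB : Fintype.card V ≤ 7 * Fintype.card V := by omega
  have hB' : Fintype.card N.Arc ≤ 7 * Fintype.card V := by omega
  have hstart : Invariant k (7 * Fintype.card V) r (Global.start N r) :=
    invariant_start hG hd h4 hB
  have hdeliver := fun g a m => invariant_deliver (r := r) hG hd h4 hB hN hB' g a m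
  have hlength : ∀ g : Global N, Invariant k (7 * Fintype.card V) r g →
      g.history.length ≤ 12 * (k + 2) * Fintype.card V := by
    intro g hg
    rw [length_eq_sum_load]
    refine (Finset.sum_le_card_nsmul _ _ _ fun a _ => hg.load_le a).trans ?_
    rw [Finset.card_univ, smul_eq_mul]
    calc Fintype.card N.Arc * (2 * (k + 2)) ≤ 6 * Fintype.card V * (2 * (k + 2)) :=
          Nat.mul_le_mul_right _ hA
      _ = 12 * (k + 2) * Fintype.card V := by ring
  refine ⟨alwaysTerminates hstart hdeliver hlength, fun c hc => ?_⟩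
  obtain ⟨i, g, hg, hgc⟩ := exists_corresponds hstart hdeliver hc
  refine ⟨?_, fun v w hvw => ?_, fun q hq => ?_, fun htransit => ?_⟩
  · have h1 := hgc.length
    have h2 := hlength g hg
    have h3 : i ≤ 12 * (k + 3) * Fintype.card V :=
      le_trans (by omega) (h2.trans (Nat.mul_le_mul_right _ (by omega)))
    exact hgc.time.trans (by exact_mod_cast h3)
  · obtain ⟨e, rfl, rfl⟩ := N.exists_arc hvw
    have h1 := traffic_le hgc e
    have h2 := hg.load_le e
    have h3 := hg.load_le (N.opposite e)
    omega
  · have h1 : (q.arc, q.content) ∈ c.sent.map fun q => (q.arc, q.content) :=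
      Multiset.mem_map_of_mem _ hq
    rw [hgc.sent, Multiset.mem_coe, List.mem_map] at h1
    obtain ⟨x, hx, h2⟩ := h1
    -- A message needs a link, so there are two nodes and the logarithm is positive.
    have hn : 2 ≤ Fintype.card V :=
      Fintype.one_lt_card_iff.2 ⟨_, _, (N.adj_opposite q.arc).ne⟩
    rw [← (Prod.mk.inj h2).2]
    exact (length_encode_le hn (hg.small x hx)).trans
      (Nat.mul_le_mul_right _ (Nat.mul_le_mul_right _ (by norm_num)))
  · have htok : g.token = none := by
      cases h : g.token with
      | none => rfl
      | some x =>
        have := hgc.transit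
        rw [htransit, h, Option.elim_some] at this
        exact absurd this.symm (Multiset.singleton_ne_zero _)
    have hfinal := hg.isFinal htok
    refine ⟨_, fun v => ?_, hfinal.stores⟩
    refine (if_pos ?_).trans (congrArg (fun s => some (s.bags.map (Bag.store (3 * k))))
      (hgc.node v))
    exact (congrArg NodeState.finished (hgc.node v)).trans (hfinal.finished v)
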